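/- Let $\Omega=[0,2\pi]\times[0,\pi]$, let $b>0$, and suppose that $-b\notin\sigma(L)$, where $\sigma(L)$ is the set of eigenvalues of $L=\partial_t^2-\partial_x^2$ under the Dirichlet condition at $x=0,\pi$ and $2\pi$-periodicity in $t$. Let $f,g:\mathbb R\times[0,\pi]\times\mathbb R\to\mathbb R$ be $2\pi$-periodic in $t$, of class $C^1$ on $\Omega\times\mathbb R$, strictly increasing in $\xi$ for every $(t,x)$, and suppose that for some $p,q>1$, $c_0>0$ and all $t,x,\xi$: (h1) $|f(t,x,\xi)|\le c_0(1+|\xi|^p)$ and $|g(t,x,\xi)|\le c_0(1+|\xi|^q)$; (h2) $f(t,x,\xi)=o(|\xi|)$ and $g(t,x,\xi)=o(|\xi|)$ as $\xi\to0$, uniformly in $(t,x)$; (h3) $(p+1)\int_0^\xi f(t,x,s)\,ds\le f(t,x,\xi)\,\xi$ and $(q+1)\int_0^\xi g(t,x,s)\,ds\le g(t,x,\xi)\,\xi$. A weak solution of $$u_{tt}-u_{xx}+bu+\varepsilon v+f(t,x,u)=0,\qquad v_{tt}-v_{xx}+bv+\varepsilon u+g(t,x,v)=0,$$ $$u(t,0)=u(t,\pi)=v(t,0)=v(t,\pi)=0,\qquad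 u(t+2\pi,x)=u(t,x),\quad v(t+2\pi,x)=v(t,x)\qquad(1.1)$$ is a pair $(u,v)\in L^2(\Omega)\times L^2(\Omega)$ with $f(\cdot,\cdot,u),\,g(\cdot,\cdot,v)\in L^1(\Omega)$ such that $$\iint_\Omega\big[u(\varphi_{tt}-\varphi_{xx})+bu\varphi+\varepsilon v\varphi+f(t,x,u)\varphi\big]\,dt\,dx=0,\qquad \iint_\Omega\big[v(\psi_{tt}-\psi_{xx})+bv\psi+\varepsilon u\psi+g(t,x,v)\psi\big]\,dt\,dx=0$$ for all $C^2$ functions $\varphi,\psi$ that vanish at $x=0,\pi$ and are $2\pi$-periodic in $t$. Then there is $\varepsilon_0>0$ such that for every $\varepsilon\in\mathbb R$ with $|\varepsilon|<\varepsilon_0$, every weak solution $(u,v)$ of (1.1) is continuous on $\Omega$ (after modification on a null set). More precisely, almost everywhere on $\Omega$, $$u(t,x)=u_1(t,x)+p_0(t+x)-p_0(t-x),\qquad v(t,x)=v_1(t,x)+q_0(t+x)-q_0(t-x),$$ where $u_1,v_1$ are Lipschitz on $\Omega$ and orthogonal in $L^2(\Omega)$ to $\ker L=\overline{\mathrm{span}}\{\sin(jx)\cos(jt),\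 \sin(jx)\sin(jt): j\ge1\}$, and $p_0,q_0:\mathbb R\to\mathbb R$ are continuous, $2\pi$-periodic and of mean zero. -/

import Mathlib

open MeasureTheory Set
open scoped Real

noncomputable section

namespace KleinGordon

/-- The rectangle `Ω = [0, 2π] × [0, π]`; points are pairs `z = (t, x)`. -/
def Omega : Set (ℝ × ℝ) := Icc 0 (2 * π) ×ˢ Icc 0 π

/-- The d'Alembert operator `φ_tt - φ_xx`. -/
def dAlembert (φ : ℝ × ℝ → ℝ) (z : ℝ × ℝ) : ℝ :=
  iteratedDeriv 2 (fun t => φ (t, z.2)) z.1 - iteratedDeriv 2 (fun x => φ (z.1, x)) z.2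

/-- Functions of class `C²` satisfying the Dirichlet conditions `φ(t,0) = φ(t,π) = 0` and
the periodicity `φ(t+2π,x) = φ(t,x)` on `ℝ × [0,π]`. (All of them have finite norm
`∑_{j ≠ |k|} |j² - k² + b| |φ_jk|² + ∑_{j = |k|} |φ_jk|²`, as `φ` and `φ_tt - φ_xx` are
square integrable on `Ω`.) -/
structure IsTestFunction (φ : ℝ × ℝ → ℝ) : Prop where
  contDiff : ContDiff ℝ 2 φ
  dirichlet_zero : ∀ t : ℝ, φ (t, 0) = 0
  dirichlet_pi : ∀ t : ℝ, φ (t, π) = 0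
  periodic : ∀ t : ℝ, ∀ x ∈ Icc (0 : ℝ) π, φ (t + 2 * π, x) = φ (t, x)

/-- The set `σ(L)` of eigenvalues of `L = ∂_t² - ∂_x²` under the Dirichlet condition in `x`
and `2π`-periodicity in `t`. -/
def sigmaL : Set ℝ :=
  {l | ∃ φ : ℝ × ℝ → ℝ, IsTestFunction φ ∧
    (∃ t : ℝ, ∃ x ∈ Icc (0 : ℝ) π, φ (t, x) ≠ 0) ∧
    ∀ t : ℝ, ∀ x ∈ Icc (0 : ℝ) π, dAlembert φ (t, x) = l * φ (t, x)}

/-- The hypotheses on one nonlinearity `f(t,x,ξ)`, `t ∈ ℝ`, `x ∈ [0,π]`, `ξ ∈ ℝ`, with growth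
exponent `p` and growth constant `c₀`: continuity on `Ω × ℝ`, `2π`-periodicity in `t`,
polynomial growth, superlinearity at `ξ = 0`, the Ambrosetti-Rabinowitz condition, and
monotonicity in `ξ`. -/
structure IsSuperlinear (f : ℝ → ℝ → ℝ → ℝ) (p c₀ : ℝ) : Prop where
  continuousOn : ContinuousOn (fun z : (ℝ × ℝ) × ℝ => f z.1.1 z.1.2 z.2) (Omega ×ˢ univ)
  periodic : ∀ t : ℝ, ∀ x ∈ Icc (0 : ℝ) π, ∀ ξ : ℝ, f (t + 2 * π) x ξ = f t x ξ
  growth : ∀ t : ℝ, ∀ x ∈ Icc (0 : ℝ) π, ∀ ξ : ℝ, |f t x ξ| ≤ c₀ * (1 + |ξ| ^ p)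
  small_at_zero : ∀ δ > (0 : ℝ), ∃ r > (0 : ℝ), ∀ t : ℝ, ∀ x ∈ Icc (0 : ℝ) π, ∀ ξ : ℝ,
    |ξ| < r → |f t x ξ| ≤ δ * |ξ|
  ambrosetti_rabinowitz : ∀ t : ℝ, ∀ x ∈ Icc (0 : ℝ) π, ∀ ξ : ℝ,
    (p + 1) * (∫ s in (0 : ℝ)..ξ, f t x s) ≤ f t x ξ * ξ
  monotone : ∀ t : ℝ, ∀ x ∈ Icc (0 : ℝ) π, Monotone (f t x)

/-- `(u, v) ∈ L²(Ω) × L²(Ω)` is a weak solution of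
`u_tt - u_xx + b u + ε v + f(t,x,u) = 0`, `v_tt - v_xx + b v + ε u + g(t,x,v) = 0`
with Dirichlet conditions in `x` and period `2π` in `t`. The nonlinear terms are required to be
integrable, so that the integrals in the weak formulation are meaningful. -/
structure IsWeakSolution (b ε : ℝ) (f g : ℝ → ℝ → ℝ → ℝ) (u v : ℝ × ℝ → ℝ) : Prop where
  memLp_u : MemLp u 2 (volume.restrict Omega)
  memLp_v : MemLp v 2 (volume.restrict Omega)
  integrableOn_f : IntegrableOn (fun z => f z.1 z.2 (u z)) Omega
  integrableOn_g : IntegrableOn (fun z => g z.1 z.2 (v z)) Omega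
  eq_u : ∀ φ : ℝ × ℝ → ℝ, IsTestFunction φ →
    ∫ z in Omega, (u z * dAlembert φ z + b * u z * φ z + ε * v z * φ z
      + f z.1 z.2 (u z) * φ z) = 0
  eq_v : ∀ ψ : ℝ × ℝ → ℝ, IsTestFunction ψ →
    ∫ z in Omega, (v z * dAlembert ψ z + b * v z * ψ z + ε * u z * ψ z
      + g z.1 z.2 (v z) * ψ z) = 0

/-- `w` is orthogonal in `L²(Ω)` to `ker L`, the closed span of the functions
`sin(jx) cos(jt)` and `sin(jx) sin(jt)`, `j ≥ 1`. -/
def OrthogonalToKernel (w : ℝ × ℝ → ℝ) : Prop :=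
  MemLp w 2 (volume.restrict Omega) ∧ ∀ j : ℕ, 1 ≤ j →
    ∫ z in Omega, w z * (Real.sin (j * z.2) * Real.cos (j * z.1)) = 0 ∧
    ∫ z in Omega, w z * (Real.sin (j * z.2) * Real.sin (j * z.1)) = 0

/-- `w` coincides almost everywhere on `Ω` with a function that is continuous on `Ω`. -/
def IsContinuousOnOmega (w : ℝ × ℝ → ℝ) : Prop :=
  ∃ W : ℝ × ℝ → ℝ, ContinuousOn W Omega ∧ w =ᵐ[volume.restrict Omega] W

/-- `w = w₁ + y` almost everywhere on `Ω`, where the regular part `w₁ ∈ (ker L)^⊥` is Lipschitz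
on `Ω`, and the null part is `y(t,x) = P(t+x) - P(t-x)` with `P` continuous, `2π`-periodic and
of mean zero. -/
def HasRegularSplitting (w : ℝ × ℝ → ℝ) : Prop :=
  ∃ (w₁ : ℝ × ℝ → ℝ) (P : ℝ → ℝ),
    OrthogonalToKernel w₁ ∧ (∃ C : NNReal, LipschitzOnWith C w₁ Omega) ∧
    Continuous P ∧ Function.Periodic P (2 * π) ∧ (∫ s in (0 : ℝ)..(2 * π), P s) = 0 ∧
    w =ᵐ[volume.restrict Omega] fun z => w₁ z + (P (z.1 + z.2) - P (z.1 - z.2))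

end KleinGordon

end

/-! Continue `u` and `v` as odd `2π`-periodic functions of `x` and pass to the characteristic
coordinates `ξ = t + x`, `η = t - x`. The d'Alembertian becomes `4 ∂_ξ ∂_η` on a torus of side `4π`.
Convolution with a product of two sawtooth functions inverts it modulo functions of one variable, so
that `U = P(ξ) - P(η) + W`, where `P` is the mean of `U` in its second variable and `W` is the
convolution of the source `H = bU + εV + F(U)` (`IsWeakWave.decomposition`). The kernel is bounded,
hence `W` is bounded although `H` is only integrable (`abs_waveInverse_le`). Once `H` is bounded,
`W` is Lipschitz, because the sawtooth is Lipschitz under translation in `L¹`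
(`abs_waveInverse_sub_le`).

It remains to control the kernel profiles `P` and `Q` of `U` and `V`. Both `H` and `W` integrate to
zero against functions of one variable, hence so does `b(P(ξ) - P(η)) + ε(Q(ξ) - Q(η)) + F(U)`.
Monotonicity bounds `F(U)` from one side: where `P(ξ) > P(η)` one has `U > W`, thus `F(U) ≥ F(W) ≥
-C`, and symmetrically. Testing with `φ(ξ) - φ(η)`, `φ` the sign of `P` cut off at level `M`, and
adding the analogous relation for `Q`, the terms in `b` absorb the coupling as soon as `2|ε| < b`.
This gives `|P|, |Q| ≤ C / (b - 2|ε|)`, the maximum principle `abs_le_of_isMarginFree`.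

The same principle applies to the increments `P(· + h) - P`. Comparing `F` at the shifted and
unshifted points, with `F` locally Lipschitz and `W` Lipschitz, replaces `C` by a multiple of `h`,
so `P` agrees almost everywhere with a Lipschitz function (`exists_lipschitz_kernelPart`). Folding
the torus back onto the rectangle yields the splitting. -/

namespace KleinGordon

open Filter Topology Function

/-! ### Periodic functions on the line: integration over a period, mollification, the sawtooth. -/

section

/-- Lebesgue measure on one period `(0, T]`. -/
noncomputable abbrev periodMeasure (T : ℝ) : Measure ℝ := volume.restrict (Ioc 0 T)

/-- The representative of `x` modulo `T` in `[0, T)`. -/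
noncomputable def wrap (T x : ℝ) : ℝ := T * Int.fract (x / T)

/-- The `T`-periodic sawtooth of slope `1 / T`. -/
noncomputable def saw (T x : ℝ) : ℝ := Int.fract (x / T)

variable {T : ℝ}

lemma measurable_wrap : Measurable (wrap T) := by unfold wrap; fun_prop

@[fun_prop] lemma measurable_saw : Measurable (saw T) := by unfold saw; fun_prop

lemma saw_nonneg (x : ℝ) : 0 ≤ saw T x := Int.fract_nonneg _

lemma saw_le_one (x : ℝ) : saw T x ≤ 1 := (Int.fract_lt_one _).le

lemma abs_saw_le_one (x : ℝ) : |saw T x| ≤ 1 := by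
  rw [abs_of_nonneg (saw_nonneg x)]; exact saw_le_one x

lemma saw_periodic (hT : 0 < T) : Periodic (saw T) T := fun x => by
  simp [saw, add_div, hT.ne']

lemma wrap_periodic (hT : 0 < T) : Periodic (wrap T) T := fun x => by
  simp [wrap, add_div, hT.ne']

lemma wrap_eq_sub (hT : 0 < T) (x : ℝ) : wrap T x = x - ⌊x / T⌋ * T := by
  unfold wrap Int.fract; field_simp

lemma wrap_of_mem (hT : 0 < T) {x : ℝ} (hx : x ∈ Ico 0 T) : wrap T x = x := by
  have : Int.fract (x / T) = x / T :=
    Int.fract_eq_self.2 ⟨div_nonneg hx.1 hT.le, (div_lt_one hT).2 hx.2⟩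
  rw [wrap, this]; field_simp

lemma wrap_mem (hT : 0 < T) (x : ℝ) : wrap T x ∈ Ico 0 T :=
  ⟨mul_nonneg hT.le (Int.fract_nonneg _), by
    unfold wrap; nlinarith [Int.fract_lt_one (x / T)]⟩

lemma _root_.Function.Periodic.apply_wrap {α : Type*} {g : ℝ → α} (hT : 0 < T)
    (hg : Periodic g T) (x : ℝ) : g (wrap T x) = g x := by
  rw [wrap_eq_sub hT]; exact hg.sub_int_mul_eq _

lemma ae_periodMeasure_mem_Ioo : ∀ᵐ x ∂(periodMeasure T), x ∈ Ioo 0 T := by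
  rw [periodMeasure, ← restrict_Ioo_eq_restrict_Ioc]
  exact ae_restrict_mem measurableSet_Ioo

lemma ae_periodMeasure_wrap (hT : 0 < T) : ∀ᵐ x ∂(periodMeasure T), wrap T x = x := by
  filter_upwards [ae_periodMeasure_mem_Ioo] with x hx
  exact wrap_of_mem hT ⟨hx.1.le, hx.2⟩

lemma lintegral_Ioc_of_periodic (hT : 0 < T) {g : ℝ → ENNReal} (hg : Periodic g T) (a b : ℝ) :
    ∫⁻ x in Ioc a (a + T), g x = ∫⁻ x in Ioc b (b + T), g x := by
  have : VAddInvariantMeasure (AddSubgroup.zmultiples T) ℝ volume :=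
    ⟨fun c s _ => measure_preimage_add _ _ _⟩
  refine IsAddFundamentalDomain.setLIntegral_eq (G := AddSubgroup.zmultiples T)
    (isAddFundamentalDomain_Ioc hT a) (isAddFundamentalDomain_Ioc hT b) _ ?_
  rintro ⟨_, n, rfl⟩ x
  simpa [AddSubgroup.vadd_def, add_comm] using hg.zsmul n x

lemma lintegral_periodMeasure_add (hT : 0 < T) {g : ℝ → ENNReal} (hg : Periodic g T) (c : ℝ) :
    ∫⁻ x, g (x + c) ∂(periodMeasure T) = ∫⁻ x, g x ∂(periodMeasure T) := by
  have h1 : ∫⁻ x in Ioc 0 T, g (x + c) = ∫⁻ x in Ioc c (c + T), g x := by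
    have := (measurePreserving_add_right volume c).setLIntegral_comp_emb
      (MeasurableEquiv.addRight c).measurableEmbedding g (Ioc 0 T)
    rw [this]
    simp [add_comm]
  rw [periodMeasure, h1, lintegral_Ioc_of_periodic hT hg c 0, zero_add]

lemma lintegral_wrap (hT : 0 < T) (g : ℝ → ENNReal) :
    ∫⁻ x, g (wrap T x) ∂(periodMeasure T) = ∫⁻ x, g x ∂(periodMeasure T) := by
  refine lintegral_congr_ae ?_
  filter_upwards [ae_periodMeasure_wrap hT] with x hx
  rw [hx]

lemma measurePreserving_wrap_add (hT : 0 < T) (c : ℝ) :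
    MeasurePreserving (fun x => wrap T (x + c)) (periodMeasure T) (periodMeasure T) := by
  have hm : Measurable (fun x => wrap T (x + c)) := measurable_wrap.comp (measurable_add_const c)
  refine ⟨hm, Measure.ext_of_lintegral _ fun g hg => ?_⟩
  rw [lintegral_map hg hm, lintegral_periodMeasure_add hT
    (g := fun x => g (wrap T x)) (fun x => by simp only [wrap_periodic hT x]), lintegral_wrap hT]

lemma integral_periodMeasure_add (hT : 0 < T) {g : ℝ → ℝ} (hg : Periodic g T) (c : ℝ) :
    ∫ x, g (x + c) ∂(periodMeasure T) = ∫ x, g x ∂(periodMeasure T) := by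
  have h := hg.intervalIntegral_add_eq c 0
  rw [← intervalIntegral.integral_of_le hT.le, ← intervalIntegral.integral_of_le hT.le,
    intervalIntegral.integral_comp_add_right]
  simpa [add_comm] using h

lemma integral_periodMeasure_sub_left (hT : 0 < T) {g : ℝ → ℝ} (hg : Periodic g T) (c : ℝ) :
    ∫ x, g (c - x) ∂(periodMeasure T) = ∫ x, g x ∂(periodMeasure T) := by
  have h := hg.intervalIntegral_add_eq (c - T) 0
  rw [← intervalIntegral.integral_of_le hT.le, ← intervalIntegral.integral_of_le hT.le,
    intervalIntegral.integral_comp_sub_left]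
  simpa using h

lemma ae_of_ae_periodMeasure (hT : 0 < T) {p : ℝ → Prop} (hp : Periodic p T)
    (h : ∀ᵐ x ∂(periodMeasure T), p x) : ∀ᵐ x : ℝ, p x := by
  rw [ae_iff] at h ⊢
  have hcover : {x | ¬ p x} ⊆ ⋃ n : ℤ, (fun x => x + n * T) '' ({x | ¬ p x} ∩ Ioc 0 T) := by
    intro x hx
    obtain ⟨y, hy, m, hm⟩ : ∃ y ∈ Ioc 0 T, ∃ m : ℤ, x = y + m * T := by
      refine ⟨toIocMod hT 0 x, by simpa using toIocMod_mem_Ioc hT 0 x, toIocDiv hT 0 x, ?_⟩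
      simp
    refine mem_iUnion.2 ⟨m, y, ⟨?_, hy⟩, hm.symm⟩
    have := hp.int_mul m y
    rw [mem_ofPred_eq, hm] at hx
    rw [mem_ofPred_eq]
    rwa [this] at hx
  refine measure_mono_null hcover (measure_iUnion_null fun n => ?_)
  rw [image_add_right, measure_preimage_add_right]
  rw [periodMeasure, Measure.restrict_apply₀' measurableSet_Ioc.nullMeasurableSet] at h
  exact h

lemma ae_periodMeasure_of_ae {p : ℝ → Prop} (h : ∀ᵐ x : ℝ, p x) :
    ∀ᵐ x ∂(periodMeasure T), p x := ae_restrict_of_ae h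

lemma locallyIntegrable_of_periodic (hT : 0 < T) {P : ℝ → ℝ} (hP : Periodic P T)
    (hi : Integrable P (periodMeasure T)) : LocallyIntegrable P := by
  have h0 : IntervalIntegrable P volume 0 (0 + T) := by
    rw [zero_add, intervalIntegrable_iff_integrableOn_Ioc_of_le hT.le]; exact hi
  refine locallyIntegrable_iff.2 fun K hK => ?_
  obtain ⟨a, b, hab⟩ : ∃ a b : ℝ, K ⊆ Icc a b := by
    obtain ⟨R, hR⟩ := hK.isBounded.subset_closedBall 0
    exact ⟨0 - R, 0 + R, by rwa [Real.closedBall_eq_Icc] at hR⟩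
  have := (hP.intervalIntegrable hT.ne' h0 a (max a b))
  rw [intervalIntegrable_iff_integrableOn_Icc_of_le (le_max_left _ _)] at this
  exact this.mono_set (hab.trans (Icc_subset_Icc_right (le_max_right _ _)))

/-- Mollification of a periodic function: bounds on the function and on its increments are
inherited by the mollified functions. -/
lemma exists_mollification {P : ℝ → ℝ} (hP : LocallyIntegrable P) (hper : Periodic P T) :
    ∃ Q : ℕ → ℝ → ℝ, (∀ n, ContDiff ℝ 2 (Q n)) ∧ (∀ n, Periodic (Q n) T) ∧
      (∀ᵐ s : ℝ, Tendsto (fun n => Q n s) atTop (𝓝 (P s))) ∧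
      (∀ h c : ℝ, (∀ᵐ s : ℝ, |P (s + h) - P s| ≤ c) → ∀ n s, |Q n (s + h) - Q n s| ≤ c) ∧
      (∀ C : ℝ, (∀ᵐ s : ℝ, |P s| ≤ C) → ∀ n s, |Q n s| ≤ C) := by
  let φ : ℕ → ContDiffBump (0 : ℝ) := fun n =>
    ⟨1 / (n + 1), 2 / (n + 1), by positivity, by gcongr; norm_num⟩
  have hφ : Tendsto (fun n => (φ n).rOut) atTop (𝓝 0) := by
    have := (tendsto_one_div_add_atTop_nhds_zero_nat (𝕜 := ℝ)).const_mul 2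
    simpa [φ, div_eq_mul_inv] using this
  -- A bounded ratio of outer to inner radius is what makes the mollified functions converge at
  -- almost every point for a merely locally integrable `P`.
  have hφ' : ∀ᶠ n in atTop, (φ n).rOut ≤ 2 * (φ n).rIn := by
    refine Eventually.of_forall fun n => ?_
    simp only [φ]; exact le_of_eq (by ring)
  let Q : ℕ → ℝ → ℝ := fun n s => ∫ r, (φ n).normed volume r * P (s - r)
  have hQ : ∀ n, Q n = convolution ((φ n).normed volume) P (ContinuousLinearMap.lsmul ℝ ℝ)
      volume := by
    intro n; ext s; simp [Q, convolution]
  have hbd : ∀ (n : ℕ) (g : ℝ → ℝ) (c : ℝ), (∀ᵐ r : ℝ, |g r| ≤ c) →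
      |∫ r, (φ n).normed volume r * g r| ≤ c := by
    intro n g c hg
    have h1 : ∀ᵐ r : ℝ, ‖(φ n).normed volume r * g r‖ ≤ (φ n).normed volume r * c := by
      filter_upwards [hg] with r hr
      rw [Real.norm_eq_abs, abs_mul, abs_of_nonneg ((φ n).nonneg_normed r)]
      exact mul_le_mul_of_nonneg_left hr ((φ n).nonneg_normed r)
    have := norm_integral_le_of_norm_le ((φ n).integrable_normed.mul_const c) h1
    rwa [integral_mul_const, (φ n).integral_normed, one_mul] at this
  have hint : ∀ n s, Integrable (fun r => (φ n).normed volume r * P (s - r)) := by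
    intro n s
    have := ((φ n).hasCompactSupport_normed (μ := volume)).convolutionExists_left
      (ContinuousLinearMap.lsmul ℝ ℝ) ((φ n).continuous_normed) hP s
    simpa [ConvolutionExistsAt] using this
  refine ⟨Q, fun n => ?_, fun n s => ?_, ?_, fun h c hc n s => ?_, fun C hC n s => ?_⟩
  · rw [hQ]
    exact ((φ n).hasCompactSupport_normed (μ := volume)).contDiff_convolution_left _
      ((φ n).contDiff_normed) hP
  · simp only [Q]
    congr 1; ext r
    rw [show s + T - r = (s - r) + T by ring, hper]
  · have := ContDiffBump.ae_convolution_tendsto_right_of_locallyIntegrable hφ hφ' hP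
    simpa only [← hQ] using this
  · simp only [Q]
    rw [← integral_sub (hint n _) (hint n _)]
    simp_rw [← mul_sub]
    refine hbd n _ c ?_
    have := (Measure.measurePreserving_sub_left (volume : Measure ℝ) s).quasiMeasurePreserving.ae hc
    filter_upwards [this] with r hr
    rwa [show s + h - r = s - r + h by ring]
  · refine hbd n _ C ?_
    exact (Measure.measurePreserving_sub_left (volume : Measure ℝ) s).quasiMeasurePreserving.ae hC

lemma integrable_of_abs_le {α : Type*} [MeasurableSpace α] {μ : Measure α} [IsFiniteMeasure μ]
    {f : α → ℝ} (hf : AEStronglyMeasurable f μ) {C : ℝ} (hC : ∀ᵐ x ∂μ, |f x| ≤ C) :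
    Integrable f μ :=
  Integrable.of_bound hf C hC

/-- The values on one period are continued periodically through `wrap` and then mollified. Since `ψ`
itself need not be periodic, convergence holds on that period only. -/
lemma exists_smooth_approx (hT : 0 < T) {ψ : ℝ → ℝ} (hψ : Measurable ψ) {C : ℝ}
    (hC : ∀ x, |ψ x| ≤ C) :
    ∃ Q : ℕ → ℝ → ℝ, (∀ n, ContDiff ℝ 2 (Q n)) ∧ (∀ n, Periodic (Q n) T) ∧
      (∀ n s, |Q n s| ≤ C) ∧
      (∀ᵐ s ∂(periodMeasure T), Tendsto (fun n => Q n s) atTop (𝓝 (ψ s))) := by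
  have hper : Periodic (fun x => ψ (wrap T x)) T := fun x => by
    simp only [wrap_periodic hT x]
  have hi : Integrable (fun x => ψ (wrap T x)) (periodMeasure T) :=
    integrable_of_abs_le (hψ.comp measurable_wrap).aestronglyMeasurable
      (Eventually.of_forall fun x => hC _)
  obtain ⟨Q, h1, h2, h3, -, h5⟩ :=
    exists_mollification (locallyIntegrable_of_periodic hT hper hi) hper
  refine ⟨Q, h1, h2, h5 C (Eventually.of_forall fun x => hC _), ?_⟩
  filter_upwards [ae_periodMeasure_of_ae h3, ae_periodMeasure_wrap hT] with s hs hw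
  rwa [hw] at hs

/-- A periodic function whose increments satisfy a Lipschitz bound almost everywhere agrees almost
everywhere with a Lipschitz periodic function. -/
lemma exists_lipschitz_representative (hT : 0 < T) {P : ℝ → ℝ} (hper : Periodic P T)
    (hi : Integrable P (periodMeasure T)) {L : NNReal}
    (hL : ∀ h : ℝ, 0 ≤ h → ∀ᵐ s : ℝ, |P (s + h) - P s| ≤ L * h) :
    ∃ R : ℝ → ℝ, LipschitzWith L R ∧ Periodic R T ∧ P =ᵐ[volume] R := by
  obtain ⟨Q, h1, h2, h3, h4, -⟩ :=
    exists_mollification (locallyIntegrable_of_periodic hT hper hi) hper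
  let E : Set ℝ := {s | Tendsto (fun n => Q n s) atTop (𝓝 (P s))}
  have hQ : ∀ n s s', |Q n s - Q n s'| ≤ L * |s - s'| := by
    intro n s s'
    rcases le_total s' s with h | h
    · have := h4 (s - s') _ (hL _ (sub_nonneg.2 h)) n s'
      rw [abs_of_nonneg (sub_nonneg.2 h)]
      simpa using this
    · have := h4 (s' - s) _ (hL _ (sub_nonneg.2 h)) n s
      rw [abs_sub_comm, abs_sub_comm s, abs_of_nonneg (sub_nonneg.2 h)]
      simpa using this
  -- The mollified functions share the Lipschitz constant `L`, which survives in the limit on the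
  -- set of convergence. This set has full measure, and `P` extends from it as a Lipschitz function.
  have hE : LipschitzOnWith L P E := by
    refine LipschitzOnWith.of_dist_le_mul fun x hx y hy => ?_
    rw [Real.dist_eq, Real.dist_eq]
    exact le_of_tendsto (Tendsto.abs (hx.sub hy)) (Eventually.of_forall fun n => hQ n x y)
  obtain ⟨R, hR, hPR⟩ := hE.extend_real
  have hae : P =ᵐ[volume] R := by filter_upwards [h3] with s hs using hPR hs
  refine ⟨R, hR, ?_, hae⟩
  have h5 : (fun s => R (s + T)) =ᵐ[volume] R := by
    have := (measurePreserving_add_right (volume : Measure ℝ) T).quasiMeasurePreserving.ae hae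
    filter_upwards [hae, this] with s hs hs'
    rw [← hs, ← hs', hper]
  exact congrFun ((hR.continuous.comp (continuous_add_const T)).ae_eq_iff_eq volume
    hR.continuous |>.1 h5)

/-- For `y ≤ x` the difference of the sawteeth is `a - k` with `a = (x - y) / T` and an integer `k ≥
0` counting jumps, so its modulus is at most `a + k = 2a - (a - k)`. The last bracket integrates to
zero over a period. -/
lemma integral_abs_saw_sub_le (hT : 0 < T) (x y : ℝ) :
    ∫ s, |saw T (x - s) - saw T (y - s)| ∂(periodMeasure T) ≤ 2 * |x - y| := by
  wlog hxy : y ≤ x generalizing x y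
  · have := this y x (le_of_not_ge hxy)
    rw [abs_sub_comm x y]
    simpa only [abs_sub_comm (saw T (x - _))] using this
  have hi : ∀ z, Integrable (fun s => saw T (z - s)) (periodMeasure T) := fun z =>
    integrable_of_abs_le
      (measurable_saw.comp (measurable_const.sub measurable_id)).aestronglyMeasurable
      (Eventually.of_forall fun _ => abs_saw_le_one _)
  have hpt : ∀ s, |saw T (x - s) - saw T (y - s)| ≤
      2 * ((x - y) / T) - (saw T (x - s) - saw T (y - s)) := by
    intro s
    have hfl : (⌊(y - s) / T⌋ : ℝ) ≤ ⌊(x - s) / T⌋ := by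
      exact_mod_cast Int.floor_le_floor (by gcongr)
    have h0 : 0 ≤ (x - y) / T := div_nonneg (sub_nonneg.2 hxy) hT.le
    have h1 : saw T (x - s) - saw T (y - s) =
        (x - y) / T - ((⌊(x - s) / T⌋ : ℝ) - ⌊(y - s) / T⌋) := by
      simp only [saw, Int.fract]; ring
    rw [abs_le]
    constructor <;> linarith
  calc ∫ s, |saw T (x - s) - saw T (y - s)| ∂(periodMeasure T)
      ≤ ∫ s, (2 * ((x - y) / T) - (saw T (x - s) - saw T (y - s))) ∂(periodMeasure T) :=
        integral_mono ((hi x).sub (hi y)).abs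
          ((integrable_const _).sub ((hi x).sub (hi y))) hpt
    _ = 2 * |x - y| := by
        have e : ∫ s, (2 * ((x - y) / T) - (saw T (x - s) - saw T (y - s))) ∂(periodMeasure T) =
            (∫ s, 2 * ((x - y) / T) ∂(periodMeasure T)) -
              ∫ s, (saw T (x - s) - saw T (y - s)) ∂(periodMeasure T) :=
          integral_sub (integrable_const _) ((hi x).sub (hi y))
        rw [e, integral_sub (hi x) (hi y),
          integral_periodMeasure_sub_left hT (saw_periodic hT),
          integral_periodMeasure_sub_left hT (saw_periodic hT), abs_of_nonneg (sub_nonneg.2 hxy)]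
        simp [Measure.real, hT.le]
        field_simp

/-- The periodic antiderivative of `ψ - mean ψ` as an integral against the sawtooth. -/
lemma integral_saw_mul (hT : 0 < T) {ψ : ℝ → ℝ} (hψ : Integrable ψ (periodMeasure T))
    {s : ℝ} (hs : s ∈ Ioc 0 T) :
    ∫ x, saw T (x - s) * ψ x ∂(periodMeasure T) =
      (∫ x, x / T * ψ x ∂(periodMeasure T)) +
        ∫ x in (0 : ℝ)..s, (ψ x - (∫ y, ψ y ∂(periodMeasure T)) / T) := by
  -- For `x` and `s` in one period, `saw T (x - s)` is `(x - s) / T` plus the indicator of `x < s`.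
  -- The indicator produces the antiderivative and the linear term in `s` subtracts the mean.
  have hsaw : ∀ x ∈ Ioc 0 T, saw T (x - s) * ψ x =
      (x / T * ψ x - s / T * ψ x) + (Iio s).indicator ψ x := by
    intro x hx
    by_cases hxs : x < s
    · have : saw T (x - s) = (x - s) / T + 1 := by
        rw [saw, ← Int.fract_add_one, Int.fract_eq_self]
        constructor
        · rw [div_add_one hT.ne']; exact div_nonneg (by linarith [hx.1, hs.2]) hT.le
        · have : (x - s) / T < 0 := div_neg_of_neg_of_pos (by linarith) hT
          linarith
      rw [this, indicator_of_mem (by exact hxs)]; ring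
    · have : saw T (x - s) = (x - s) / T := by
        rw [saw, Int.fract_eq_self]
        exact ⟨div_nonneg (by linarith) hT.le, (div_lt_one hT).2 (by linarith [hx.2, hs.1])⟩
      rw [this, indicator_of_notMem (by exact hxs)]; ring
  have i1 : Integrable (fun x => x / T * ψ x) (periodMeasure T) := by
    refine hψ.bdd_mul (c := 1) (by fun_prop) ?_
    filter_upwards [ae_restrict_mem measurableSet_Ioc] with x hx
    rw [Real.norm_eq_abs, abs_of_nonneg (div_nonneg hx.1.le hT.le)]
    exact (div_le_one hT).2 hx.2
  have i2 : Integrable (fun x => s / T * ψ x) (periodMeasure T) := hψ.const_mul _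
  have i3 : Integrable ((Iio s).indicator ψ) (periodMeasure T) := hψ.indicator measurableSet_Iio
  have hI : IntervalIntegrable ψ volume 0 s := by
    rw [intervalIntegrable_iff_integrableOn_Ioc_of_le hs.1.le]
    exact IntegrableOn.mono_set (t := Ioc 0 T) hψ (Ioc_subset_Ioc_right hs.2)
  have e : ∫ x, ((x / T * ψ x - s / T * ψ x) + (Iio s).indicator ψ x) ∂(periodMeasure T) =
      (∫ x, (x / T * ψ x - s / T * ψ x) ∂(periodMeasure T)) +
        ∫ x, (Iio s).indicator ψ x ∂(periodMeasure T) := integral_add (i1.sub i2) i3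
  rw [setIntegral_congr_fun measurableSet_Ioc hsaw, e, integral_sub i1 i2, integral_const_mul, intervalIntegral.integral_sub hI (by simp),
    intervalIntegral.integral_const, setIntegral_indicator measurableSet_Iio,
    show Ioc 0 T ∩ Iio s = Ioo 0 s by
      ext x; simp only [mem_inter_iff, mem_Ioc, mem_Iio, mem_Ioo]
      exact ⟨fun h => ⟨h.1.1, h.2⟩, fun h => ⟨⟨h.1, h.2.le.trans hs.2⟩, h.2⟩⟩,
    ← integral_Ioc_eq_integral_Ioo, intervalIntegral.integral_of_le hs.1.le]
  simp only [sub_zero, smul_eq_mul]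
  ring

end

/-! ### The weak wave equation on the torus and its inversion by the sawtooth kernel. -/

section

/-- Lebesgue measure on the square `(0, T] × (0, T]`. -/
noncomputable abbrev squareMeasure (T : ℝ) : Measure (ℝ × ℝ) :=
  (periodMeasure T).prod (periodMeasure T)

/-- The weak form of `4 ∂₁∂₂U + H = 0` on the torus `(ℝ / Tℤ)²`, tested against products. -/
def IsWeakWave (T : ℝ) (U H : ℝ × ℝ → ℝ) : Prop :=
  ∀ A B : ℝ → ℝ, ContDiff ℝ 2 A → ContDiff ℝ 2 B → Periodic A T → Periodic B T →
    ∫ z, (4 * U z * (deriv A z.1 * deriv B z.2) + H z * (A z.1 * B z.2)) ∂(squareMeasure T) = 0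

/-- The inverse of `-4 ∂₁∂₂` on the torus, modulo functions of one variable. -/
noncomputable def waveInverse (T : ℝ) (H : ℝ × ℝ → ℝ) (ζ : ℝ × ℝ) : ℝ :=
  -(1 / 4) * ∫ s, saw T (ζ.1 - s.1) * saw T (ζ.2 - s.2) * H s ∂(squareMeasure T)

/-- Integration against the sawtooth in the first variable. -/
noncomputable def sawIntegral (T : ℝ) (ψ : ℝ → ℝ) (s : ℝ) : ℝ :=
  ∫ x, saw T (x - s) * ψ x ∂(periodMeasure T)

/-- The mean over a period. -/
noncomputable def periodMean (T : ℝ) (ψ : ℝ → ℝ) : ℝ := (∫ x, ψ x ∂(periodMeasure T)) / T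

variable {T : ℝ} {U H : ℝ × ℝ → ℝ}

lemma ae_square_fst {p : ℝ → Prop} (h : ∀ᵐ x ∂(periodMeasure T), p x) :
    ∀ᵐ z ∂(squareMeasure T), p z.1 := Measure.quasiMeasurePreserving_fst.ae h

lemma ae_square_snd {p : ℝ → Prop} (h : ∀ᵐ x ∂(periodMeasure T), p x) :
    ∀ᵐ z ∂(squareMeasure T), p z.2 := Measure.quasiMeasurePreserving_snd.ae h

lemma integrable_mul_fst (hH : Integrable H (squareMeasure T)) {ψ : ℝ → ℝ} (hψ : Measurable ψ)
    {C : ℝ} (hC : ∀ x, |ψ x| ≤ C) : Integrable (fun z => H z * ψ z.1) (squareMeasure T) :=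
  hH.mul_bdd (c := C) (hψ.comp measurable_fst).aestronglyMeasurable
    (Eventually.of_forall fun _ => hC _)

lemma integrable_mul_snd (hH : Integrable H (squareMeasure T)) {ψ : ℝ → ℝ} (hψ : Measurable ψ)
    {C : ℝ} (hC : ∀ x, |ψ x| ≤ C) : Integrable (fun z => H z * ψ z.2) (squareMeasure T) :=
  hH.mul_bdd (c := C) (hψ.comp measurable_snd).aestronglyMeasurable
    (Eventually.of_forall fun _ => hC _)

lemma integral_mul_fst_eq_zero_of_smooth (hT : 0 < T) (hH : Integrable H (squareMeasure T))
    (h : ∀ A : ℝ → ℝ, ContDiff ℝ 2 A → Periodic A T →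
      ∫ z, H z * A z.1 ∂(squareMeasure T) = 0)
    {ψ : ℝ → ℝ} (hψ : Measurable ψ) {C : ℝ} (hC : ∀ x, |ψ x| ≤ C) :
    ∫ z, H z * ψ z.1 ∂(squareMeasure T) = 0 := by
  obtain ⟨Q, h1, h2, h3, h4⟩ := exists_smooth_approx hT hψ hC
  have hlim : Tendsto (fun n => ∫ z, H z * Q n z.1 ∂(squareMeasure T)) atTop
      (𝓝 (∫ z, H z * ψ z.1 ∂(squareMeasure T))) := by
    refine tendsto_integral_of_dominated_convergence (fun z => |H z| * C) (fun n => ?_)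
      (hH.abs.mul_const C) (fun n => Eventually.of_forall fun z => ?_) ?_
    · exact (integrable_mul_fst hH (h1 n).continuous.measurable (h3 n)).aestronglyMeasurable
    · rw [Real.norm_eq_abs, abs_mul]
      exact mul_le_mul_of_nonneg_left (h3 n _) (abs_nonneg _)
    · filter_upwards [ae_square_fst h4] with z hz using hz.const_mul _
  simp only [fun n => h (Q n) (h1 n) (h2 n)] at hlim
  exact (tendsto_nhds_unique hlim tendsto_const_nhds)

/-- A constant second test factor annihilates the derivative term, leaving only the source. -/
lemma IsWeakWave.integral_mul_fst (hT : 0 < T) (hw : IsWeakWave T U H)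
    (hH : Integrable H (squareMeasure T)) {ψ : ℝ → ℝ} (hψ : Measurable ψ) {C : ℝ}
    (hC : ∀ x, |ψ x| ≤ C) : ∫ z, H z * ψ z.1 ∂(squareMeasure T) = 0 :=
  integral_mul_fst_eq_zero_of_smooth hT hH (fun A hA hp => by
    simpa using hw A (fun _ => 1) hA contDiff_const hp (fun _ => rfl)) hψ hC

lemma integral_square_swap (F : ℝ × ℝ → ℝ) :
    ∫ z, F z.swap ∂(squareMeasure T) = ∫ z, F z ∂(squareMeasure T) := integral_prod_swap F

lemma IsWeakWave.swap (hw : IsWeakWave T U H) :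
    IsWeakWave T (fun z => U z.swap) (fun z => H z.swap) := fun A B hA hB hpA hpB => by
  have := hw B A hB hA hpB hpA
  rw [← integral_square_swap] at this
  simpa [mul_comm] using this

lemma IsWeakWave.integral_mul_snd (hT : 0 < T) (hw : IsWeakWave T U H)
    (hH : Integrable H (squareMeasure T)) {ψ : ℝ → ℝ} (hψ : Measurable ψ) {C : ℝ}
    (hC : ∀ x, |ψ x| ≤ C) : ∫ z, H z * ψ z.2 ∂(squareMeasure T) = 0 := by
  rw [← integral_square_swap]
  exact hw.swap.integral_mul_fst hT hH.swap hψ hC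

lemma sawIntegral_bound {ψ : ℝ → ℝ} {C : ℝ} (hT : 0 < T) (hC : ∀ x, |ψ x| ≤ C) (s : ℝ) :
    |sawIntegral T ψ s| ≤ C * T := by
  have := norm_integral_le_of_norm_le_const (μ := periodMeasure T) (C := C)
    (f := fun x => saw T (x - s) * ψ x) (Eventually.of_forall fun x => by
      rw [norm_mul, Real.norm_eq_abs, Real.norm_eq_abs]
      calc _ ≤ 1 * C := mul_le_mul (abs_saw_le_one _) (hC x) (abs_nonneg _) zero_le_one
        _ = C := one_mul _)
  simpa [Measure.real, hT.le, sawIntegral] using this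

lemma measurable_sawIntegral {ψ : ℝ → ℝ} (hψ : Measurable ψ) : Measurable (sawIntegral T ψ) := by
  have hm : Measurable (fun p : ℝ × ℝ => saw T (p.2 - p.1) * ψ p.2) :=
    (measurable_saw.comp (measurable_snd.sub measurable_fst)).mul (hψ.comp measurable_snd)
  exact (hm.stronglyMeasurable.integral_prod_right (ν := periodMeasure T)).measurable

/-- A smooth periodic `ψ` has the smooth periodic function `sawIntegral T ψ` as an antiderivative
of `ψ - mean ψ`, up to modification outside `(0, T]`. -/
lemma exists_smooth_sawIntegral (hT : 0 < T) {ψ : ℝ → ℝ} (hψ : ContDiff ℝ 2 ψ)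
    (hp : Periodic ψ T) :
    ∃ A : ℝ → ℝ, ContDiff ℝ 2 A ∧ Periodic A T ∧ (∀ s, deriv A s = ψ s - periodMean T ψ) ∧
      ∀ s ∈ Ioc 0 T, A s = sawIntegral T ψ s := by
  have hc : Continuous (fun x => ψ x - periodMean T ψ) := hψ.continuous.sub continuous_const
  -- The additive constant is the one of `integral_saw_mul`, chosen so that `A` agrees with
  -- `sawIntegral T ψ` on the period.
  let A : ℝ → ℝ := fun s => (∫ x, x / T * ψ x ∂(periodMeasure T)) +
    ∫ x in (0 : ℝ)..s, (ψ x - periodMean T ψ)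
  have hd : ∀ s, HasDerivAt A (ψ s - periodMean T ψ) s := fun s =>
    (intervalIntegral.integral_hasDerivAt_right (hc.intervalIntegrable _ _)
      hc.stronglyMeasurable.stronglyMeasurableAtFilter hc.continuousAt).const_add _
  have hψi : Integrable ψ (periodMeasure T) :=
    (hψ.continuous.integrableOn_Icc (a := 0) (b := T)).mono_set Ioc_subset_Icc_self
  refine ⟨A, ?_, fun s => ?_, fun s => (hd s).deriv, fun s hs => ?_⟩
  · have : deriv A = fun s => ψ s - periodMean T ψ := funext fun s => (hd s).deriv
    rw [show (2 : WithTop ℕ∞) = 1 + 1 by norm_num, contDiff_succ_iff_deriv]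
    refine ⟨fun s => (hd s).differentiableAt, by simp, ?_⟩
    rw [this]
    exact (hψ.of_le (by norm_num)).sub contDiff_const
  · have hp' : Periodic (fun x => ψ x - periodMean T ψ) T := fun x => by simp only [hp x]
    have h0 : ∫ x in s..(s + T), (ψ x - periodMean T ψ) = 0 := by
      rw [hp'.intervalIntegral_add_eq s 0, zero_add, intervalIntegral.integral_sub
        (hψ.continuous.intervalIntegrable _ _) (by simp), intervalIntegral.integral_const,
        intervalIntegral.integral_of_le hT.le, periodMean]
      simp only [sub_zero, smul_eq_mul]
      field_simp
      simp
    simp only [A]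
    rw [← intervalIntegral.integral_add_adjacent_intervals (hc.intervalIntegrable 0 s)
      (hc.intervalIntegrable s (s + T)), h0, add_zero]
  · exact (integral_saw_mul hT hψi hs).symm

lemma tendsto_integral_mul_of_bounded {ψ : ℝ → ℝ} {Q : ℕ → ℝ → ℝ} {C : ℝ}
    (hm : ∀ n, Measurable (Q n)) (hC : ∀ n s, |Q n s| ≤ C)
    (hQ : ∀ᵐ s ∂(periodMeasure T), Tendsto (fun n => Q n s) atTop (𝓝 (ψ s)))
    {g : ℝ → ℝ} (hg : Measurable g) (hg1 : ∀ x, |g x| ≤ 1) :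
    Tendsto (fun n => ∫ x, g x * Q n x ∂(periodMeasure T)) atTop
      (𝓝 (∫ x, g x * ψ x ∂(periodMeasure T))) := by
  refine tendsto_integral_of_dominated_convergence (fun _ => C)
    (fun n => (hg.mul (hm n)).aestronglyMeasurable) (integrable_const C)
    (fun n => Eventually.of_forall fun x => ?_) ?_
  · rw [norm_mul, Real.norm_eq_abs, Real.norm_eq_abs]
    calc _ ≤ 1 * C := mul_le_mul (hg1 x) (hC n x) (abs_nonneg _) zero_le_one
      _ = C := one_mul _
  · filter_upwards [hQ] with s hs using hs.const_mul _

lemma abs_periodMean_le (hT : 0 < T) {ψ : ℝ → ℝ} {C : ℝ} (hC : ∀ x, |ψ x| ≤ C) :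
    |periodMean T ψ| ≤ C := by
  have := norm_integral_le_of_norm_le_const (μ := periodMeasure T) (C := C) (f := ψ)
    (Eventually.of_forall hC)
  rw [periodMean, abs_div, abs_of_pos hT, div_le_iff₀ hT]
  simpa [Measure.real, hT.le] using this

/-- The weak wave equation tested against bounded measurable data. -/
lemma IsWeakWave.integral_bounded (hT : 0 < T) (hw : IsWeakWave T U H)
    (hU : Integrable U (squareMeasure T)) (hH : Integrable H (squareMeasure T))
    {ψ χ : ℝ → ℝ} (hψ : Measurable ψ) (hχ : Measurable χ)
    (hψ1 : ∀ x, |ψ x| ≤ 1) (hχ1 : ∀ x, |χ x| ≤ 1) :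
    ∫ z, (4 * U z * ((ψ z.1 - periodMean T ψ) * (χ z.2 - periodMean T χ)) +
      H z * (sawIntegral T ψ z.1 * sawIntegral T χ z.2)) ∂(squareMeasure T) = 0 := by
  obtain ⟨Q, q1, q2, q3, q4⟩ := exists_smooth_approx hT hψ hψ1
  obtain ⟨R, r1, r2, r3, r4⟩ := exists_smooth_approx hT hχ hχ1
  have hQm : ∀ n, Measurable (Q n) := fun n => (q1 n).continuous.measurable
  have hRm : ∀ n, Measurable (R n) := fun n => (r1 n).continuous.measurable
  have hmean : ∀ {ψ : ℝ → ℝ} {Q : ℕ → ℝ → ℝ}, (∀ n, Measurable (Q n)) → (∀ n s, |Q n s| ≤ 1) →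
      (∀ᵐ s ∂(periodMeasure T), Tendsto (fun n => Q n s) atTop (𝓝 (ψ s))) →
      Tendsto (fun n => periodMean T (Q n)) atTop (𝓝 (periodMean T ψ)) := by
    intro ψ Q h1 h2 h3
    have := (tendsto_integral_mul_of_bounded h1 h2 h3 (g := fun _ => 1) measurable_const
      (by simp)).div_const T
    simpa [periodMean] using this
  have hsaw : ∀ {ψ : ℝ → ℝ} {Q : ℕ → ℝ → ℝ}, (∀ n, Measurable (Q n)) → (∀ n s, |Q n s| ≤ 1) →
      (∀ᵐ s ∂(periodMeasure T), Tendsto (fun n => Q n s) atTop (𝓝 (ψ s))) →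
      ∀ s, Tendsto (fun n => sawIntegral T (Q n) s) atTop (𝓝 (sawIntegral T ψ s)) := by
    intro ψ Q h1 h2 h3 s
    exact tendsto_integral_mul_of_bounded h1 h2 h3
      (measurable_saw.comp (measurable_id.sub_const s)) (fun _ => abs_saw_le_one _)
  let F : (ℝ → ℝ) → (ℝ → ℝ) → ℝ × ℝ → ℝ := fun ψ χ z =>
    4 * U z * ((ψ z.1 - periodMean T ψ) * (χ z.2 - periodMean T χ)) +
      H z * (sawIntegral T ψ z.1 * sawIntegral T χ z.2)
  -- For smooth data the periodic antiderivatives are admissible test functions, and their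
  -- derivatives are the data minus their means.
  have hzero : ∀ n, ∫ z, F (Q n) (R n) z ∂(squareMeasure T) = 0 := by
    intro n
    obtain ⟨A, a1, a2, a3, a4⟩ := exists_smooth_sawIntegral hT (q1 n) (q2 n)
    obtain ⟨B, b1, b2, b3, b4⟩ := exists_smooth_sawIntegral hT (r1 n) (r2 n)
    rw [← hw A B a1 b1 a2 b2]
    refine integral_congr_ae ?_
    filter_upwards [ae_square_fst (ae_restrict_mem measurableSet_Ioc),
      ae_square_snd (ae_restrict_mem measurableSet_Ioc)] with z h1 h2
    simp only [F, a3, b3, a4 _ h1, b4 _ h2]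
  have hlim : Tendsto (fun n => ∫ z, F (Q n) (R n) z ∂(squareMeasure T)) atTop
      (𝓝 (∫ z, F ψ χ z ∂(squareMeasure T))) := by
    refine tendsto_integral_of_dominated_convergence
      (fun z => 4 * |U z| * (2 * 2) + |H z| * ((1 * T) * (1 * T))) (fun n => ?_)
      (((hU.abs.const_mul 4).mul_const _).add (hH.abs.mul_const _))
      (fun n => Eventually.of_forall fun z => ?_) ?_
    · refine ((hU.aestronglyMeasurable.const_mul 4).mul ?_).add (hH.aestronglyMeasurable.mul ?_)
      · exact ((((hQm n).comp measurable_fst).sub_const _).mul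
          (((hRm n).comp measurable_snd).sub_const _)).aestronglyMeasurable
      · exact (((measurable_sawIntegral (hQm n)).comp measurable_fst).mul
          ((measurable_sawIntegral (hRm n)).comp measurable_snd)).aestronglyMeasurable
    · have hb : ∀ {ψ : ℝ → ℝ}, (∀ s, |ψ s| ≤ 1) → ∀ s, |ψ s - periodMean T ψ| ≤ 2 :=
        fun h s => (abs_sub _ _).trans (by linarith [h s, abs_periodMean_le hT h])
      refine (norm_add_le _ _).trans (add_le_add ?_ ?_)
      · rw [Real.norm_eq_abs, abs_mul, abs_mul, abs_mul, abs_of_pos (show (0 : ℝ) < 4 by norm_num)]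
        gcongr
        · exact hb (q3 n) _
        · exact hb (r3 n) _
      · rw [Real.norm_eq_abs, abs_mul, abs_mul]
        gcongr
        · exact sawIntegral_bound hT (q3 n) _
        · exact sawIntegral_bound hT (r3 n) _
    · filter_upwards [ae_square_fst q4, ae_square_snd r4] with z h1 h2
      exact (((h1.sub (hmean hQm q3 q4)).mul (h2.sub (hmean hRm r3 r4))).const_mul _).add
        (((hsaw hQm q3 q4 _).mul (hsaw hRm r3 r4 _)).const_mul _)
  simp only [hzero] at hlim
  exact tendsto_nhds_unique hlim tendsto_const_nhds

lemma measurable_waveKernel :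
    Measurable (fun p : (ℝ × ℝ) × (ℝ × ℝ) => saw T (p.1.1 - p.2.1) * saw T (p.1.2 - p.2.2)) :=
  (measurable_saw.comp ((measurable_fst.comp measurable_fst).sub
    (measurable_fst.comp measurable_snd))).mul
  (measurable_saw.comp ((measurable_snd.comp measurable_fst).sub
    (measurable_snd.comp measurable_snd)))

lemma abs_waveKernel_le (ζ s : ℝ × ℝ) : |saw T (ζ.1 - s.1) * saw T (ζ.2 - s.2)| ≤ 1 := by
  rw [abs_mul]
  calc _ ≤ (1 : ℝ) * 1 :=
        mul_le_mul (abs_saw_le_one _) (abs_saw_le_one _) (abs_nonneg _) zero_le_one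
    _ = 1 := one_mul _

lemma integrable_waveKernel_mul (hH : Integrable H (squareMeasure T)) (ζ : ℝ × ℝ) :
    Integrable (fun s => saw T (ζ.1 - s.1) * saw T (ζ.2 - s.2) * H s) (squareMeasure T) :=
  hH.bdd_mul (c := 1) (measurable_waveKernel.comp
    (measurable_const.prodMk measurable_id)).aestronglyMeasurable
    (Eventually.of_forall fun s => abs_waveKernel_le ζ s)

/-- The kernel is bounded by one, so an integrable source already gives a bounded function. All
later bounds start from this gain. -/
lemma abs_waveInverse_le (hH : Integrable H (squareMeasure T)) (ζ : ℝ × ℝ) :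
    |waveInverse T H ζ| ≤ ∫ s, |H s| ∂(squareMeasure T) := by
  have h1 := norm_integral_le_of_norm_le (μ := squareMeasure T) hH.abs
    (f := fun s => saw T (ζ.1 - s.1) * saw T (ζ.2 - s.2) * H s)
    (Eventually.of_forall fun s => by
      rw [norm_mul, Real.norm_eq_abs, Real.norm_eq_abs]
      exact mul_le_of_le_one_left (abs_nonneg _) (abs_waveKernel_le ζ s))
  rw [waveInverse, abs_mul, show |(-(1 / 4) : ℝ)| = 1 / 4 by norm_num [abs_of_pos]]
  rw [Real.norm_eq_abs] at h1
  linarith [abs_nonneg (∫ s, saw T (ζ.1 - s.1) * saw T (ζ.2 - s.2) * H s ∂(squareMeasure T))]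

lemma measurable_waveInverse (hH : AEStronglyMeasurable H (squareMeasure T)) :
    Measurable (waveInverse T H) := by
  have : waveInverse T H = waveInverse T (hH.mk H) := by
    ext ζ
    unfold waveInverse
    congr 1
    refine integral_congr_ae ?_
    filter_upwards [hH.ae_eq_mk] with s hs
    rw [hs]
  rw [this]
  have hm : Measurable (fun p : (ℝ × ℝ) × (ℝ × ℝ) =>
      saw T (p.1.1 - p.2.1) * saw T (p.1.2 - p.2.2) * hH.mk H p.2) :=
    measurable_waveKernel.mul (hH.stronglyMeasurable_mk.measurable.comp measurable_snd)
  exact (hm.stronglyMeasurable.integral_prod_right (ν := squareMeasure T)).measurable.const_mul _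

lemma waveInverse_add_fst (hT : 0 < T) (x y : ℝ) :
    waveInverse T H (x + T, y) = waveInverse T H (x, y) := by
  unfold waveInverse
  congr 1; refine integral_congr_ae (Eventually.of_forall fun s => ?_)
  simp only [add_sub_right_comm x T, saw_periodic hT (x - s.1)]

lemma waveInverse_add_snd (hT : 0 < T) (x y : ℝ) :
    waveInverse T H (x, y + T) = waveInverse T H (x, y) := by
  unfold waveInverse
  congr 1; refine integral_congr_ae (Eventually.of_forall fun s => ?_)
  simp only [add_sub_right_comm y T, saw_periodic hT (y - s.2)]

lemma waveInverse_swap (x y : ℝ) :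
    waveInverse T H (x, y) = waveInverse T (fun z => H z.swap) (y, x) := by
  unfold waveInverse
  congr 1
  rw [← integral_square_swap]
  refine integral_congr_ae (Eventually.of_forall fun s => ?_)
  simp only [Prod.fst_swap, Prod.snd_swap]; ring

lemma integrable_waveKernel_mul_prod (hH : Integrable H (squareMeasure T))
    {k : ℝ × ℝ → ℝ} (hk : Measurable k) (hk1 : ∀ z, |k z| ≤ 1) :
    Integrable (fun p : (ℝ × ℝ) × (ℝ × ℝ) =>
      saw T (p.1.1 - p.2.1) * saw T (p.1.2 - p.2.2) * H p.2 * k p.1)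
      ((squareMeasure T).prod (squareMeasure T)) := by
  have h1 : Integrable (fun p : (ℝ × ℝ) × (ℝ × ℝ) => H p.2)
      ((squareMeasure T).prod (squareMeasure T)) := hH.comp_snd _
  exact (h1.bdd_mul (c := 1) measurable_waveKernel.aestronglyMeasurable
    (Eventually.of_forall fun p => abs_waveKernel_le p.1 p.2)).mul_bdd (c := 1)
    (hk.comp measurable_fst).aestronglyMeasurable (Eventually.of_forall fun p => hk1 p.1)

/-- Fubini moves each sawtooth factor onto the test function of the same variable; the result is the
source term of `IsWeakWave.integral_bounded`. -/
lemma integral_waveInverse_mul (hH : Integrable H (squareMeasure T))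
    {ψ χ : ℝ → ℝ} (hψ : Measurable ψ) (hχ : Measurable χ)
    (hψ1 : ∀ x, |ψ x| ≤ 1) (hχ1 : ∀ x, |χ x| ≤ 1) :
    ∫ z, waveInverse T H z * (ψ z.1 * χ z.2) ∂(squareMeasure T) =
      -(1 / 4) * ∫ s, H s * (sawIntegral T ψ s.1 * sawIntegral T χ s.2) ∂(squareMeasure T) := by
  have hk : Measurable (fun z : ℝ × ℝ => ψ z.1 * χ z.2) :=
    (hψ.comp measurable_fst).mul (hχ.comp measurable_snd)
  have hk1 : ∀ z : ℝ × ℝ, |ψ z.1 * χ z.2| ≤ 1 := fun z => by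
    rw [abs_mul]
    calc _ ≤ (1 : ℝ) * 1 := mul_le_mul (hψ1 _) (hχ1 _) (abs_nonneg _) zero_le_one
      _ = 1 := one_mul _
  have hswap := integral_integral_swap (μ := squareMeasure T) (ν := squareMeasure T)
    (f := fun z s => saw T (z.1 - s.1) * saw T (z.2 - s.2) * H s * (ψ z.1 * χ z.2))
    (integrable_waveKernel_mul_prod hH hk hk1)
  simp only [waveInverse, mul_assoc (-(1 / 4) : ℝ), integral_const_mul]
  congr 1
  simp only [integral_mul_const] at hswap
  rw [hswap]
  refine integral_congr_ae (Eventually.of_forall fun s => ?_)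
  simp only [sawIntegral]
  rw [← integral_prod_mul, ← integral_const_mul]
  refine integral_congr_ae (Eventually.of_forall fun z => ?_)
  simp only; ring

/-- Integration in `y` turns the second sawtooth into a constant, independent of the translation.
What is left is `H` tested against a function of the first variable. -/
lemma integral_waveInverse_snd (hT : 0 < T) (hH : Integrable H (squareMeasure T))
    (h : ∀ ψ : ℝ → ℝ, Measurable ψ → (∀ x, |ψ x| ≤ 1) →
      ∫ z, H z * ψ z.1 ∂(squareMeasure T) = 0) (x : ℝ) :
    ∫ y, waveInverse T H (x, y) ∂(periodMeasure T) = 0 := by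
  have hi : Integrable (fun p : ℝ × (ℝ × ℝ) =>
      saw T (x - p.2.1) * saw T (p.1 - p.2.2) * H p.2)
      ((periodMeasure T).prod (squareMeasure T)) := by
    have h1 : Integrable (fun p : ℝ × (ℝ × ℝ) => H p.2)
      ((periodMeasure T).prod (squareMeasure T)) := hH.comp_snd _
    exact h1.bdd_mul (c := 1) (measurable_waveKernel.comp
      (((measurable_const (a := x)).prodMk measurable_fst).prodMk
        measurable_snd)).aestronglyMeasurable
      (Eventually.of_forall fun p => abs_waveKernel_le (x, p.1) p.2)
  have hswap := integral_integral_swap (f := fun y s => saw T (x - s.1) * saw T (y - s.2) * H s) hi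
  simp only [waveInverse, integral_const_mul]
  rw [hswap]
  have : ∀ s : ℝ × ℝ, ∫ y, saw T (x - s.1) * saw T (y - s.2) * H s ∂(periodMeasure T) =
      H s * saw T (x - s.1) * ∫ y, saw T y ∂(periodMeasure T) := by
    intro s
    rw [integral_mul_const, integral_const_mul]
    have := integral_periodMeasure_add hT (saw_periodic hT) (-s.2)
    simp only [← sub_eq_add_neg] at this
    rw [this]; ring
  simp only [this, integral_mul_const]
  rw [h (fun t => saw T (x - t)) (measurable_saw.comp (measurable_id.const_sub x))
    (fun _ => abs_saw_le_one _)]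
  simp

/-- The product kernel is varied one factor at a time. Each variation costs the `L¹` translation
modulus of the sawtooth, and the other factor is at most one. -/
lemma abs_waveInverse_sub_le (hT : 0 < T) {K : ℝ} (hH : Integrable H (squareMeasure T))
    (hK : ∀ᵐ s ∂(squareMeasure T), |H s| ≤ K) (ζ ζ' : ℝ × ℝ) :
    |waveInverse T H ζ - waveInverse T H ζ'| ≤
      K * T * (|ζ.1 - ζ'.1| + |ζ.2 - ζ'.2|) := by
  let D₁ : ℝ × ℝ → ℝ := fun s => |saw T (ζ.1 - s.1) - saw T (ζ'.1 - s.1)|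
  let D₂ : ℝ × ℝ → ℝ := fun s => |saw T (ζ.2 - s.2) - saw T (ζ'.2 - s.2)|
  have hD : ∀ a b : ℝ, Integrable (fun s => |saw T (a - s) - saw T (b - s)|)
      (periodMeasure T) := fun a b =>
    (((integrable_of_abs_le (measurable_saw.comp (measurable_id.const_sub a)).aestronglyMeasurable
      (Eventually.of_forall fun _ => abs_saw_le_one _)).sub (integrable_of_abs_le
      (measurable_saw.comp (measurable_id.const_sub b)).aestronglyMeasurable
      (Eventually.of_forall fun _ => abs_saw_le_one _)))).abs
  have hD₁ : Integrable D₁ (squareMeasure T) := (hD ζ.1 ζ'.1).comp_fst _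
  have hD₂ : Integrable D₂ (squareMeasure T) := (hD ζ.2 ζ'.2).comp_snd _
  have e₁ : ∫ s, D₁ s ∂(squareMeasure T) ≤ T * (2 * |ζ.1 - ζ'.1|) := by
    have := integral_fun_fst (μ := periodMeasure T) (ν := periodMeasure T)
      (fun s => |saw T (ζ.1 - s) - saw T (ζ'.1 - s)|)
    rw [this]
    simp only [Measure.real, Measure.restrict_apply_univ, Real.volume_Ioc, sub_zero, smul_eq_mul,
      ENNReal.toReal_ofReal hT.le]
    exact mul_le_mul_of_nonneg_left (integral_abs_saw_sub_le hT _ _) hT.le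
  have e₂ : ∫ s, D₂ s ∂(squareMeasure T) ≤ T * (2 * |ζ.2 - ζ'.2|) := by
    have := integral_fun_snd (μ := periodMeasure T) (ν := periodMeasure T)
      (fun s => |saw T (ζ.2 - s) - saw T (ζ'.2 - s)|)
    rw [this]
    simp only [Measure.real, Measure.restrict_apply_univ, Real.volume_Ioc, sub_zero, smul_eq_mul,
      ENNReal.toReal_ofReal hT.le]
    exact mul_le_mul_of_nonneg_left (integral_abs_saw_sub_le hT _ _) hT.le
  have hK0 : 0 ≤ K := by
    have hne : NeZero (squareMeasure T) := ⟨by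
      intro h0
      have := congrArg (fun m : Measure (ℝ × ℝ) => m univ) h0
      simp [squareMeasure, ← univ_prod_univ, Measure.prod_prod] at this
      linarith⟩
    obtain ⟨s, hs⟩ := hK.exists
    exact (abs_nonneg _).trans hs
  have hpt : ∀ᵐ s ∂(squareMeasure T),
      ‖saw T (ζ.1 - s.1) * saw T (ζ.2 - s.2) * H s -
        saw T (ζ'.1 - s.1) * saw T (ζ'.2 - s.2) * H s‖ ≤ K * (D₁ s + D₂ s) := by
    filter_upwards [hK] with s hs
    have : saw T (ζ.1 - s.1) * saw T (ζ.2 - s.2) * H s -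
        saw T (ζ'.1 - s.1) * saw T (ζ'.2 - s.2) * H s =
        H s * ((saw T (ζ.1 - s.1) - saw T (ζ'.1 - s.1)) * saw T (ζ.2 - s.2) +
          (saw T (ζ.2 - s.2) - saw T (ζ'.2 - s.2)) * saw T (ζ'.1 - s.1)) := by ring
    rw [this, norm_mul]
    refine mul_le_mul hs ((norm_add_le _ _).trans (add_le_add ?_ ?_)) (norm_nonneg _) hK0
    · rw [norm_mul]; exact mul_le_of_le_one_right (abs_nonneg _) (abs_saw_le_one _)
    · rw [norm_mul]; exact mul_le_of_le_one_right (abs_nonneg _) (abs_saw_le_one _)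
  have h1 := norm_integral_le_of_norm_le ((hD₁.add hD₂).const_mul K) hpt
  rw [integral_sub (integrable_waveKernel_mul hH ζ) (integrable_waveKernel_mul hH ζ'),
    integral_const_mul, Real.norm_eq_abs] at h1
  have e : ∫ s, (D₁ + D₂) s ∂(squareMeasure T) =
    (∫ s, D₁ s ∂(squareMeasure T)) + ∫ s, D₂ s ∂(squareMeasure T) := integral_add hD₁ hD₂
  rw [e] at h1
  rw [waveInverse, waveInverse, ← mul_sub, abs_mul,
    show |(-(1 / 4) : ℝ)| = 1 / 4 by norm_num [abs_of_pos]]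
  have h2 := mul_le_mul_of_nonneg_left (add_le_add e₁ e₂) hK0
  have h3 : 0 ≤ K * T * (|ζ.1 - ζ'.1| + |ζ.2 - ζ'.2|) := by positivity
  nlinarith [h1.trans h2]

/-- Rectangles form a π-system generating the product σ-algebra, and the sets of zero integral are
closed under complements and disjoint unions. -/
lemma ae_eq_zero_of_integral_prod_eq_zero {W : ℝ × ℝ → ℝ} (hW : Integrable W (squareMeasure T))
    (h : ∀ S S' : Set ℝ, MeasurableSet S → MeasurableSet S' →
      ∫ z in S ×ˢ S', W z ∂(squareMeasure T) = 0) : W =ᵐ[squareMeasure T] 0 := by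
  refine Integrable.ae_eq_zero_of_forall_setIntegral_eq_zero hW fun s hs _ => ?_
  refine MeasurableSpace.induction_on_inter
    (C := fun s _ => ∫ z in s, W z ∂(squareMeasure T) = 0)
    generateFrom_prod.symm isPiSystem_prod (by simp) ?_ ?_ ?_ s hs
  · rintro - ⟨S, hS, S', hS', rfl⟩
    exact h S S' hS hS'
  · intro t ht h0
    have := integral_add_compl ht hW
    have hu := h univ univ .univ .univ
    rw [univ_prod_univ, setIntegral_univ] at hu
    rw [h0, hu, zero_add] at this
    exact this
  · intro f hd hm h0
    rw [integral_iUnion hm hd hW.integrableOn]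
    simp [h0]

/-- Representation of antisymmetric weak solutions of `4 ∂₁∂₂U + H = 0` on the torus. -/
lemma IsWeakWave.decomposition (hT : 0 < T) (hw : IsWeakWave T U H)
    (hU : Integrable U (squareMeasure T)) (hH : Integrable H (squareMeasure T))
    (hanti : ∀ z, U z.swap = -U z) :
    ∀ᵐ z ∂(squareMeasure T), U z = periodMean T (fun y => U (z.1, y)) -
      periodMean T (fun y => U (z.2, y)) + waveInverse T H z := by
  set P : ℝ → ℝ := fun x => periodMean T (fun y => U (x, y)) with hP
  have hPi : Integrable P (periodMeasure T) := hU.integral_prod_left.div_const T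
  have hI : Integrable (waveInverse T H) (squareMeasure T) :=
    integrable_of_abs_le (measurable_waveInverse hH.aestronglyMeasurable).aestronglyMeasurable
      (Eventually.of_forall (abs_waveInverse_le hH))
  have hP1 : Integrable (fun z : ℝ × ℝ => P z.1) (squareMeasure T) := hPi.comp_fst _
  have hP2 : Integrable (fun z : ℝ × ℝ => P z.2) (squareMeasure T) := hPi.comp_snd _
  have hW : Integrable (fun z => U z - (P z.1 - P z.2 + waveInverse T H z)) (squareMeasure T) :=
    hU.sub ((hP1.sub hP2).add hI)
  have key : (fun z => U z - (P z.1 - P z.2 + waveInverse T H z)) =ᵐ[squareMeasure T] 0 := by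
    refine ae_eq_zero_of_integral_prod_eq_zero hW fun S S' hS hS' => ?_
    -- Indicators of rectangles are tested, which is why the weak equation was extended from smooth
    -- to bounded measurable data.
    set ψ : ℝ → ℝ := S.indicator 1 with hψ
    set χ : ℝ → ℝ := S'.indicator 1 with hχ
    have hψm : Measurable ψ := measurable_one.indicator hS
    have hχm : Measurable χ := measurable_one.indicator hS'
    have hψ1 : ∀ x, |ψ x| ≤ 1 := fun x => by by_cases hx : x ∈ S <;> simp [hψ, hx]
    have hχ1 : ∀ x, |χ x| ≤ 1 := fun x => by by_cases hx : x ∈ S' <;> simp [hχ, hx]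
    have hmul : ∀ F : ℝ × ℝ → ℝ, ∫ z in S ×ˢ S', F z ∂(squareMeasure T) =
        ∫ z, F z * (ψ z.1 * χ z.2) ∂(squareMeasure T) := by
      intro F
      rw [← integral_indicator (hS.prod hS')]
      refine integral_congr_ae (Eventually.of_forall fun z => ?_)
      by_cases h1 : z.1 ∈ S <;> by_cases h2 : z.2 ∈ S' <;>
        simp [hψ, hχ, indicator, h1, h2]
    rw [hmul]
    have hint : ∀ F : ℝ × ℝ → ℝ, Integrable F (squareMeasure T) →
        Integrable (fun z => F z * (ψ z.1 * χ z.2)) (squareMeasure T) := fun F hF => by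
      simpa [mul_assoc] using integrable_mul_snd (integrable_mul_fst hF hψm hψ1) hχm hχ1
    have e1 := hw.integral_bounded hT hU hH hψm hχm hψ1 hχ1
    have e2 := integral_waveInverse_mul hH hψm hχm hψ1 hχ1
    set a := periodMean T ψ with ha
    set c := periodMean T χ with hc
    have hTa : ∫ x, ψ x ∂(periodMeasure T) = T * a := by
      rw [ha, periodMean]; field_simp
    have hTc : ∫ x, χ x ∂(periodMeasure T) = T * c := by
      rw [hc, periodMean]; field_simp
    have hUP : ∀ φ : ℝ → ℝ, Measurable φ → (∀ x, |φ x| ≤ 1) →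
        ∫ z, U z * φ z.1 ∂(squareMeasure T) = T * ∫ x, P x * φ x ∂(periodMeasure T) := by
      intro φ h1 h2
      rw [integral_prod _ (integrable_mul_fst hU h1 h2), ← integral_const_mul]
      refine integral_congr_ae (Eventually.of_forall fun x => ?_)
      simp only [integral_mul_const, hP, periodMean]
      field_simp
    have f1 := hUP ψ hψm hψ1
    -- Antisymmetry makes the marginal in the other variable equal to minus `P`, so one profile
    -- describes both; it also removes the total mean in `f3`.
    have f2 : ∫ z, U z * χ z.2 ∂(squareMeasure T) = -(T * ∫ x, P x * χ x ∂(periodMeasure T)) := by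
      rw [← hUP χ hχm hχ1, ← integral_square_swap, ← integral_neg]
      refine integral_congr_ae (Eventually.of_forall fun z => ?_)
      simp [hanti]
    have f3 : ∫ z, U z ∂(squareMeasure T) = 0 := by
      have := integral_square_swap (T := T) U
      simp only [hanti, integral_neg] at this
      linarith
    have f4 : ∫ z, P z.1 * (ψ z.1 * χ z.2) ∂(squareMeasure T) =
        (∫ x, P x * ψ x ∂(periodMeasure T)) * (T * c) := by
      rw [← hTc, ← integral_prod_mul]
      simp only [mul_assoc]
    have f5 : ∫ z, P z.2 * (ψ z.1 * χ z.2) ∂(squareMeasure T) =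
        (T * a) * (∫ x, P x * χ x ∂(periodMeasure T)) := by
      rw [← hTa, ← integral_prod_mul]
      refine integral_congr_ae (Eventually.of_forall fun z => ?_)
      simp only; ring
    have i1 := hint U hU
    have i2 := hint _ hP1
    have i3 := hint _ hP2
    have i4 := hint _ hI
    have g1 : ∫ z, (U z - (P z.1 - P z.2 + waveInverse T H z)) * (ψ z.1 * χ z.2)
        ∂(squareMeasure T) =
        (∫ z, U z * (ψ z.1 * χ z.2) ∂(squareMeasure T)) -
        ((∫ z, P z.1 * (ψ z.1 * χ z.2) ∂(squareMeasure T)) -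
        (∫ z, P z.2 * (ψ z.1 * χ z.2) ∂(squareMeasure T)) +
        ∫ z, waveInverse T H z * (ψ z.1 * χ z.2) ∂(squareMeasure T)) := by
      rw [← integral_sub' i2 i3, ← integral_add' (i2.sub i3) i4, ← integral_sub' i1
        ((i2.sub i3).add i4)]
      refine integral_congr_ae (Eventually.of_forall fun z => ?_)
      simp only [Pi.add_apply, Pi.sub_apply]; ring
    have j1 := integrable_mul_fst hU hψm hψ1
    have j2 := integrable_mul_snd hU hχm hχ1
    have hAA : Integrable (fun s => H s * (sawIntegral T ψ s.1 * sawIntegral T χ s.2))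
        (squareMeasure T) := by
      simpa [mul_assoc] using integrable_mul_snd (integrable_mul_fst hH
        (measurable_sawIntegral hψm) (sawIntegral_bound hT hψ1)) (measurable_sawIntegral hχm)
        (sawIntegral_bound hT hχ1)
    have g2 : ∫ z, (4 * U z * ((ψ z.1 - a) * (χ z.2 - c)) +
        H z * (sawIntegral T ψ z.1 * sawIntegral T χ z.2)) ∂(squareMeasure T) =
        4 * ((∫ z, U z * (ψ z.1 * χ z.2) ∂(squareMeasure T)) -
          c * (∫ z, U z * ψ z.1 ∂(squareMeasure T)) -
          a * (∫ z, U z * χ z.2 ∂(squareMeasure T)) +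
          a * c * ∫ z, U z ∂(squareMeasure T)) +
        ∫ s, H s * (sawIntegral T ψ s.1 * sawIntegral T χ s.2) ∂(squareMeasure T) := by
      rw [← integral_const_mul c, ← integral_const_mul a, ← integral_const_mul (a * c),
        ← integral_sub' i1 (j1.const_mul c), ← integral_sub' (i1.sub (j1.const_mul c))
        (j2.const_mul a), ← integral_add' ((i1.sub (j1.const_mul c)).sub (j2.const_mul a))
        (hU.const_mul (a * c)), ← integral_const_mul 4, ← integral_add' _ hAA]
      · refine integral_congr_ae (Eventually.of_forall fun z => ?_)
        simp only [Pi.add_apply, Pi.sub_apply]; ring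
      · exact (((i1.sub (j1.const_mul c)).sub (j2.const_mul a)).add
          (hU.const_mul (a * c))).const_mul 4
    rw [g2, f1, f2, f3] at e1
    rw [g1, f4, f5, e2]
    linarith
  filter_upwards [key] with z hz
  exact sub_eq_zero.1 hz

end

/-! ### Functions orthogonal to functions of one variable, and the maximum principle. -/

section

variable {T : ℝ}

/-- `G` is orthogonal to all bounded functions of one of the two variables. -/
def IsMarginFree (T : ℝ) (G : ℝ × ℝ → ℝ) : Prop :=
  ∀ φ : ℝ → ℝ, Measurable φ → (∀ x, |φ x| ≤ 1) →
    ∫ z, G z * φ z.1 ∂(squareMeasure T) = 0 ∧ ∫ z, G z * φ z.2 ∂(squareMeasure T) = 0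

lemma IsWeakWave.isMarginFree {U H : ℝ × ℝ → ℝ} (hT : 0 < T) (hw : IsWeakWave T U H)
    (hH : Integrable H (squareMeasure T)) : IsMarginFree T H := fun _ hφ hφ1 =>
  ⟨hw.integral_mul_fst hT hH hφ hφ1, hw.integral_mul_snd hT hH hφ hφ1⟩

lemma integrable_waveInverse {H : ℝ × ℝ → ℝ} (hH : Integrable H (squareMeasure T)) :
    Integrable (waveInverse T H) (squareMeasure T) :=
  integrable_of_abs_le (measurable_waveInverse hH.aestronglyMeasurable).aestronglyMeasurable
    (Eventually.of_forall (abs_waveInverse_le hH))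

lemma IsMarginFree.integral_waveInverse_snd {H : ℝ × ℝ → ℝ} (hT : 0 < T) (h : IsMarginFree T H)
    (hH : Integrable H (squareMeasure T)) (x : ℝ) :
    ∫ y, waveInverse T H (x, y) ∂(periodMeasure T) = 0 :=
  KleinGordon.integral_waveInverse_snd hT hH (fun φ h1 h2 => (h φ h1 h2).1) x

lemma IsMarginFree.integral_waveInverse_fst {H : ℝ × ℝ → ℝ} (hT : 0 < T) (h : IsMarginFree T H)
    (hH : Integrable H (squareMeasure T)) (y : ℝ) :
    ∫ x, waveInverse T H (x, y) ∂(periodMeasure T) = 0 := by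
  simp only [waveInverse_swap _ y]
  refine KleinGordon.integral_waveInverse_snd hT hH.swap (fun φ h1 h2 => ?_) y
  rw [← integral_square_swap]
  exact (h φ h1 h2).2

lemma isMarginFree_of_integral {G : ℝ × ℝ → ℝ} (hG : Integrable G (squareMeasure T))
    (h1 : ∀ x, ∫ y, G (x, y) ∂(periodMeasure T) = 0)
    (h2 : ∀ y, ∫ x, G (x, y) ∂(periodMeasure T) = 0) : IsMarginFree T G := fun φ hφ hφ1 => by
  constructor
  · rw [integral_prod _ (integrable_mul_fst hG hφ hφ1)]
    simp [integral_mul_const, h1]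
  · rw [integral_prod_symm _ (integrable_mul_snd hG hφ hφ1)]
    simp [integral_mul_const, h2]

lemma IsMarginFree.waveInverse {H : ℝ × ℝ → ℝ} (hT : 0 < T) (h : IsMarginFree T H)
    (hH : Integrable H (squareMeasure T)) : IsMarginFree T (waveInverse T H) :=
  isMarginFree_of_integral (integrable_waveInverse hH) (h.integral_waveInverse_snd hT hH)
    (h.integral_waveInverse_fst hT hH)

lemma IsMarginFree.const_mul {G : ℝ × ℝ → ℝ} (h : IsMarginFree T G) (c : ℝ) :
    IsMarginFree T (fun z => c * G z) := fun φ h1 h2 => by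
  simp only [mul_assoc, integral_const_mul, (h φ h1 h2).1, (h φ h1 h2).2, mul_zero, and_self]

lemma IsMarginFree.sub {G G' : ℝ × ℝ → ℝ} (h : IsMarginFree T G) (h' : IsMarginFree T G')
    (hG : Integrable G (squareMeasure T)) (hG' : Integrable G' (squareMeasure T)) :
    IsMarginFree T (fun z => G z - G' z) := fun φ h1 h2 => by
  simp only [sub_mul]
  rw [integral_sub (integrable_mul_fst hG h1 h2) (integrable_mul_fst hG' h1 h2),
    integral_sub (integrable_mul_snd hG h1 h2) (integrable_mul_snd hG' h1 h2),
    (h φ h1 h2).1, (h φ h1 h2).2, (h' φ h1 h2).1, (h' φ h1 h2).2]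
  simp

lemma IsMarginFree.congr {G G' : ℝ × ℝ → ℝ} (h : IsMarginFree T G)
    (hG : G =ᵐ[squareMeasure T] G') : IsMarginFree T G' := fun φ h1 h2 => by
  obtain ⟨g1, g2⟩ := h φ h1 h2
  constructor
  · refine (integral_congr_ae ?_).trans g1
    filter_upwards [hG] with z hz
    rw [hz]
  · refine (integral_congr_ae ?_).trans g2
    filter_upwards [hG] with z hz
    rw [hz]

/-- Translation of both variables by `h`, modulo `T`. -/
noncomputable def torusShift (T h : ℝ) : ℝ × ℝ → ℝ × ℝ :=
  Prod.map (fun x => wrap T (x + h)) (fun x => wrap T (x + h))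

lemma measurePreserving_torusShift (hT : 0 < T) (h : ℝ) :
    MeasurePreserving (torusShift T h) (squareMeasure T) (squareMeasure T) :=
  (measurePreserving_wrap_add hT h).prod (measurePreserving_wrap_add hT h)

/-- `T`-periodicity in each of two variables. -/
def IsBiperiodic {α : Type*} (T : ℝ) (G : ℝ × ℝ → α) : Prop :=
  (∀ x y, G (x + T, y) = G (x, y)) ∧ ∀ x y, G (x, y + T) = G (x, y)

lemma IsBiperiodic.apply_torusShift {α : Type*} {G : ℝ × ℝ → α} (hT : 0 < T)
    (hG : IsBiperiodic T G) (h : ℝ) (z : ℝ × ℝ) :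
    G (torusShift T h z) = G (z + (h, h)) := by
  have h1 : ∀ y, Periodic (fun x => G (x, y)) T := fun y x => hG.1 x y
  have h2 : ∀ x, Periodic (fun y => G (x, y)) T := fun x y => hG.2 x y
  have e1 := (h1 (wrap T (z.2 + h))).apply_wrap hT (z.1 + h)
  have e2 := (h2 (z.1 + h)).apply_wrap hT (z.2 + h)
  exact e1.trans e2

lemma IsBiperiodic.integrable_shift {G : ℝ × ℝ → ℝ} (hT : 0 < T) (hG : IsBiperiodic T G)
    (hi : Integrable G (squareMeasure T)) (h : ℝ) :
    Integrable (fun z => G (z + (h, h))) (squareMeasure T) := by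
  have := (measurePreserving_torusShift hT h).integrable_comp_of_integrable hi
  refine this.congr (Eventually.of_forall fun z => hG.apply_torusShift hT h z)

lemma IsBiperiodic.ae_shift {p : ℝ × ℝ → Prop} (hT : 0 < T) (hG : IsBiperiodic T p)
    (hi : ∀ᵐ z ∂(squareMeasure T), p z) (h : ℝ) :
    ∀ᵐ z ∂(squareMeasure T), p (z + (h, h)) := by
  have := (measurePreserving_torusShift hT h).quasiMeasurePreserving.ae hi
  filter_upwards [this] with z hz
  rwa [hG.apply_torusShift hT] at hz

/-- The shift preserves the measure of the torus, so it can be transferred to the test function,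
which becomes another bounded function of one variable. -/
lemma IsMarginFree.shift {G : ℝ × ℝ → ℝ} (hT : 0 < T) (hp : IsBiperiodic T G)
    (hi : Integrable G (squareMeasure T)) (hG : IsMarginFree T G) (h : ℝ) :
    IsMarginFree T (fun z => G (z + (h, h))) := fun φ h1 h2 => by
  have hm : Measurable (fun x => φ (wrap T (x - h))) :=
    h1.comp (measurable_wrap.comp (measurable_id.sub_const h))
  have hw : ∀ x, wrap T (wrap T (x + h) - h) = wrap T x := fun x => by
    have : Periodic (fun y => wrap T (y - h)) T := fun y => by
      simp only [add_sub_right_comm y T, wrap_periodic hT (y - h)]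
    have := this.apply_wrap hT (x + h)
    simpa using this
  have hmp := measurePreserving_torusShift hT h
  obtain ⟨g1, g2⟩ := hG _ hm (fun _ => h2 _)
  rw [← hmp.map_eq, integral_map hmp.aemeasurable (by
    rw [hmp.map_eq]; exact (integrable_mul_fst hi hm (fun _ => h2 _)).aestronglyMeasurable)] at g1
  rw [← hmp.map_eq, integral_map hmp.aemeasurable (by
    rw [hmp.map_eq]; exact (integrable_mul_snd hi hm (fun _ => h2 _)).aestronglyMeasurable)] at g2
  constructor
  · refine (integral_congr_ae ?_).trans g1
    filter_upwards [ae_square_fst (ae_periodMeasure_wrap hT)] with z hz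
    rw [hp.apply_torusShift hT]
    simp only [torusShift, Prod.map_fst, hw, hz]
  · refine (integral_congr_ae ?_).trans g2
    filter_upwards [ae_square_snd (ae_periodMeasure_wrap hT)] with z hz
    rw [hp.apply_torusShift hT]
    simp only [torusShift, Prod.map_snd, hw, hz]

/-- The truncated sign: the sign of `s` for `|s| > M`, and zero otherwise. -/
noncomputable def truncSign (M s : ℝ) : ℝ := if M < s then 1 else if s < -M then -1 else 0

section truncSign

variable {M : ℝ}

lemma measurable_truncSign : Measurable (truncSign M) :=
  Measurable.ite measurableSet_Ioi measurable_const
    (Measurable.ite measurableSet_Iio measurable_const measurable_const)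

lemma abs_truncSign_le_one (s : ℝ) : |truncSign M s| ≤ 1 := by
  unfold truncSign; split_ifs <;> simp

lemma truncSign_mono : Monotone (truncSign M) := fun s s' h => by
  unfold truncSign; split_ifs <;> linarith

lemma mul_truncSign (hM : 0 ≤ M) (s : ℝ) : s * truncSign M s = |s| * |truncSign M s| := by
  unfold truncSign; split_ifs with h1 h2
  · rw [abs_of_pos (hM.trans_lt h1)]; simp
  · rw [abs_of_neg (by linarith)]; simp
  · simp

lemma abs_truncSign_of_lt {s : ℝ} (h : M < |s|) : |truncSign M s| = 1 := by
  unfold truncSign; split_ifs with h1 h2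
  · simp
  · simp
  · exact absurd (abs_le.2 ⟨not_lt.1 h2, not_lt.1 h1⟩) (not_le.2 h)

lemma truncSign_of_le {s : ℝ} (h : |s| ≤ M) : truncSign M s = 0 := by
  rw [abs_le] at h
  unfold truncSign; rw [if_neg (not_lt.2 h.2), if_neg (not_lt.2 h.1)]

/-- This absorbs the coupling terms. If `|y| ≤ M < |s|`, the first term on the right suffices; if
both exceed `M`, the second does. -/
lemma abs_mul_truncSign_le (s y : ℝ) :
    |y| * |truncSign M s| ≤ |s| * |truncSign M s| + |y| * |truncSign M y| := by
  rcases le_or_gt |s| M with h | h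
  · rw [truncSign_of_le h, abs_zero, mul_zero, mul_zero, zero_add]; positivity
  · rw [abs_truncSign_of_lt h]
    rcases le_or_gt |y| M with h' | h'
    · rw [truncSign_of_le h']; simp only [abs_zero, mul_one, mul_zero, add_zero]; linarith
    · rw [abs_truncSign_of_lt h']; linarith [abs_nonneg s]

lemma sub_mul_abs_truncSign_nonneg (s : ℝ) : 0 ≤ (|s| - M) * |truncSign M s| := by
  rcases le_or_gt |s| M with h | h
  · simp [truncSign_of_le h]
  · exact mul_nonneg (sub_nonneg.2 h.le) (abs_nonneg _)

end truncSign

lemma integrable_mul_bdd_period {P : ℝ → ℝ} (hP : Integrable P (periodMeasure T)) {φ : ℝ → ℝ}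
    (hφ : Measurable φ) (hφ1 : ∀ x, |φ x| ≤ 1) :
    Integrable (fun x => P x * φ x) (periodMeasure T) :=
  hP.mul_bdd (c := 1) hφ.aestronglyMeasurable (Eventually.of_forall hφ1)

lemma integral_linear_comb {α : Type*} [MeasurableSpace α] {μ : Measure α} {f g h : α → ℝ}
    {b c d : ℝ} (hf : Integrable f μ) (hg : Integrable g μ) (hh : Integrable h μ) :
    ∫ x, (b * f x + c * g x - d * h x) ∂μ =
      b * (∫ x, f x ∂μ) + c * (∫ x, g x ∂μ) - d * ∫ x, h x ∂μ := by
  rw [← integral_const_mul b, ← integral_const_mul c, ← integral_const_mul d,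
    ← integral_add' (hf.const_mul b) (hg.const_mul c),
    ← integral_sub' ((hf.const_mul b).add (hg.const_mul c)) (hh.const_mul d)]
  rfl

/-- After expansion the mixed products contain the vanishing mean of `P`, and the two diagonal ones
contribute equally. -/
lemma integral_sub_mul_sub (hT : 0 < T) {P φ : ℝ → ℝ} (hP : Integrable P (periodMeasure T))
    (hP0 : ∫ x, P x ∂(periodMeasure T) = 0) (hφ : Measurable φ) (hφ1 : ∀ x, |φ x| ≤ 1) :
    Integrable (fun z => (P z.1 - P z.2) * (φ z.1 - φ z.2)) (squareMeasure T) ∧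
    ∫ z, (P z.1 - P z.2) * (φ z.1 - φ z.2) ∂(squareMeasure T) =
      2 * T * ∫ x, P x * φ x ∂(periodMeasure T) := by
  have i0 := integrable_mul_bdd_period hP hφ hφ1
  have hφi : Integrable φ (periodMeasure T) :=
    integrable_of_abs_le hφ.aestronglyMeasurable (Eventually.of_forall hφ1)
  have i1 : Integrable (fun z : ℝ × ℝ => P z.1 * φ z.1) (squareMeasure T) := i0.comp_fst _
  have i2 : Integrable (fun z : ℝ × ℝ => P z.2 * φ z.2) (squareMeasure T) := i0.comp_snd _
  have i3 : Integrable (fun z : ℝ × ℝ => P z.1 * φ z.2) (squareMeasure T) := hP.mul_prod hφi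
  have i4 : Integrable (fun z : ℝ × ℝ => φ z.1 * P z.2) (squareMeasure T) := hφi.mul_prod hP
  have e : (fun z : ℝ × ℝ => (P z.1 - P z.2) * (φ z.1 - φ z.2)) =
      (((fun z : ℝ × ℝ => P z.1 * φ z.1) + fun z => P z.2 * φ z.2) - fun z => P z.1 * φ z.2) -
        fun z => φ z.1 * P z.2 := by
    ext z; simp only [Pi.sub_apply, Pi.add_apply]; ring
  refine ⟨by rw [e]; exact ((i1.add i2).sub i3).sub i4, ?_⟩
  have e1 : ∫ z : ℝ × ℝ, P z.1 * φ z.1 ∂(squareMeasure T) =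
      T * ∫ x, P x * φ x ∂(periodMeasure T) := by
    have := integral_fun_fst (μ := periodMeasure T) (ν := periodMeasure T) (fun x => P x * φ x)
    rw [this]; simp [Measure.real, hT.le]
  have e2 : ∫ z : ℝ × ℝ, P z.2 * φ z.2 ∂(squareMeasure T) =
      T * ∫ x, P x * φ x ∂(periodMeasure T) := by
    have := integral_fun_snd (μ := periodMeasure T) (ν := periodMeasure T) (fun x => P x * φ x)
    rw [this]; simp [Measure.real, hT.le]
  rw [e, integral_sub' ((i1.add i2).sub i3) i4, integral_sub' (i1.add i2) i3,
    integral_add' i1 i2, e1, e2, integral_prod_mul, integral_prod_mul, hP0]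
  ring

/-- The test function is `φ(ξ) - φ(η)` with `φ` the truncated sign of `P`. It has the sign of `P(ξ)
- P(η)` or vanishes, so only the available one-sided bound on `N` is needed, and the nonlinear term
is at least `-C(|φ(ξ)| + |φ(η)|)`. -/
lemma integral_mul_truncSign_le (hT : 0 < T) {P Q : ℝ → ℝ} {N : ℝ × ℝ → ℝ} {b ε C M : ℝ}
    (hC : 0 ≤ C) (hPm : Measurable P) (hP : Integrable P (periodMeasure T))
    (hQ : Integrable Q (periodMeasure T)) (hN : Integrable N (squareMeasure T))
    (hP0 : ∫ x, P x ∂(periodMeasure T) = 0) (hQ0 : ∫ x, Q x ∂(periodMeasure T) = 0)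
    (hfree : IsMarginFree T fun z => b * (P z.1 - P z.2) + ε * (Q z.1 - Q z.2) + N z)
    (hsign : ∀ᵐ z ∂(squareMeasure T), (P z.2 < P z.1 → -C ≤ N z) ∧ (P z.1 < P z.2 → N z ≤ C)) :
    b * (∫ x, P x * truncSign M (P x) ∂(periodMeasure T)) +
      ε * (∫ x, Q x * truncSign M (P x) ∂(periodMeasure T)) ≤
      C * ∫ x, |truncSign M (P x)| ∂(periodMeasure T) := by
  set φ : ℝ → ℝ := fun x => truncSign M (P x) with hφdef
  have hφ : Measurable φ := measurable_truncSign.comp hPm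
  have hφ1 : ∀ x, |φ x| ≤ 1 := fun x => abs_truncSign_le_one _
  obtain ⟨iP, eP⟩ := integral_sub_mul_sub hT hP hP0 hφ hφ1
  obtain ⟨iQ, eQ⟩ := integral_sub_mul_sub hT hQ hQ0 hφ hφ1
  have hPP : Integrable (fun z : ℝ × ℝ => P z.1 - P z.2) (squareMeasure T) :=
    (hP.comp_fst _).sub (hP.comp_snd _)
  have hQQ : Integrable (fun z : ℝ × ℝ => Q z.1 - Q z.2) (squareMeasure T) :=
    (hQ.comp_fst _).sub (hQ.comp_snd _)
  have hG : Integrable (fun z => b * (P z.1 - P z.2) + ε * (Q z.1 - Q z.2) + N z)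
      (squareMeasure T) := ((hPP.const_mul b).add (hQQ.const_mul ε)).add hN
  have iN : Integrable (fun z => N z * (φ z.1 - φ z.2)) (squareMeasure T) := by
    simp only [mul_sub]
    exact (integrable_mul_fst hN hφ hφ1).sub (integrable_mul_snd hN hφ hφ1)
  have hzero : b * (2 * T * ∫ x, P x * φ x ∂(periodMeasure T)) +
      ε * (2 * T * ∫ x, Q x * φ x ∂(periodMeasure T)) +
      ∫ z, N z * (φ z.1 - φ z.2) ∂(squareMeasure T) = 0 := by
    have h0 : ∫ z, (b * (P z.1 - P z.2) + ε * (Q z.1 - Q z.2) + N z) * (φ z.1 - φ z.2)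
        ∂(squareMeasure T) = 0 := by
      simp only [mul_sub (_ + _ + _)]
      rw [integral_sub (integrable_mul_fst hG hφ hφ1) (integrable_mul_snd hG hφ hφ1),
        (hfree φ hφ hφ1).1, (hfree φ hφ hφ1).2, sub_zero]
    rw [← eP, ← eQ, ← integral_const_mul, ← integral_const_mul, ← h0,
      ← integral_add' (iP.const_mul b) (iQ.const_mul ε),
      ← integral_add' ((iP.const_mul b).add (iQ.const_mul ε)) iN]
    refine integral_congr_ae (Eventually.of_forall fun z => ?_)
    simp only [Pi.add_apply]; ring
  have hφi : Integrable (fun x => |φ x|) (periodMeasure T) :=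
    (integrable_of_abs_le hφ.aestronglyMeasurable (Eventually.of_forall hφ1)).abs
  have hlow : -(C * (2 * T * ∫ x, |φ x| ∂(periodMeasure T))) ≤
      ∫ z, N z * (φ z.1 - φ z.2) ∂(squareMeasure T) := by
    have e1 : ∫ z : ℝ × ℝ, |φ z.1| ∂(squareMeasure T) = T * ∫ x, |φ x| ∂(periodMeasure T) := by
      have := integral_fun_fst (μ := periodMeasure T) (ν := periodMeasure T) (fun x => |φ x|)
      rw [this]; simp [Measure.real, hT.le]
    have e2 : ∫ z : ℝ × ℝ, |φ z.2| ∂(squareMeasure T) = T * ∫ x, |φ x| ∂(periodMeasure T) := by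
      have := integral_fun_snd (μ := periodMeasure T) (ν := periodMeasure T) (fun x => |φ x|)
      rw [this]; simp [Measure.real, hT.le]
    have i1 : Integrable (fun z : ℝ × ℝ => |φ z.1|) (squareMeasure T) := hφi.comp_fst _
    have i2 : Integrable (fun z : ℝ × ℝ => |φ z.2|) (squareMeasure T) := hφi.comp_snd _
    have e3 : ∫ z : ℝ × ℝ, -(C * (|φ z.1| + |φ z.2|)) ∂(squareMeasure T) =
        -(C * (2 * T * ∫ x, |φ x| ∂(periodMeasure T))) := by
      rw [integral_neg, integral_const_mul, integral_add i1 i2, e1, e2]; ring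
    rw [← e3]
    refine integral_mono_ae ((i1.add i2).const_mul C).neg iN ?_
    filter_upwards [hsign] with z hz
    have hle : ∀ a b : ℝ, b - a ≤ |a| + |b| := fun a b => by
      linarith [neg_abs_le a, le_abs_self b]
    rcases lt_trichotomy (P z.1) (P z.2) with h | h | h
    · have hm : φ z.1 ≤ φ z.2 := truncSign_mono h.le
      have h1 := hle (φ z.1) (φ z.2)
      have h2 := hz.2 h
      nlinarith [mul_le_mul_of_nonneg_left h1 hC,
        mul_le_mul_of_nonneg_right h2 (sub_nonneg.2 hm)]
    -- Where the two values of `P` agree there is no bound on `N`, but the test function vanishes.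
    · have hm : φ z.1 = φ z.2 := by simp only [hφdef, h]
      rw [hm, sub_self, mul_zero]
      have : 0 ≤ C * (|φ z.2| + |φ z.2|) := by positivity
      linarith
    · have hm : φ z.2 ≤ φ z.1 := truncSign_mono h.le
      have h1 := hle (φ z.2) (φ z.1)
      have h2 := hz.1 h
      nlinarith [mul_le_mul_of_nonneg_left h1 hC,
        mul_le_mul_of_nonneg_right h2 (sub_nonneg.2 hm)]
  have h2T : 0 < 2 * T := by linarith
  nlinarith [hzero, hlow, h2T]

/-- The maximum principle for the coupled kernel equations. -/
lemma abs_le_of_isMarginFree (hT : 0 < T) {P Q : ℝ → ℝ} {N N' : ℝ × ℝ → ℝ} {b ε C : ℝ}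
    (hC : 0 ≤ C) (hε : 2 * |ε| < b) (hPm : Measurable P) (hQm : Measurable Q)
    (hP : Integrable P (periodMeasure T)) (hQ : Integrable Q (periodMeasure T))
    (hN : Integrable N (squareMeasure T)) (hN' : Integrable N' (squareMeasure T))
    (hP0 : ∫ x, P x ∂(periodMeasure T) = 0) (hQ0 : ∫ x, Q x ∂(periodMeasure T) = 0)
    (hfree : IsMarginFree T fun z => b * (P z.1 - P z.2) + ε * (Q z.1 - Q z.2) + N z)
    (hfree' : IsMarginFree T fun z => b * (Q z.1 - Q z.2) + ε * (P z.1 - P z.2) + N' z)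
    (hsign : ∀ᵐ z ∂(squareMeasure T), (P z.2 < P z.1 → -C ≤ N z) ∧ (P z.1 < P z.2 → N z ≤ C))
    (hsign' : ∀ᵐ z ∂(squareMeasure T),
      (Q z.2 < Q z.1 → -C ≤ N' z) ∧ (Q z.1 < Q z.2 → N' z ≤ C)) :
    ∀ᵐ x ∂(periodMeasure T), |P x| ≤ C / (b - 2 * |ε|) ∧ |Q x| ≤ C / (b - 2 * |ε|) := by
  have hd : 0 < b - 2 * |ε| := by linarith
  set M := C / (b - 2 * |ε|) with hMdef
  have hM : 0 ≤ M := div_nonneg hC hd.le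
  have hCM : C = (b - 2 * |ε|) * M := by rw [hMdef]; field_simp
  have h1 := integral_mul_truncSign_le (M := M) hT hC hPm hP hQ hN hP0 hQ0 hfree hsign
  have h2 := integral_mul_truncSign_le (M := M) hT hC hQm hQ hP hN' hQ0 hP0 hfree' hsign'
  have mP : Measurable (fun x => truncSign M (P x)) := measurable_truncSign.comp hPm
  have mQ : Measurable (fun x => truncSign M (Q x)) := measurable_truncSign.comp hQm
  have bP : ∀ x, |truncSign M (P x)| ≤ 1 := fun x => abs_truncSign_le_one _
  have bQ : ∀ x, |truncSign M (Q x)| ≤ 1 := fun x => abs_truncSign_le_one _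
  have iPP := integrable_mul_bdd_period hP mP bP
  have iQP := integrable_mul_bdd_period hQ mP bP
  have iPQ := integrable_mul_bdd_period hP mQ bQ
  have iQQ := integrable_mul_bdd_period hQ mQ bQ
  have iP : Integrable (fun x => |truncSign M (P x)|) (periodMeasure T) :=
    (integrable_of_abs_le mP.aestronglyMeasurable (Eventually.of_forall bP)).abs
  have iQ : Integrable (fun x => |truncSign M (Q x)|) (periodMeasure T) :=
    (integrable_of_abs_le mQ.aestronglyMeasurable (Eventually.of_forall bQ)).abs
  -- This is the excess of `|P|` and `|Q|` over `M`. It is nonnegative, and the two tested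
  -- inequalities force its integral to be nonpositive.
  let g : ℝ → ℝ := fun x => (|P x| - M) * |truncSign M (P x)| + (|Q x| - M) * |truncSign M (Q x)|
  have hg0 : ∀ x, 0 ≤ g x := fun x =>
    add_nonneg (sub_mul_abs_truncSign_nonneg _) (sub_mul_abs_truncSign_nonneg _)
  have hgi : Integrable g (periodMeasure T) := by
    simp only [g, sub_mul, ← mul_truncSign hM]
    exact (iPP.sub (iP.const_mul M)).add (iQQ.sub (iQ.const_mul M))
  let k : ℝ → ℝ := fun x => b * (P x * truncSign M (P x)) + ε * (Q x * truncSign M (P x)) -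
    C * |truncSign M (P x)| + (b * (Q x * truncSign M (Q x)) + ε * (P x * truncSign M (Q x)) -
    C * |truncSign M (Q x)|)
  have ik1 := ((iPP.const_mul b).add (iQP.const_mul ε)).sub (iP.const_mul C)
  have ik2 := ((iQQ.const_mul b).add (iPQ.const_mul ε)).sub (iQ.const_mul C)
  have hk : ∫ x, k x ∂(periodMeasure T) ≤ 0 := by
    have : ∫ x, k x ∂(periodMeasure T) = _ := integral_add' ik1 ik2
    rw [this, integral_linear_comb iPP iQP iP, integral_linear_comb iQQ iPQ iQ]
    linarith
  -- Each of the two coupling terms is bounded by `|ε|` times the sum of both diagonal terms;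
  -- together they cost `2|ε|`. The choice of `M` makes the terms in `C` match exactly.
  have hle : ∀ x, (b - 2 * |ε|) * g x ≤ k x := by
    intro x
    have c1 : -(|ε| * (|Q x| * |truncSign M (P x)|)) ≤ ε * (Q x * truncSign M (P x)) := by
      rw [← abs_mul, ← abs_mul]; exact neg_abs_le _
    have c2 : -(|ε| * (|P x| * |truncSign M (Q x)|)) ≤ ε * (P x * truncSign M (Q x)) := by
      rw [← abs_mul, ← abs_mul]; exact neg_abs_le _
    have d1 := mul_le_mul_of_nonneg_left (abs_mul_truncSign_le (M := M) (P x) (Q x)) (abs_nonneg ε)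
    have d2 := mul_le_mul_of_nonneg_left (abs_mul_truncSign_le (M := M) (Q x) (P x)) (abs_nonneg ε)
    simp only [g, k, mul_truncSign hM, hCM]
    nlinarith
  have hint : ∫ x, g x ∂(periodMeasure T) = 0 := by
    refine le_antisymm ?_ (integral_nonneg hg0)
    have := integral_mono (hgi.const_mul (b - 2 * |ε|)) (ik1.add ik2) hle
    rw [integral_const_mul] at this
    have h3 : (b - 2 * |ε|) * ∫ x, g x ∂(periodMeasure T) ≤ 0 := this.trans hk
    by_contra hneg
    exact absurd h3 (not_le.2 (mul_pos hd (not_le.1 hneg)))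
  have hae := (integral_eq_zero_iff_of_nonneg hg0 hgi).1 hint
  filter_upwards [hae] with x hx
  have hx' : g x = 0 := hx
  have e1 := sub_mul_abs_truncSign_nonneg (M := M) (P x)
  have e2 := sub_mul_abs_truncSign_nonneg (M := M) (Q x)
  simp only [g] at hx'
  constructor <;> by_contra hcon <;> rw [not_le] at hcon
  · rw [abs_truncSign_of_lt hcon, mul_one] at hx'; linarith
  · rw [abs_truncSign_of_lt hcon, mul_one] at hx'; linarith

end

/-! ### The coupled nonlinear system on the torus: bounds and Lipschitz estimates for the kernel
part. -/

section

variable {T b ε : ℝ} {U V : ℝ × ℝ → ℝ} {F G : ℝ × ℝ → ℝ → ℝ}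

/-- The candidate for the profile of the kernel component of an antisymmetric `U`. -/
noncomputable def kernelPart (T : ℝ) (U : ℝ × ℝ → ℝ) (x : ℝ) : ℝ :=
  periodMean T fun y => U (x, y)

lemma measurable_kernelPart (hU : Measurable U) : Measurable (kernelPart T U) :=
  (hU.stronglyMeasurable.integral_prod_right' (ν := periodMeasure T)).measurable.div_const T

lemma integrable_kernelPart (hU : Integrable U (squareMeasure T)) :
    Integrable (kernelPart T U) (periodMeasure T) := hU.integral_prod_left.div_const T

lemma integral_kernelPart (hU : Integrable U (squareMeasure T)) (hanti : ∀ z, U z.swap = -U z) :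
    ∫ x, kernelPart T U x ∂(periodMeasure T) = 0 := by
  have h0 : ∫ z, U z ∂(squareMeasure T) = 0 := by
    have := integral_square_swap (T := T) U
    simp only [hanti, integral_neg] at this
    linarith
  rw [integral_prod _ hU] at h0
  simp only [kernelPart, periodMean]
  rw [integral_div, h0, zero_div]

lemma kernelPart_periodic (hU : IsBiperiodic T U) : Periodic (kernelPart T U) T := fun x => by
  simp only [kernelPart, hU.1]

/-- The first of two coupled nonlinear wave equations on the torus `(ℝ / Tℤ)²` in characteristic
coordinates, `4 ∂₁∂₂U + bU + εV + F(U) = 0`, for an antisymmetric unknown `U`. -/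
structure IsWaveComponent (T b ε : ℝ) (U V : ℝ × ℝ → ℝ) (F : ℝ × ℝ → ℝ → ℝ) : Prop where
  measurable : Measurable U
  integrable : Integrable U (squareMeasure T)
  antisymm : ∀ z, U z.swap = -U z
  biperiodic : IsBiperiodic T U
  monotone : ∀ z, Monotone (F z)
  bounded : ∀ R : ℝ, ∃ C : ℝ, ∀ z r, |r| ≤ R → |F z r| ≤ C
  -- Only diagonal shifts occur: they are translations in `t`, which move both arguments of the
  -- kernel part by `h`. No such bound can be asked in `x`, across which the folded nonlinearity
  -- changes sign.
  lipschitz : ∀ R : ℝ, ∃ L : ℝ, 0 ≤ L ∧ ∀ z h r r', 0 ≤ h → |r| ≤ R → |r'| ≤ R →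
    |F (z + (h, h)) r - F z r'| ≤ L * (h + |r - r'|)
  biperiodic_nonlinearity : IsBiperiodic T F
  integrable_nonlinearity : Integrable (fun z => F z (U z)) (squareMeasure T)
  weak : IsWeakWave T U fun z => b * U z + ε * V z + F z (U z)

namespace IsWaveComponent

lemma integrable_source (hS : IsWaveComponent T b ε U V F)
    (hV : Integrable V (squareMeasure T)) :
    Integrable (fun z => b * U z + ε * V z + F z (U z)) (squareMeasure T) :=
  ((hS.integrable.const_mul b).add (hV.const_mul ε)).add hS.integrable_nonlinearity

lemma decomposition (hT : 0 < T) (hS : IsWaveComponent T b ε U V F)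
    (hV : Integrable V (squareMeasure T)) :
    ∀ᵐ z ∂(squareMeasure T), U z = kernelPart T U z.1 - kernelPart T U z.2 +
      waveInverse T (fun z => b * U z + ε * V z + F z (U z)) z :=
  hS.weak.decomposition hT hS.integrable (hS.integrable_source hV) hS.antisymm

/-- This is the source with `b` and `ε` times the regular parts of `U` and `V` subtracted; all three
are margin-free. The result is the projection of the equation to the kernel. -/
lemma isMarginFree (hT : 0 < T) (hS : IsWaveComponent T b ε U V F)
    (hS' : IsWaveComponent T b ε V U G) :
    IsMarginFree T fun z => b * (kernelPart T U z.1 - kernelPart T U z.2) +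
      ε * (kernelPart T V z.1 - kernelPart T V z.2) + F z (U z) := by
  have hH := hS.integrable_source hS'.integrable
  have hK := hS'.integrable_source hS.integrable
  have fH := hS.weak.isMarginFree hT hH
  have fK := hS'.weak.isMarginFree hT hK
  refine ((fH.sub ((fH.waveInverse hT hH).const_mul b) hH
    ((integrable_waveInverse hH).const_mul b)).sub ((fK.waveInverse hT hK).const_mul ε)
    (hH.sub ((integrable_waveInverse hH).const_mul b))
    ((integrable_waveInverse hK).const_mul ε)).congr ?_
  filter_upwards [hS.decomposition hT hS'.integrable, hS'.decomposition hT hS.integrable]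
    with z h1 h2
  linear_combination b * h1 + ε * h2

/-- The sign of the kernel part decides on which side of the bounded function `W` the value `U`
lies, and `F` is monotone and bounded on the range of `W`. -/
lemma exists_sign_bound (hT : 0 < T) (hS : IsWaveComponent T b ε U V F)
    (hV : Integrable V (squareMeasure T)) :
    ∃ C : ℝ, ∀ᵐ z ∂(squareMeasure T),
      (kernelPart T U z.2 < kernelPart T U z.1 → -C ≤ F z (U z)) ∧
      (kernelPart T U z.1 < kernelPart T U z.2 → F z (U z) ≤ C) := by
  obtain ⟨C, hC⟩ := hS.bounded (∫ s, |b * U s + ε * V s + F s (U s)| ∂(squareMeasure T))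
  refine ⟨C, ?_⟩
  filter_upwards [hS.decomposition hT hV] with z hz
  have hw := abs_le.1 (hC z _ (abs_waveInverse_le (hS.integrable_source hV) z))
  constructor <;> intro h
  · exact hw.1.trans (hS.monotone z (by linarith))
  · exact (hS.monotone z (by linarith)).trans hw.2

lemma exists_kernel_bound (hT : 0 < T) (hε : 2 * |ε| < b) (hS : IsWaveComponent T b ε U V F)
    (hS' : IsWaveComponent T b ε V U G) :
    ∃ M : ℝ, ∀ᵐ x ∂(periodMeasure T), |kernelPart T U x| ≤ M ∧ |kernelPart T V x| ≤ M := by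
  obtain ⟨C, hC⟩ := hS.exists_sign_bound hT hS'.integrable
  obtain ⟨C', hC'⟩ := hS'.exists_sign_bound hT hS.integrable
  refine ⟨_, abs_le_of_isMarginFree hT (C := max 0 (max C C')) (le_max_left _ _) hε
    (measurable_kernelPart hS.measurable) (measurable_kernelPart hS'.measurable)
    (integrable_kernelPart hS.integrable) (integrable_kernelPart hS'.integrable)
    hS.integrable_nonlinearity hS'.integrable_nonlinearity
    (integral_kernelPart hS.integrable hS.antisymm)
    (integral_kernelPart hS'.integrable hS'.antisymm)
    (hS.isMarginFree hT hS') (hS'.isMarginFree hT hS) ?_ ?_⟩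
  · filter_upwards [hC] with z hz
    have : C ≤ max 0 (max C C') := (le_max_left _ _).trans (le_max_right _ _)
    exact ⟨fun h => by linarith [hz.1 h], fun h => by linarith [hz.2 h]⟩
  · filter_upwards [hC'] with z hz
    have : C' ≤ max 0 (max C C') := (le_max_right _ _).trans (le_max_right _ _)
    exact ⟨fun h => by linarith [hz.1 h], fun h => by linarith [hz.2 h]⟩

lemma exists_bound (hT : 0 < T) (hS : IsWaveComponent T b ε U V F)
    (hV : Integrable V (squareMeasure T)) {M : ℝ}
    (hM : ∀ᵐ x ∂(periodMeasure T), |kernelPart T U x| ≤ M) :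
    ∃ C : ℝ, ∀ᵐ z ∂(squareMeasure T), |U z| ≤ C := by
  refine ⟨M + M + ∫ s, |b * U s + ε * V s + F s (U s)| ∂(squareMeasure T), ?_⟩
  filter_upwards [hS.decomposition hT hV, ae_square_fst hM, ae_square_snd hM] with z h h1 h2
  rw [h]
  exact (abs_add_le _ _).trans (add_le_add ((abs_sub _ _).trans (add_le_add h1 h2))
    (abs_waveInverse_le (hS.integrable_source hV) z))

lemma exists_source_bound (hS : IsWaveComponent T b ε U V F) {C : ℝ}
    (hU : ∀ᵐ z ∂(squareMeasure T), |U z| ≤ C) (hV : ∀ᵐ z ∂(squareMeasure T), |V z| ≤ C) :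
    ∃ K : ℝ, ∀ᵐ z ∂(squareMeasure T), |b * U z + ε * V z + F z (U z)| ≤ K := by
  obtain ⟨D, hD⟩ := hS.bounded C
  refine ⟨|b| * C + |ε| * C + D, ?_⟩
  filter_upwards [hU, hV] with z h1 h2
  refine (abs_add_le _ _).trans (add_le_add ((abs_add_le _ _).trans (add_le_add ?_ ?_)) (hD _ _ h1))
  · rw [abs_mul]; gcongr
  · rw [abs_mul]; gcongr

/-- Bootstrap: bounded profiles make `U` and `V` bounded, hence the source is bounded and its
convolution with the sawtooth kernel is Lipschitz. -/
lemma exists_waveInverse_lipschitz (hT : 0 < T) (hε : 2 * |ε| < b)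
    (hS : IsWaveComponent T b ε U V F) (hS' : IsWaveComponent T b ε V U G) :
    ∃ K : ℝ, 0 ≤ K ∧ ∀ ζ ζ' : ℝ × ℝ,
      |waveInverse T (fun z => b * U z + ε * V z + F z (U z)) ζ -
        waveInverse T (fun z => b * U z + ε * V z + F z (U z)) ζ'| ≤
        K * (|ζ.1 - ζ'.1| + |ζ.2 - ζ'.2|) := by
  obtain ⟨M, hM⟩ := hS.exists_kernel_bound hT hε hS'
  obtain ⟨C, hC⟩ := hS.exists_bound hT hS'.integrable (hM.mono fun _ h => h.1)
  obtain ⟨C', hC'⟩ := hS'.exists_bound hT hS.integrable (hM.mono fun _ h => h.2)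
  obtain ⟨K, hK⟩ := hS.exists_source_bound (C := max C C')
    (hC.mono fun _ h => h.trans (le_max_left _ _)) (hC'.mono fun _ h => h.trans (le_max_right _ _))
  have hK' : ∀ᵐ z ∂(squareMeasure T), |b * U z + ε * V z + F z (U z)| ≤ max K 0 :=
    hK.mono fun _ h => h.trans (le_max_left _ _)
  exact ⟨max K 0 * T, mul_nonneg (le_max_right _ _) hT.le,
    abs_waveInverse_sub_le hT (hS.integrable_source hS'.integrable) hK'⟩

lemma decomposition_shift (hT : 0 < T) (hS : IsWaveComponent T b ε U V F)
    (hV : Integrable V (squareMeasure T)) (h : ℝ) :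
    ∀ᵐ z ∂(squareMeasure T), U (z + (h, h)) = kernelPart T U (z.1 + h) - kernelPart T U (z.2 + h) +
      waveInverse T (fun z => b * U z + ε * V z + F z (U z)) (z + (h, h)) := by
  refine IsBiperiodic.ae_shift (p := fun z => U z = kernelPart T U z.1 - kernelPart T U z.2 +
      waveInverse T (fun z => b * U z + ε * V z + F z (U z)) z) hT ?_
      (hS.decomposition hT hV) h
  constructor <;> intro x y
  · simp only [hS.biperiodic.1, kernelPart_periodic hS.biperiodic x, waveInverse_add_fst hT]
  · simp only [hS.biperiodic.2, kernelPart_periodic hS.biperiodic y, waveInverse_add_snd hT]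

/-- The comparison value is the shifted kernel part plus the unshifted `W`. Monotonicity at the
fixed point `z` compares it with `U z`, and the Lipschitz bounds compare it with the shifted value.
-/
lemma exists_increment_bound (hT : 0 < T) (hε : 2 * |ε| < b)
    (hS : IsWaveComponent T b ε U V F) (hS' : IsWaveComponent T b ε V U G) :
    ∃ L : ℝ, 0 ≤ L ∧ ∀ h : ℝ, 0 ≤ h → ∀ᵐ z ∂(squareMeasure T),
      ((kernelPart T U (z.2 + h) - kernelPart T U z.2 <
        kernelPart T U (z.1 + h) - kernelPart T U z.1) →
        -(L * h) ≤ F (z + (h, h)) (U (z + (h, h))) - F z (U z)) ∧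
      ((kernelPart T U (z.1 + h) - kernelPart T U z.1 <
        kernelPart T U (z.2 + h) - kernelPart T U z.2) →
        F (z + (h, h)) (U (z + (h, h))) - F z (U z) ≤ L * h) := by
  obtain ⟨M, hM'⟩ := hS.exists_kernel_bound hT hε hS'
  have hM : ∀ᵐ x ∂(periodMeasure T), |kernelPart T U x| ≤ M := hM'.mono fun _ h => h.1
  obtain ⟨K, hK0, hK⟩ := hS.exists_waveInverse_lipschitz hT hε hS'
  set w := waveInverse T (fun z => b * U z + ε * V z + F z (U z)) with hw
  set C := ∫ s, |b * U s + ε * V s + F s (U s)| ∂(squareMeasure T) with hC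
  have hwC : ∀ z, |w z| ≤ C := abs_waveInverse_le (hS.integrable_source hS'.integrable)
  obtain ⟨L, hL0, hL⟩ := hS.lipschitz (M + M + C)
  -- One `h` comes from the explicit dependence of `F` on the point; `2Kh` is the variation of `W`
  -- when both coordinates move by `h`.
  refine ⟨L * (1 + 2 * K), by positivity, fun h hh => ?_⟩
  have hMh : ∀ᵐ x ∂(periodMeasure T), |kernelPart T U (x + h)| ≤ M := by
    have h1 := ae_of_ae_periodMeasure hT (fun x => by
      simp only [kernelPart_periodic hS.biperiodic x]) hM
    exact ae_periodMeasure_of_ae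
      ((measurePreserving_add_right (volume : Measure ℝ) h).quasiMeasurePreserving.ae h1)
  filter_upwards [hS.decomposition hT hS'.integrable, hS.decomposition_shift hT hS'.integrable h,
    ae_square_fst hMh, ae_square_snd hMh] with z d1 d2 m1 m2
  set u := kernelPart T U (z.1 + h) - kernelPart T U (z.2 + h) with hu
  have hubd : |u| ≤ M + M := (abs_sub _ _).trans (add_le_add m1 m2)
  have r1 : |u + w (z + (h, h))| ≤ M + M + C :=
    (abs_add_le _ _).trans (add_le_add hubd (hwC _))
  have r2 : |u + w z| ≤ M + M + C := (abs_add_le _ _).trans (add_le_add hubd (hwC _))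
  have hdiff := hL z h _ _ hh r1 r2
  have hwdiff : |u + w (z + (h, h)) - (u + w z)| ≤ K * (h + h) := by
    have := hK (z + (h, h)) z
    simp only [Prod.fst_add, Prod.snd_add, add_sub_cancel_left, abs_of_nonneg hh] at this
    simpa using this
  have hbd : |F (z + (h, h)) (u + w (z + (h, h))) - F z (u + w z)| ≤ L * (1 + 2 * K) * h := by
    refine hdiff.trans ?_
    have := mul_le_mul_of_nonneg_left hwdiff hL0
    nlinarith
  rw [abs_le] at hbd
  rw [d2]
  constructor <;> intro hlt
  · have hmono : F z (U z) ≤ F z (u + w z) := hS.monotone z (by rw [d1]; linarith)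
    linarith [hbd.1]
  · have hmono : F z (u + w z) ≤ F z (U z) := hS.monotone z (by rw [d1]; linarith)
    linarith [hbd.2]

lemma isMarginFree_increment (hT : 0 < T) (hS : IsWaveComponent T b ε U V F)
    (hS' : IsWaveComponent T b ε V U G) (h : ℝ) :
    IsMarginFree T fun z =>
      b * ((kernelPart T U (z.1 + h) - kernelPart T U z.1) -
        (kernelPart T U (z.2 + h) - kernelPart T U z.2)) +
      ε * ((kernelPart T V (z.1 + h) - kernelPart T V z.1) -
        (kernelPart T V (z.2 + h) - kernelPart T V z.2)) +
      (F (z + (h, h)) (U (z + (h, h))) - F z (U z)) := by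
  have hfree := hS.isMarginFree hT hS'
  have iP := integrable_kernelPart hS.integrable
  have iQ := integrable_kernelPart hS'.integrable
  have hi : Integrable (fun z : ℝ × ℝ => b * (kernelPart T U z.1 - kernelPart T U z.2) +
      ε * (kernelPart T V z.1 - kernelPart T V z.2) + F z (U z)) (squareMeasure T) :=
    ((((iP.comp_fst _).sub (iP.comp_snd _)).const_mul b).add
      (((iQ.comp_fst _).sub (iQ.comp_snd _)).const_mul ε)).add hS.integrable_nonlinearity
  have hp : IsBiperiodic T (fun z : ℝ × ℝ => b * (kernelPart T U z.1 - kernelPart T U z.2) +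
      ε * (kernelPart T V z.1 - kernelPart T V z.2) + F z (U z)) := by
    constructor <;> intro x y
    · simp only [kernelPart_periodic hS.biperiodic x, kernelPart_periodic hS'.biperiodic x,
        hS.biperiodic.1, hS.biperiodic_nonlinearity.1]
    · simp only [kernelPart_periodic hS.biperiodic y, kernelPart_periodic hS'.biperiodic y,
        hS.biperiodic.2, hS.biperiodic_nonlinearity.2]
  refine ((hfree.shift hT hp hi h).sub hfree (hp.integrable_shift hT hi h) hi).congr
    (Eventually.of_forall fun z => ?_)
  simp only [Prod.fst_add, Prod.snd_add]
  ring

lemma biperiodic_comp_nonlinearity (hS : IsWaveComponent T b ε U V F) :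
    IsBiperiodic T (fun z => F z (U z)) := by
  constructor <;> intro x y
  · simp only [hS.biperiodic.1, hS.biperiodic_nonlinearity.1]
  · simp only [hS.biperiodic.2, hS.biperiodic_nonlinearity.2]

/-- The maximum principle is applied to the increments of the two profiles, with constant `max L L'
* h` in place of `C`. -/
lemma exists_lipschitz_kernelPart (hT : 0 < T) (hε : 2 * |ε| < b)
    (hS : IsWaveComponent T b ε U V F) (hS' : IsWaveComponent T b ε V U G) :
    ∃ (L : NNReal) (R : ℝ → ℝ), LipschitzWith L R ∧ Periodic R T ∧
      kernelPart T U =ᵐ[volume] R := by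
  obtain ⟨L, hL0, hL⟩ := hS.exists_increment_bound hT hε hS'
  obtain ⟨L', hL0', hL'⟩ := hS'.exists_increment_bound hT hε hS
  have hd : 0 < b - 2 * |ε| := by linarith
  have hmax : 0 ≤ max L L' := hL0.trans (le_max_left _ _)
  have iP := integrable_kernelPart hS.integrable
  have iQ := integrable_kernelPart hS'.integrable
  have pP := kernelPart_periodic hS.biperiodic
  have pQ := kernelPart_periodic hS'.biperiodic
  have mP := measurable_kernelPart (T := T) hS.measurable
  have mQ := measurable_kernelPart (T := T) hS'.measurable
  have hshift : ∀ (P : ℝ → ℝ), Periodic P T → Integrable P (periodMeasure T) →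
      ∀ h, Integrable (fun x => P (x + h)) (periodMeasure T) := by
    intro P hp hi h
    have := (measurePreserving_wrap_add hT h).integrable_comp_of_integrable hi
    exact this.congr (Eventually.of_forall fun x => hp.apply_wrap hT (x + h))
  have hzero : ∀ (P : ℝ → ℝ), Periodic P T → Integrable P (periodMeasure T) →
      ∀ h, ∫ x, (P (x + h) - P x) ∂(periodMeasure T) = 0 := by
    intro P hp hi h
    rw [integral_sub (hshift P hp hi h) hi, integral_periodMeasure_add hT hp, sub_self]
  refine ⟨⟨max L L' / (b - 2 * |ε|), div_nonneg hmax hd.le⟩,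
    exists_lipschitz_representative hT pP iP fun h hh => ?_⟩
  have key := abs_le_of_isMarginFree hT (C := max L L' * h) (mul_nonneg hmax hh) hε
    ((mP.comp (measurable_add_const h)).sub mP) ((mQ.comp (measurable_add_const h)).sub mQ)
    ((hshift _ pP iP h).sub iP) ((hshift _ pQ iQ h).sub iQ)
    ((hS.biperiodic_comp_nonlinearity.integrable_shift hT hS.integrable_nonlinearity h).sub
      hS.integrable_nonlinearity)
    ((hS'.biperiodic_comp_nonlinearity.integrable_shift hT hS'.integrable_nonlinearity h).sub
      hS'.integrable_nonlinearity)
    (hzero _ pP iP h) (hzero _ pQ iQ h)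
    (hS.isMarginFree_increment hT hS' h) (hS'.isMarginFree_increment hT hS h) (by
      filter_upwards [hL h hh] with z hz
      have : L * h ≤ max L L' * h := mul_le_mul_of_nonneg_right (le_max_left _ _) hh
      exact ⟨fun h => (neg_le_neg this).trans (hz.1 h), fun h => (hz.2 h).trans this⟩) (by
      filter_upwards [hL' h hh] with z hz
      have : L' * h ≤ max L L' * h := mul_le_mul_of_nonneg_right (le_max_right _ _) hh
      exact ⟨fun h => (neg_le_neg this).trans (hz.1 h), fun h => (hz.2 h).trans this⟩)
  refine ae_of_ae_periodMeasure hT (fun x => ?_) (key.mono fun x hx => hx.1.trans_eq ?_)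
  · simp only [add_right_comm x T h, pP x, pP (x + h)]
  · exact (div_mul_eq_mul_div _ _ _).symm

end IsWaveComponent

end

/-! ### Folding the torus of side `4π` onto the rectangle. -/

/-- Reduction of characteristic coordinates `(t + x, t - x)` to the rectangle `Ω`. -/
noncomputable def foldMap (z : ℝ × ℝ) : ℝ × ℝ :=
  (wrap (2 * π) ((z.1 + z.2) / 2), Real.arccos (Real.cos ((z.1 - z.2) / 2)))

/-- The sign with which functions odd in `x` transform under `foldMap`. -/
noncomputable def foldSign (z : ℝ × ℝ) : ℝ := Real.sign (Real.sin ((z.1 - z.2) / 2))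

/-- The extension of a function on `Ω`, odd in `x` and periodic in `t` and `x`, in characteristic
coordinates. -/
noncomputable def oddExtension (u : ℝ × ℝ → ℝ) (z : ℝ × ℝ) : ℝ := foldSign z * u (foldMap z)

/-- Functions of `(t + x, t - x)` that are odd and `2π`-periodic in `x`, and `2π`-periodic
in `t`. -/
structure IsOddPeriodic (Φ : ℝ × ℝ → ℝ) : Prop where
  swap : ∀ z, Φ z.swap = -Φ z
  time : ∀ x y, Φ (x + 2 * π, y + 2 * π) = Φ (x, y)
  space : ∀ x y, Φ (x + 2 * π, y - 2 * π) = Φ (x, y)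

/-- The periods `(2π, 2π)` and `(2π, -2π)` add up to `(4π, 0)`; this is why the torus has side `4π`
and carries one further diagonal symmetry. -/
lemma IsOddPeriodic.biperiodic {Φ : ℝ × ℝ → ℝ} (h : IsOddPeriodic Φ) :
    IsBiperiodic (4 * π) Φ := by
  constructor <;> intro x y
  · rw [← h.space x y, ← h.time (x + 2 * π) (y - 2 * π)]
    congr 2 <;> ring
  · rw [← h.time x y, ← h.space x (y + 4 * π)]
    congr 2; ring

lemma IsOddPeriodic.sub_int {Φ : ℝ × ℝ → ℝ} (h : IsOddPeriodic Φ) (x y : ℝ) (m k : ℤ) :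
    Φ (x - m * (2 * π) - k * (2 * π), y - m * (2 * π) + k * (2 * π)) = Φ (x, y) := by
  have h1 : Periodic (fun s => Φ (x + s, y + s)) (2 * π) := fun s => by
    simp only [← add_assoc]; exact h.time _ _
  have h2 : Periodic (fun s => Φ (x - m * (2 * π) + s, y - m * (2 * π) - s)) (2 * π) := fun s => by
    simp only [← add_assoc, ← sub_sub]; exact h.space _ _
  have e1 := h1.sub_int_mul_eq (x := 0) m
  have e2 := h2.sub_int_mul_eq (x := 0) k
  simp only [zero_sub, add_zero, sub_zero, ← sub_eq_add_neg, sub_neg_eq_add] at e1 e2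
  rw [e2, e1]

lemma foldSign_swap (z : ℝ × ℝ) : foldSign z.swap = -foldSign z := by
  unfold foldSign
  rw [← Real.sign_neg, ← Real.sin_neg, Prod.fst_swap, Prod.snd_swap]
  congr 2; ring

lemma foldMap_swap (z : ℝ × ℝ) : foldMap z.swap = foldMap z := by
  unfold foldMap
  rw [← Real.cos_neg ((z.1 - z.2) / 2), Prod.fst_swap, Prod.snd_swap]
  congr 2
  · ring
  · congr 1; ring

lemma foldSign_time (x y h : ℝ) : foldSign (x + h, y + h) = foldSign (x, y) := by
  simp [foldSign]

lemma foldMap_time (x y h : ℝ) :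
    foldMap (x + h, y + h) = (wrap (2 * π) ((x + y) / 2 + h), (foldMap (x, y)).2) := by
  simp only [foldMap]
  congr 2
  · ring
  · congr 1; ring

lemma foldSign_space (x y : ℝ) : foldSign (x + 2 * π, y - 2 * π) = foldSign (x, y) := by
  simp only [foldSign]
  rw [show (x + 2 * π - (y - 2 * π)) / 2 = (x - y) / 2 + 2 * π by ring, Real.sin_add_two_pi]

lemma foldMap_space (x y : ℝ) : foldMap (x + 2 * π, y - 2 * π) = foldMap (x, y) := by
  simp only [foldMap]
  rw [show (x + 2 * π - (y - 2 * π)) / 2 = (x - y) / 2 + 2 * π by ring, Real.cos_add_two_pi]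
  congr 2; ring

lemma foldMap_time_two_pi (x y : ℝ) : foldMap (x + 2 * π, y + 2 * π) = foldMap (x, y) := by
  rw [foldMap_time, wrap_periodic Real.two_pi_pos]; rfl

lemma foldMap_biperiodic : IsBiperiodic (4 * π) foldMap := by
  constructor <;> intro x y
  · rw [← foldMap_space x y, ← foldMap_time_two_pi (x + 2 * π) (y - 2 * π)]
    congr 2 <;> ring
  · rw [← foldMap_time_two_pi x y, ← foldMap_space x (y + 4 * π)]
    congr 2; ring

lemma foldSign_biperiodic : IsBiperiodic (4 * π) foldSign := by
  constructor <;> intro x y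
  · rw [← foldSign_space x y, ← foldSign_time (x + 2 * π) (y - 2 * π) (2 * π)]
    congr 2 <;> ring
  · rw [← foldSign_time x y (2 * π), ← foldSign_space x (y + 4 * π)]
    congr 2; ring

lemma isOddPeriodic_oddExtension (u : ℝ × ℝ → ℝ) : IsOddPeriodic (oddExtension u) where
  swap z := by simp only [oddExtension, foldSign_swap, foldMap_swap]; ring
  time x y := by simp only [oddExtension, foldSign_time, foldMap_time_two_pi]
  space x y := by simp only [oddExtension, foldSign_space, foldMap_space]

lemma foldMap_mem (z : ℝ × ℝ) : foldMap z ∈ Omega :=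
  ⟨Ico_subset_Icc_self (wrap_mem Real.two_pi_pos _), Real.arccos_nonneg _, Real.arccos_le_pi _⟩

lemma measurable_foldMap : Measurable foldMap := by
  unfold foldMap
  exact (measurable_wrap.comp (by fun_prop)).prodMk
    (Real.continuous_arccos.measurable.comp (by fun_prop))

lemma measurable_foldSign : Measurable foldSign := by
  have : Measurable Real.sign := by
    unfold Real.sign
    exact Measurable.ite measurableSet_Iio measurable_const
      (Measurable.ite measurableSet_Ioi measurable_const measurable_const)
  unfold foldSign
  exact this.comp (by fun_prop)

lemma foldSign_cases (z : ℝ × ℝ) : foldSign z = -1 ∨ foldSign z = 0 ∨ foldSign z = 1 :=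
  Real.sign_apply_eq _

lemma abs_foldSign_le (z : ℝ × ℝ) : |foldSign z| ≤ 1 := by
  rcases foldSign_cases z with h | h | h <;> simp [h]

/-- Odd periodic functions transform with `foldSign` under `foldMap`. -/
lemma IsOddPeriodic.apply_foldMap {Φ : ℝ × ℝ → ℝ} (h : IsOddPeriodic Φ) (z : ℝ × ℝ) :
    Φ ((foldMap z).1 + (foldMap z).2, (foldMap z).1 - (foldMap z).2) = foldSign z * Φ z := by
  set t := (foldMap z).1 with ht
  set x := (foldMap z).2 with hx
  obtain ⟨m, hm⟩ : ∃ m : ℤ, t = (z.1 + z.2) / 2 - m * (2 * π) :=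
    ⟨_, wrap_eq_sub Real.two_pi_pos _⟩
  have hcos : Real.cos x = Real.cos ((z.1 - z.2) / 2) :=
    Real.cos_arccos (Real.neg_one_le_cos _) (Real.cos_le_one _)
  have hsin : 0 ≤ Real.sin x :=
    Real.sin_nonneg_of_nonneg_of_le_pi (Real.arccos_nonneg _) (Real.arccos_le_pi _)
  -- The folded `x` is congruent modulo `2π` to the original one or to its negative; the second case
  -- is the swap of the characteristic coordinates.
  obtain ⟨k, hk⟩ := Real.cos_eq_cos_iff.1 hcos
  have hcase : (Φ (t + x, t - x) = Φ z ∧ Real.sin ((z.1 - z.2) / 2) = Real.sin x) ∨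
      (Φ (t + x, t - x) = -Φ z ∧ Real.sin ((z.1 - z.2) / 2) = -Real.sin x) := by
    rcases hk with hk | hk
    · left
      constructor
      · rw [← h.sub_int z.1 z.2 m k]
        congr 2 <;> rw [hm] <;> linarith
      · rw [hk, show 2 * k * π + x = x + k * (2 * π) by ring, Real.sin_add_int_mul_two_pi]
    · right
      constructor
      · rw [← h.swap z, ← h.sub_int z.swap.1 z.swap.2 m (-k)]
        simp only [Prod.fst_swap, Prod.snd_swap, Int.cast_neg]
        congr 2 <;> rw [hm] <;> linarith
      · rw [hk, show 2 * k * π - x = -x + k * (2 * π) by ring, Real.sin_add_int_mul_two_pi,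
          Real.sin_neg]
  rcases hsin.eq_or_lt with h0 | h0
  -- On the fold lines `foldSign` is zero. There a period carries `z` to its swap, so an odd
  -- periodic function vanishes as well.
  · have hs : Real.sin ((z.1 - z.2) / 2) = 0 := by
      rcases hcase with hc | hc <;> simp [hc.2, ← h0]
    obtain ⟨n, hn⟩ := Real.sin_eq_zero_iff.1 hs
    have hzero : Φ z = 0 := by
      have h1 := h.sub_int z.1 z.2 0 n
      have h2 := h.swap z
      have h3 : ((z.1 - (0 : ℤ) * (2 * π) - n * (2 * π),
          z.2 - (0 : ℤ) * (2 * π) + n * (2 * π)) : ℝ × ℝ) = z.swap := by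
        ext
        · simp; linarith
        · simp; linarith
      rw [h3] at h1
      change Φ z.swap = Φ z at h1
      linarith
    rcases hcase with hc | hc <;> rw [hc.1, hzero] <;> simp
  · rcases hcase with hc | hc
    · rw [hc.1, foldSign, hc.2, Real.sign_of_pos h0, one_mul]
    · rw [hc.1, foldSign, hc.2, Real.sign_of_neg (by linarith)]; ring

lemma mul_apply_foldMap {Φ : ℝ × ℝ → ℝ} (h : IsOddPeriodic Φ) (u : ℝ × ℝ → ℝ) (z : ℝ × ℝ) :
    u (foldMap z) * Φ ((foldMap z).1 + (foldMap z).2, (foldMap z).1 - (foldMap z).2) =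
      oddExtension u z * Φ z := by
  rw [h.apply_foldMap, oddExtension]; ring

lemma lintegral_double_period {T : ℝ} (hT : 0 < T) {q : ℝ → ENNReal} (hq : Periodic q T) :
    ∫⁻ x, q x ∂(periodMeasure (2 * T)) = 2 * ∫⁻ x, q x ∂(periodMeasure T) := by
  have hU : Ioc 0 (2 * T) = Ioc 0 T ∪ Ioc T (T + T) := by
    rw [Ioc_union_Ioc_eq_Ioc hT.le (by linarith), two_mul]
  rw [periodMeasure, hU, lintegral_union measurableSet_Ioc (by
    rw [disjoint_left]; intro x h1 h2; exact absurd h1.2 (not_le.2 h2.1)),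
    lintegral_Ioc_of_periodic hT hq T 0, zero_add, two_mul]

lemma lintegral_comp_half {T : ℝ} {q : ℝ → ENNReal} (hq : Measurable q) :
    ∫⁻ x, q (x / 2) ∂(periodMeasure (2 * T)) = 2 * ∫⁻ x, q x ∂(periodMeasure T) := by
  have hm : Measurable ((Ioc 0 T).indicator q) := hq.indicator measurableSet_Ioc
  have h1 : ∀ x : ℝ, (Ioc 0 (2 * T)).indicator (fun x => q (x / 2)) x =
      (Ioc 0 T).indicator q (2⁻¹ * x) := by
    intro x
    have : x ∈ Ioc 0 (2 * T) ↔ 2⁻¹ * x ∈ Ioc 0 T := by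
      simp only [mem_Ioc]
      constructor <;> rintro ⟨h1, h2⟩ <;> constructor <;> linarith
    by_cases hx : x ∈ Ioc 0 (2 * T)
    · rw [indicator_of_mem hx, indicator_of_mem (this.1 hx)]; congr 1; ring
    · rw [indicator_of_notMem hx, indicator_of_notMem (fun h => hx (this.2 h))]
  rw [periodMeasure, periodMeasure, ← lintegral_indicator measurableSet_Ioc,
    ← lintegral_indicator measurableSet_Ioc]
  simp only [h1]
  rw [← lintegral_map hm (measurable_const_mul _), Real.map_volume_mul_left (by norm_num)]
  rw [lintegral_smul_measure]
  simp

lemma lintegral_fold {g : ℝ → ENNReal} :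
    ∫⁻ x, g (Real.arccos (Real.cos x)) ∂(periodMeasure (2 * π)) =
      2 * ∫⁻ x, g x ∂(periodMeasure π) := by
  have hp : Periodic (fun x => g (Real.arccos (Real.cos x))) (2 * π) := fun x => by
    simp only [Real.cos_add_two_pi]
  have h0 := lintegral_Ioc_of_periodic Real.two_pi_pos hp 0 (-π)
  rw [zero_add, show -π + 2 * π = π by ring, ← Ioc_union_Ioc_eq_Ioc (b := 0)
    (by linarith [Real.pi_pos]) Real.pi_pos.le, lintegral_union measurableSet_Ioc (by
    rw [disjoint_left]; intro x h1 h2; exact absurd h1.2 (not_le.2 h2.1))] at h0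
  have e1 : ∫⁻ x in Ioc 0 π, g (Real.arccos (Real.cos x)) = ∫⁻ x in Ioc 0 π, g x :=
    setLIntegral_congr_fun measurableSet_Ioc fun x hx => by
      simp only [Real.arccos_cos hx.1.le hx.2]
  have e2 : ∫⁻ x in Ioc (-π) 0, g (Real.arccos (Real.cos x)) = ∫⁻ x in Ioc 0 π, g x := by
    have a1 : ∫⁻ x in Ioc (-π) 0, g (Real.arccos (Real.cos x)) = ∫⁻ x in Ioc (-π) 0, g (-x) :=
      setLIntegral_congr_fun measurableSet_Ioc fun x hx => by
        rw [← Real.cos_neg, Real.arccos_cos (by linarith [hx.2]) (by linarith [hx.1])]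
    have a2 := (Measure.measurePreserving_neg (volume : Measure ℝ)).setLIntegral_comp_emb
      (MeasurableEquiv.neg ℝ).measurableEmbedding g (Ioc (-π) 0)
    rw [a1, a2]
    simp only [image_neg_Ioc, neg_zero, neg_neg]
    rw [setLIntegral_congr Ico_ae_eq_Ioc]
  rw [periodMeasure, h0, e1, e2, two_mul]

/-- The factor `8` is the Jacobian `2` of the characteristic coordinates times `4` preimages of a
generic point: two from the diagonal half-period `(2π, 2π)`, two from the reflection of `x`. In the
iterated integrals it appears as `2 * 2 * 2`. -/
lemma lintegral_foldMap {g : ℝ × ℝ → ENNReal} (hg : Measurable g) :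
    ∫⁻ z, g (foldMap z) ∂(squareMeasure (4 * π)) = 8 * ∫⁻ z in Omega, g z := by
  have h4 : 4 * π = 2 * (2 * π) := by ring
  let k : ℝ → ℝ → ENNReal := fun t x => g (wrap (2 * π) t, Real.arccos (Real.cos x))
  have hk : Measurable (uncurry k) := hg.comp ((measurable_wrap.comp measurable_fst).prodMk
    ((Real.continuous_arccos.comp Real.continuous_cos).measurable.comp measurable_snd))
  have hk1 : ∀ x, Periodic (fun t => k t x) (2 * π) := fun x t => by
    simp only [k, wrap_periodic Real.two_pi_pos t]
  have hk2 : ∀ t, Periodic (k t) (2 * π) := fun t x => by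
    simp only [k, Real.cos_add_two_pi]
  have hinner : ∀ y, ∫⁻ x, g (foldMap (x, y)) ∂(periodMeasure (4 * π)) =
      2 * ∫⁻ s, k (y + s) s ∂(periodMeasure (2 * π)) := by
    intro y
    have hq : Measurable (fun s => k (y + s) s) :=
      hk.comp ((measurable_const_add y).prodMk measurable_id)
    have hp : Periodic (fun s => k (y + s) s) (2 * π) := fun s => by
      simp only [hk2 _ s, ← add_assoc]; exact hk1 s (y + s)
    have hp' : Periodic (fun x => k (y + x / 2) (x / 2)) (4 * π) := fun x => by
      have := hp (x / 2)
      simpa only [show (x + 4 * π) / 2 = x / 2 + 2 * π by ring] using this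
    rw [← lintegral_comp_half hq, ← h4,
      ← lintegral_periodMeasure_add (by positivity) hp' (-y)]
    refine lintegral_congr fun x => ?_
    simp only [k, foldMap]
    congr 3
    ring
  have hm : Measurable (fun p : ℝ × ℝ => k (p.1 + p.2) p.2) :=
    hk.comp ((measurable_fst.add measurable_snd).prodMk measurable_snd)
  rw [lintegral_prod_symm' (fun z => g (foldMap z)) (hg.comp measurable_foldMap)]
  simp only [hinner]
  rw [lintegral_const_mul _ (hm.lintegral_prod_right' (ν := periodMeasure (2 * π))),
    lintegral_lintegral_swap hm.aemeasurable]
  have hstep : ∀ s, ∫⁻ y, k (y + s) s ∂(periodMeasure (4 * π)) =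
      2 * ∫⁻ t, k t s ∂(periodMeasure (2 * π)) := by
    intro s
    rw [h4, lintegral_double_period Real.two_pi_pos
      (fun y => by simp only [add_right_comm y (2 * π) s]; exact hk1 s (y + s)),
      lintegral_periodMeasure_add Real.two_pi_pos (hk1 s)]
  simp only [hstep]
  have hkl : Measurable (fun s => ∫⁻ t, k t s ∂(periodMeasure (2 * π))) :=
    hk.lintegral_prod_left' (μ := periodMeasure (2 * π))
  rw [lintegral_const_mul _ hkl]
  rw [← lintegral_lintegral_swap hk.aemeasurable]
  have hlast : ∀ t, ∫⁻ x, k t x ∂(periodMeasure (2 * π)) =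
      2 * ∫⁻ x, g (wrap (2 * π) t, x) ∂(periodMeasure π) := fun t =>
    lintegral_fold (g := fun x => g (wrap (2 * π) t, x))
  simp only [hlast]
  rw [lintegral_wrap Real.two_pi_pos (fun t => 2 * ∫⁻ x, g (t, x) ∂(periodMeasure π)),
    lintegral_const_mul _ (hg.lintegral_prod_right' (ν := periodMeasure π)),
    ← lintegral_prod _ hg.aemeasurable, Omega, Measure.volume_eq_prod, ← Measure.prod_restrict,
    periodMeasure, periodMeasure, Measure.restrict_congr_set Ioc_ae_eq_Icc,
    Measure.restrict_congr_set Ioc_ae_eq_Icc, ← mul_assoc, ← mul_assoc]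
  norm_num

lemma measurePreserving_foldMap :
    MeasurePreserving foldMap (squareMeasure (4 * π))
      ((8 : ENNReal) • (volume : Measure (ℝ × ℝ)).restrict Omega) := by
  refine ⟨measurable_foldMap, Measure.ext_of_lintegral _ fun g hg => ?_⟩
  rw [lintegral_map hg measurable_foldMap, lintegral_foldMap hg, lintegral_smul_measure]
  rfl

lemma integrable_comp_foldMap {g : ℝ × ℝ → ℝ} (hg : IntegrableOn g Omega) :
    Integrable (fun z => g (foldMap z)) (squareMeasure (4 * π)) :=
  measurePreserving_foldMap.integrable_comp_of_integrable (hg.integrable.smul_measure (by simp))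

lemma integrable_oddExtension {g : ℝ × ℝ → ℝ} (hg : IntegrableOn g Omega) :
    Integrable (oddExtension g) (squareMeasure (4 * π)) :=
  (integrable_comp_foldMap hg).bdd_mul (c := 1) measurable_foldSign.aestronglyMeasurable
    (Eventually.of_forall abs_foldSign_le)

lemma integral_comp_foldMap {g : ℝ × ℝ → ℝ}
    (hg : AEStronglyMeasurable g (volume.restrict Omega)) :
    ∫ z, g (foldMap z) ∂(squareMeasure (4 * π)) = 8 * ∫ z in Omega, g z := by
  have h := measurePreserving_foldMap
  rw [← integral_map h.aemeasurable (by rw [h.map_eq]; exact hg.smul_measure _), h.map_eq,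
    integral_smul_measure]
  simp

lemma ae_foldMap {p : ℝ × ℝ → Prop} (h : ∀ᵐ z ∂(volume.restrict Omega), p z) :
    ∀ᵐ z ∂(squareMeasure (4 * π)), p (foldMap z) :=
  measurePreserving_foldMap.quasiMeasurePreserving.ae (Measure.ae_smul_measure h _)

/-! ### Test functions on the rectangle and transfer of the weak formulation. -/

/-- The product of two travelling waves. -/
def waveProduct (A B : ℝ → ℝ) (z : ℝ × ℝ) : ℝ := A (z.1 + z.2) * B (z.1 - z.2)

/-- Antisymmetrization of `A(ξ) B(η)`, made invariant under `(ξ, η) ↦ (ξ + 2π, η + 2π)`. -/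
noncomputable def oddProduct (A B : ℝ → ℝ) (z : ℝ × ℝ) : ℝ :=
  A z.1 * B z.2 + A (z.1 + 2 * π) * B (z.2 + 2 * π) - A z.2 * B z.1 -
    A (z.2 + 2 * π) * B (z.1 + 2 * π)

lemma isOddPeriodic_oddProduct {A B : ℝ → ℝ} (hA : Periodic A (4 * π)) (hB : Periodic B (4 * π)) :
    IsOddPeriodic (oddProduct A B) := by
  have a1 : ∀ x, A (x + 2 * π + 2 * π) = A x := fun x => by
    rw [← hA x]; congr 1; ring
  have b1 : ∀ x, B (x + 2 * π + 2 * π) = B x := fun x => by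
    rw [← hB x]; congr 1; ring
  have a2 : ∀ x, A (x - 2 * π) = A (x + 2 * π) := fun x => by
    rw [← hA (x - 2 * π)]; congr 1; ring
  have b2 : ∀ x, B (x - 2 * π) = B (x + 2 * π) := fun x => by
    rw [← hB (x - 2 * π)]; congr 1; ring
  refine ⟨fun z => ?_, fun x y => ?_, fun x y => ?_⟩
  · simp only [oddProduct, Prod.fst_swap, Prod.snd_swap]; ring
  · simp only [oddProduct, a1, b1]; ring
  · simp only [oddProduct, a1, b1, a2, b2, sub_add_cancel]; ring

lemma contDiff_waveProduct {A B : ℝ → ℝ} (hA : ContDiff ℝ 2 A) (hB : ContDiff ℝ 2 B) :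
    ContDiff ℝ 2 (waveProduct A B) :=
  (hA.comp (contDiff_fst.add contDiff_snd)).mul (hB.comp (contDiff_fst.sub contDiff_snd))

lemma iteratedDeriv_two_eq {p p' p'' : ℝ → ℝ} (h1 : ∀ s, HasDerivAt p (p' s) s)
    (h2 : ∀ s, HasDerivAt p' (p'' s) s) (s : ℝ) : iteratedDeriv 2 p s = p'' s := by
  have e1 : deriv p = p' := funext fun s => (h1 s).deriv
  rw [show 2 = 1 + 1 from rfl, iteratedDeriv_succ, iteratedDeriv_one, e1, (h2 s).deriv]

lemma dAlembert_waveProduct {A B : ℝ → ℝ} (hA : ContDiff ℝ 2 A) (hB : ContDiff ℝ 2 B)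
    (z : ℝ × ℝ) :
    dAlembert (waveProduct A B) z = 4 * (deriv A (z.1 + z.2) * deriv B (z.1 - z.2)) := by
  have hd : ∀ {f : ℝ → ℝ}, ContDiff ℝ 2 f → (∀ s, HasDerivAt f (deriv f s) s) ∧
      ∀ s, HasDerivAt (deriv f) (deriv (deriv f) s) s := by
    intro f hf
    refine ⟨fun s => (hf.differentiable (by norm_num) s).hasDerivAt, fun s => ?_⟩
    rw [show (2 : WithTop ℕ∞) = 1 + 1 by norm_num, contDiff_succ_iff_deriv] at hf
    exact (hf.2.2.differentiable (by norm_num) s).hasDerivAt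
  obtain ⟨a1, a2⟩ := hd hA
  obtain ⟨b1, b2⟩ := hd hB
  have hp : ∀ {f f' : ℝ → ℝ}, (∀ s, HasDerivAt f (f' s) s) → ∀ c s : ℝ,
      HasDerivAt (fun s => f (s + c)) (f' (s + c)) s := fun h c s => (h (s + c)).comp_add_const s c
  have hm : ∀ {f f' : ℝ → ℝ}, (∀ s, HasDerivAt f (f' s) s) → ∀ c s : ℝ,
      HasDerivAt (fun s => f (s - c)) (f' (s - c)) s := fun h c s => (h (s - c)).comp_sub_const s c
  have hl : ∀ {f f' : ℝ → ℝ}, (∀ s, HasDerivAt f (f' s) s) → ∀ c s : ℝ,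
      HasDerivAt (fun s => f (c + s)) (f' (c + s)) s := fun h c s => (h (c + s)).comp_const_add c s
  have hr : ∀ {f f' : ℝ → ℝ}, (∀ s, HasDerivAt f (f' s) s) → ∀ c s : ℝ,
      HasDerivAt (fun s => f (c - s)) (-f' (c - s)) s := fun h c s => (h (c - s)).comp_const_sub c s
  have e1 : iteratedDeriv 2 (fun t => waveProduct A B (t, z.2)) z.1 = _ :=
    iteratedDeriv_two_eq (fun s => (hp a1 z.2 s).mul (hm b1 z.2 s))
      (fun s => ((hp a2 z.2 s).mul (hm b1 z.2 s)).add ((hp a1 z.2 s).mul (hm b2 z.2 s))) z.1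
  have e2 : iteratedDeriv 2 (fun x => waveProduct A B (z.1, x)) z.2 = _ :=
    iteratedDeriv_two_eq (fun s => (hl a1 z.1 s).mul (hr b1 z.1 s))
      (fun s => ((hl a2 z.1 s).mul (hr b1 z.1 s)).add ((hl a1 z.1 s).mul (hr b2 z.1 s).neg)) z.2
  rw [dAlembert, e1, e2]
  ring

lemma dAlembert_add {φ χ : ℝ × ℝ → ℝ} (hφ : ContDiff ℝ 2 φ) (hχ : ContDiff ℝ 2 χ) (z : ℝ × ℝ) :
    dAlembert (fun z => φ z + χ z) z = dAlembert φ z + dAlembert χ z := by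
  have h1 : ∀ {φ : ℝ × ℝ → ℝ}, ContDiff ℝ 2 φ → ContDiff ℝ 2 (fun t => φ (t, z.2)) :=
    fun h => h.comp (contDiff_id.prodMk contDiff_const)
  have h2 : ∀ {φ : ℝ × ℝ → ℝ}, ContDiff ℝ 2 φ → ContDiff ℝ 2 (fun x => φ (z.1, x)) :=
    fun h => h.comp (contDiff_const.prodMk contDiff_id)
  have e1 := iteratedDeriv_add (n := 2) (x := z.1) (h1 hφ).contDiffAt (h1 hχ).contDiffAt
  have e2 := iteratedDeriv_add (n := 2) (x := z.2) (h2 hφ).contDiffAt (h2 hχ).contDiffAt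
  simp only [dAlembert]
  change iteratedDeriv 2 ((fun t => φ (t, z.2)) + fun t => χ (t, z.2)) z.1 -
    iteratedDeriv 2 ((fun x => φ (z.1, x)) + fun x => χ (z.1, x)) z.2 = _
  rw [e1, e2]; ring

lemma dAlembert_sub {φ χ : ℝ × ℝ → ℝ} (hφ : ContDiff ℝ 2 φ) (hχ : ContDiff ℝ 2 χ) (z : ℝ × ℝ) :
    dAlembert (fun z => φ z - χ z) z = dAlembert φ z - dAlembert χ z := by
  have := dAlembert_add (hφ.sub hχ) hχ z
  simp only [sub_add_cancel] at this
  linarith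

/-- The test function `A(t+x)B(t-x) + A(t+x+2π)B(t-x+2π) - A(t-x)B(t+x) - A(t-x+2π)B(t+x+2π)`. -/
noncomputable def oddTest (A B : ℝ → ℝ) (z : ℝ × ℝ) : ℝ := oddProduct A B (z.1 + z.2, z.1 - z.2)

lemma contDiff_comp_add_const {A : ℝ → ℝ} (hA : ContDiff ℝ 2 A) (c : ℝ) :
    ContDiff ℝ 2 (fun s => A (s + c)) := hA.comp (contDiff_id.add contDiff_const)

lemma oddTest_eq (A B : ℝ → ℝ) :
    oddTest A B = fun z => waveProduct A B z +
      waveProduct (fun s => A (s + 2 * π)) (fun s => B (s + 2 * π)) z - waveProduct B A z -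
      waveProduct (fun s => B (s + 2 * π)) (fun s => A (s + 2 * π)) z := by
  ext z; simp only [oddTest, oddProduct, waveProduct]; ring

lemma contDiff_oddTest {A B : ℝ → ℝ} (hA : ContDiff ℝ 2 A) (hB : ContDiff ℝ 2 B) :
    ContDiff ℝ 2 (oddTest A B) := by
  rw [oddTest_eq]
  have hA' := contDiff_comp_add_const hA (2 * π)
  have hB' := contDiff_comp_add_const hB (2 * π)
  exact (((contDiff_waveProduct hA hB).add (contDiff_waveProduct hA' hB')).sub
    (contDiff_waveProduct hB hA)).sub (contDiff_waveProduct hB' hA')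

lemma dAlembert_oddTest {A B : ℝ → ℝ} (hA : ContDiff ℝ 2 A) (hB : ContDiff ℝ 2 B) (z : ℝ × ℝ) :
    dAlembert (oddTest A B) z = 4 * oddTest (deriv A) (deriv B) z := by
  have hA' := contDiff_comp_add_const hA (2 * π)
  have hB' := contDiff_comp_add_const hB (2 * π)
  have w1 := contDiff_waveProduct hA hB
  have w2 := contDiff_waveProduct hA' hB'
  have w3 := contDiff_waveProduct hB hA
  have w4 := contDiff_waveProduct hB' hA'
  rw [oddTest_eq, dAlembert_sub ((w1.add w2).sub w3) w4, dAlembert_sub (w1.add w2) w3,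
    dAlembert_add w1 w2, dAlembert_waveProduct hA hB, dAlembert_waveProduct hA' hB',
    dAlembert_waveProduct hB hA, dAlembert_waveProduct hB' hA']
  simp only [deriv_comp_add_const, oddTest, oddProduct]
  ring

/-- Antisymmetry gives the Dirichlet condition at `x = 0`; combined with the period `2π` in `x` it
gives the one at `x = π`. -/
lemma isTestFunction_oddTest {A B : ℝ → ℝ} (hA : ContDiff ℝ 2 A) (hB : ContDiff ℝ 2 B)
    (hpA : Periodic A (4 * π)) (hpB : Periodic B (4 * π)) : IsTestFunction (oddTest A B) := by
  have h := isOddPeriodic_oddProduct hpA hpB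
  refine ⟨contDiff_oddTest hA hB, fun t => ?_, fun t => ?_, fun t x _ => ?_⟩
  · simp only [oddTest, oddProduct, add_zero, sub_zero]; ring
  · have h1 := h.swap (t + π, t - π)
    have h2 := h.space (t - π) (t + π)
    rw [show t - π + 2 * π = t + π by ring, show t + π - 2 * π = t - π by ring] at h2
    change oddProduct A B (t + π, t - π) = 0
    change oddProduct A B (t - π, t + π) = _ at h1
    linarith
  · change oddProduct A B (t + 2 * π + x, t + 2 * π - x) = oddProduct A B (t + x, t - x)
    rw [← h.time (t + x) (t - x)]; congr 2 <;> ring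

lemma exists_bound_of_periodic {T : ℝ} (hT : 0 < T) {A : ℝ → ℝ} (hA : Continuous A)
    (hp : Periodic A T) : ∃ C, ∀ x, |A x| ≤ C := by
  obtain ⟨C, hC⟩ := (hp.isBounded_of_continuous hT.ne' hA).exists_norm_le
  exact ⟨C, fun x => hC _ (mem_range_self x)⟩

lemma deriv_periodic {T : ℝ} {A : ℝ → ℝ} (hp : Periodic A T) : Periodic (deriv A) T := fun x => by
  rw [← deriv_comp_add_const]
  congr 1; ext y; exact hp y

lemma integrable_mul_prod {T : ℝ} {U : ℝ × ℝ → ℝ} (hU : Integrable U (squareMeasure T))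
    {A B : ℝ → ℝ} (hA : Continuous A) (hB : Continuous B) {C D : ℝ} (hC : ∀ x, |A x| ≤ C)
    (hD : ∀ x, |B x| ≤ D) : Integrable (fun z => U z * (A z.1 * B z.2)) (squareMeasure T) := by
  simpa [mul_assoc] using integrable_mul_snd (integrable_mul_fst hU hA.measurable hC)
    hB.measurable hD

/-- The four terms of `oddProduct` are images of one under the swap and the diagonal half-period,
which preserve the measure; `U` transforms with the same signs. Hence testing with antisymmetrized
products is no loss. -/
lemma integral_mul_oddProduct {U : ℝ × ℝ → ℝ} (hU : Integrable U (squareMeasure (4 * π)))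
    (hodd : IsOddPeriodic U) {A B : ℝ → ℝ} (hA : Continuous A) (hB : Continuous B)
    (hpA : Periodic A (4 * π)) (hpB : Periodic B (4 * π)) :
    ∫ z, U z * oddProduct A B z ∂(squareMeasure (4 * π)) =
      4 * ∫ z, U z * (A z.1 * B z.2) ∂(squareMeasure (4 * π)) := by
  have hT : 0 < 4 * π := by positivity
  obtain ⟨C, hC⟩ := exists_bound_of_periodic hT hA hpA
  obtain ⟨D, hD⟩ := exists_bound_of_periodic hT hB hpB
  let E : ℝ × ℝ → ℝ := fun z => U z * (A z.1 * B z.2)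
  have hE : Integrable E (squareMeasure (4 * π)) := integrable_mul_prod hU hA hB hC hD
  have hEp : IsBiperiodic (4 * π) E := by
    constructor <;> intro x y
    · simp only [E, hodd.biperiodic.1, hpA x]
    · simp only [E, hodd.biperiodic.2, hpB y]
  have hmp := measurePreserving_torusShift hT (2 * π)
  have hshift : ∫ z, E (z + (2 * π, 2 * π)) ∂(squareMeasure (4 * π)) =
      ∫ z, E z ∂(squareMeasure (4 * π)) := by
    conv_rhs => rw [← hmp.map_eq]
    rw [integral_map hmp.aemeasurable (by rw [hmp.map_eq]; exact hE.aestronglyMeasurable)]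
    simp only [hEp.apply_torusShift hT]
  have iS : Integrable (fun z => E (z + (2 * π, 2 * π))) (squareMeasure (4 * π)) :=
    hEp.integrable_shift hT hE _
  have hsum : ∀ z, U z * oddProduct A B z = E z + E (z + (2 * π, 2 * π)) +
      (E z.swap + E (z.swap + (2 * π, 2 * π))) := by
    intro z
    have h1 : U (z + (2 * π, 2 * π)) = U z := hodd.time z.1 z.2
    have h2 : U (z.swap + (2 * π, 2 * π)) = -U z := (hodd.time z.2 z.1).trans (hodd.swap z)
    simp only [E, h1, h2, hodd.swap, oddProduct, Prod.fst_add, Prod.snd_add, Prod.fst_swap,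
      Prod.snd_swap]
    ring
  simp only [hsum]
  rw [integral_add (f := fun z => E z + E (z + (2 * π, 2 * π)))
    (g := fun z => E z.swap + E (z.swap + (2 * π, 2 * π))) (hE.add iS) (hE.swap.add iS.swap),
    integral_square_swap (fun z => E z + E (z + (2 * π, 2 * π))), integral_add hE iS, hshift]
  ring

/-- The weak formulation on `Ω` in characteristic coordinates. -/
lemma isWeakWave_oddExtension {u k : ℝ × ℝ → ℝ} (hu : IntegrableOn u Omega)
    (hk : IntegrableOn k Omega)
    (hweak : ∀ φ, IsTestFunction φ → ∫ z in Omega, (u z * dAlembert φ z + k z * φ z) = 0) :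
    IsWeakWave (4 * π) (oddExtension u) (oddExtension k) := by
  intro A B hA hB hpA hpB
  have hT : 0 < 4 * π := by positivity
  have hA' : Continuous (deriv A) := hA.continuous_deriv (by norm_num)
  have hB' : Continuous (deriv B) := hB.continuous_deriv (by norm_num)
  have hpA' := deriv_periodic hpA
  have hpB' := deriv_periodic hpB
  have hU := integrable_oddExtension hu
  have hK := integrable_oddExtension hk
  have oU := isOddPeriodic_oddExtension u
  have oK := isOddPeriodic_oddExtension k
  obtain ⟨C, hC⟩ := exists_bound_of_periodic hT hA.continuous hpA
  obtain ⟨D, hD⟩ := exists_bound_of_periodic hT hB.continuous hpB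
  obtain ⟨C', hC'⟩ := exists_bound_of_periodic hT hA' hpA'
  obtain ⟨D', hD'⟩ := exists_bound_of_periodic hT hB' hpB'
  have h0 := hweak _ (isTestFunction_oddTest hA hB hpA hpB)
  simp only [dAlembert_oddTest hA hB] at h0
  have hc1 : Continuous (oddTest (deriv A) (deriv B)) := by
    unfold oddTest oddProduct; fun_prop
  have hc2 : Continuous (oddTest A B) := (contDiff_oddTest hA hB).continuous
  have hm : AEStronglyMeasurable (fun z => u z * (4 * oddTest (deriv A) (deriv B) z) +
      k z * oddTest A B z) (volume.restrict Omega) :=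
    (hu.aestronglyMeasurable.mul (hc1.aestronglyMeasurable.const_mul 4)).add
      (hk.aestronglyMeasurable.mul hc2.aestronglyMeasurable)
  -- Pulled back to the torus, each of the two terms is a product of two odd periodic functions. The
  -- signs can therefore be distributed so that the odd extensions appear.
  have h1 := integral_comp_foldMap hm
  rw [h0, mul_zero] at h1
  have o1 := isOddPeriodic_oddProduct hpA' hpB'
  have o2 := isOddPeriodic_oddProduct hpA hpB
  have hpt : ∀ z, u (foldMap z) * (4 * oddTest (deriv A) (deriv B) (foldMap z)) +
      k (foldMap z) * oddTest A B (foldMap z) =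
      4 * (oddExtension u z * oddProduct (deriv A) (deriv B) z) +
        oddExtension k z * oddProduct A B z := by
    intro z
    rw [← mul_apply_foldMap o1, ← mul_apply_foldMap o2, oddTest, oddTest]
    ring
  simp only [hpt] at h1
  have ib : ∀ {X : ℝ × ℝ → ℝ} {a b : ℝ → ℝ} {c d : ℝ}, Integrable X (squareMeasure (4 * π)) →
      Continuous a → Continuous b → (∀ x, |a x| ≤ c) → (∀ x, |b x| ≤ d) →
      Integrable (fun z => X z * oddProduct a b z) (squareMeasure (4 * π)) := by
    intro X a b c d hX ha hb hc hd
    refine hX.mul_bdd (c := c * d + c * d + c * d + c * d) ?_ (Eventually.of_forall fun z => ?_)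
    · refine Continuous.aestronglyMeasurable ?_
      unfold oddProduct; fun_prop
    · have hab : ∀ x y, |a x * b y| ≤ c * d := fun x y => by
        rw [abs_mul]
        exact mul_le_mul (hc x) (hd y) (abs_nonneg _) ((abs_nonneg _).trans (hc x))
      unfold oddProduct
      exact (abs_sub _ _).trans (add_le_add ((abs_sub _ _).trans (add_le_add
        ((abs_add_le _ _).trans (add_le_add (hab _ _) (hab _ _))) (hab _ _))) (hab _ _))
  rw [integral_add ((ib hU hA' hB' hC' hD').const_mul 4)
    (ib hK hA.continuous hB.continuous hC hD), integral_const_mul,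
    integral_mul_oddProduct hU oU hA' hB' hpA' hpB',
    integral_mul_oddProduct hK oK hA.continuous hB.continuous hpA hpB] at h1
  simp only [mul_assoc (4 : ℝ) (oddExtension u _)]
  rw [integral_add ((integrable_mul_prod hU hA' hB' hC' hD').const_mul 4)
    (integrable_mul_prod hK hA.continuous hB.continuous hC hD), integral_const_mul]
  linarith

/-! ### The folded nonlinearity and the system satisfied by the odd extensions. -/

/-- The nonlinearity in characteristic coordinates. -/
noncomputable def foldNonlinearity (f : ℝ → ℝ → ℝ → ℝ) (z : ℝ × ℝ) (r : ℝ) : ℝ :=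
  foldSign z * f (foldMap z).1 (foldMap z).2 (foldSign z * r)

lemma foldNonlinearity_oddExtension (f : ℝ → ℝ → ℝ → ℝ) (u : ℝ × ℝ → ℝ) (z : ℝ × ℝ) :
    foldNonlinearity f z (oddExtension u z) = oddExtension (fun w => f w.1 w.2 (u w)) z := by
  unfold foldNonlinearity oddExtension
  rcases foldSign_cases z with h | h | h <;> simp [h]

/-- Regularity of the nonlinearity is given on one closed period only. A step that wraps around is
split at the endpoint, where the values at `0` and `P` coincide. -/
lemma abs_sub_le_of_periodic {P L : ℝ} (hP : 0 < P) {g : ℝ → ℝ} (hg : Periodic g P)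
    (hL : 0 ≤ L) (h : ∀ s ∈ Icc 0 P, ∀ s' ∈ Icc 0 P, |g s - g s'| ≤ L * |s - s'|) (t d : ℝ)
    (hd : 0 ≤ d) : |g (t + d) - g t| ≤ L * d := by
  rw [← hg.apply_wrap hP (t + d), ← hg.apply_wrap hP t]
  have m1 := wrap_mem hP (t + d)
  have m2 := wrap_mem hP t
  have e1 := wrap_eq_sub hP (t + d)
  have e2 := wrap_eq_sub hP t
  set s' := wrap P (t + d)
  set s := wrap P t
  obtain ⟨m, hm⟩ : ∃ m : ℤ, d = s' - s + m * P := ⟨⌊(t + d) / P⌋ - ⌊t / P⌋, by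
    rw [e1, e2]; push_cast; ring⟩
  rcases le_or_gt s s' with hs | hs
  · have hm0 : 0 ≤ m := by
      by_contra hneg
      have : (m : ℝ) ≤ -1 := by exact_mod_cast (by omega : m ≤ -1)
      nlinarith [m1.2, m2.1]
    have hm0' : (0 : ℝ) ≤ m := by exact_mod_cast hm0
    refine (h s' (Ico_subset_Icc_self m1) s (Ico_subset_Icc_self m2)).trans ?_
    rw [abs_of_nonneg (sub_nonneg.2 hs)]
    exact mul_le_mul_of_nonneg_left (by nlinarith) hL
  · have hm0 : 1 ≤ m := by
      by_contra hneg
      have : (m : ℝ) ≤ 0 := by exact_mod_cast (by omega : m ≤ 0)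
      nlinarith
    have hm0' : (1 : ℝ) ≤ m := by exact_mod_cast hm0
    have h0 : g P = g 0 := by simpa using hg 0
    have k1 := h s' (Ico_subset_Icc_self m1) 0 ⟨le_rfl, hP.le⟩
    have k2 := h P ⟨hP.le, le_rfl⟩ s (Ico_subset_Icc_self m2)
    rw [sub_zero, abs_of_nonneg m1.1] at k1
    rw [h0, abs_of_nonneg (sub_nonneg.2 m2.2.le)] at k2
    calc |g s' - g s| ≤ |g s' - g 0| + |g 0 - g s| := abs_sub_le _ _ _
      _ ≤ L * s' + L * (P - s) := add_le_add k1 k2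
      _ = L * (s' + (P - s)) := by ring
      _ ≤ L * d := mul_le_mul_of_nonneg_left (by nlinarith) hL

lemma exists_lipschitz_foldNonlinearity {f : ℝ → ℝ → ℝ → ℝ} {p c₀ : ℝ} (hf : IsSuperlinear f p c₀)
    (hf1 : ContDiffOn ℝ 1 (fun z : (ℝ × ℝ) × ℝ => f z.1.1 z.1.2 z.2) (Omega ×ˢ univ)) (R : ℝ) :
    ∃ L : ℝ, 0 ≤ L ∧ ∀ z h r r', 0 ≤ h → |r| ≤ R → |r'| ≤ R →
      |foldNonlinearity f (z + (h, h)) r - foldNonlinearity f z r'| ≤ L * (h + |r - r'|) := by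
  have hconv : Convex ℝ (Omega ×ˢ Icc (-R) R) :=
    ((convex_Icc _ _).prod (convex_Icc _ _)).prod (convex_Icc _ _)
  have hcomp : IsCompact (Omega ×ˢ Icc (-R) R) := (isCompact_Icc.prod isCompact_Icc).prod
    isCompact_Icc
  obtain ⟨L, hL⟩ := (hf1.mono (prod_mono_right (subset_univ (Icc (-R) R)))).exists_lipschitzOnWith
    one_ne_zero hconv hcomp
  refine ⟨L, L.2, fun z h r r' hh hr hr' => ?_⟩
  set σ := foldSign z with hσ
  have hσr : ∀ r, |r| ≤ R → |σ * r| ≤ R := fun r hr => by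
    rw [abs_mul]
    exact (mul_le_of_le_one_left (abs_nonneg _) (abs_foldSign_le z)).trans hr
  set x := (foldMap z).2 with hx
  have hxm : x ∈ Icc 0 π := (foldMap_mem z).2
  have e1 : foldNonlinearity f (z + (h, h)) r = σ * f ((z.1 + z.2) / 2 + h) x (σ * r) := by
    have hper : Periodic (fun t => f t x (σ * r)) (2 * π) := fun t => hf.periodic t x hxm _
    have a1 : foldSign (z + (h, h)) = σ := foldSign_time z.1 z.2 h
    have a2 : foldMap (z + (h, h)) = _ := foldMap_time z.1 z.2 h
    rw [foldNonlinearity, a1, a2]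
    congr 1
    exact hper.apply_wrap Real.two_pi_pos _
  have e2 : foldNonlinearity f z r' = σ * f (foldMap z).1 x (σ * r') := rfl
  have e3 : f ((z.1 + z.2) / 2) x (σ * r) = f (foldMap z).1 x (σ * r) := by
    have hper : Periodic (fun t => f t x (σ * r)) (2 * π) := fun t => hf.periodic t x hxm _
    exact (hper.apply_wrap Real.two_pi_pos _).symm
  have d1 : |f ((z.1 + z.2) / 2 + h) x (σ * r) - f ((z.1 + z.2) / 2) x (σ * r)| ≤ L * h := by
    refine abs_sub_le_of_periodic Real.two_pi_pos (g := fun t => f t x (σ * r))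
      (fun t => hf.periodic t x hxm _) L.2 (fun s hs s' hs' => ?_) _ _ hh
    have := hL.dist_le_mul ((s, x), σ * r) ⟨⟨hs, hxm⟩, abs_le.1 (hσr r hr)⟩
      ((s', x), σ * r) ⟨⟨hs', hxm⟩, abs_le.1 (hσr r hr)⟩
    simpa [Prod.dist_eq, Real.dist_eq] using this
  have d2 : |f (foldMap z).1 x (σ * r) - f (foldMap z).1 x (σ * r')| ≤ L * |r - r'| := by
    have := hL.dist_le_mul (foldMap z, σ * r) ⟨foldMap_mem z, abs_le.1 (hσr r hr)⟩
      (foldMap z, σ * r') ⟨foldMap_mem z, abs_le.1 (hσr r' hr')⟩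
    rw [Prod.dist_eq, dist_self, max_eq_right dist_nonneg, Real.dist_eq, Real.dist_eq,
      ← mul_sub, abs_mul] at this
    exact this.trans (mul_le_mul_of_nonneg_left
      (mul_le_of_le_one_left (abs_nonneg _) (abs_foldSign_le z)) L.2)
  rw [e1, e2, ← mul_sub, abs_mul]
  refine (mul_le_of_le_one_left (abs_nonneg _) (abs_foldSign_le z)).trans ?_
  rw [mul_add]
  refine le_trans ?_ (add_le_add d1 d2)
  rw [e3]
  exact abs_sub_le _ _ _

lemma isWaveComponent_oddExtension {b ε : ℝ} {f : ℝ → ℝ → ℝ → ℝ} {p c₀ : ℝ} (hp : 0 ≤ p)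
    (hc₀ : 0 ≤ c₀) (hf : IsSuperlinear f p c₀)
    (hf1 : ContDiffOn ℝ 1 (fun z : (ℝ × ℝ) × ℝ => f z.1.1 z.1.2 z.2) (Omega ×ˢ univ))
    {u v : ℝ × ℝ → ℝ} (hu : Measurable u) (hui : IntegrableOn u Omega)
    (hvi : IntegrableOn v Omega) (hfi : IntegrableOn (fun z => f z.1 z.2 (u z)) Omega)
    (hweak : ∀ φ : ℝ × ℝ → ℝ, IsTestFunction φ →
      ∫ z in Omega, (u z * dAlembert φ z + b * u z * φ z + ε * v z * φ z
        + f z.1 z.2 (u z) * φ z) = 0) :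
    IsWaveComponent (4 * π) b ε (oddExtension u) (oddExtension v) (foldNonlinearity f) where
  measurable := measurable_foldSign.mul (hu.comp measurable_foldMap)
  integrable := integrable_oddExtension hui
  antisymm := (isOddPeriodic_oddExtension u).swap
  biperiodic := (isOddPeriodic_oddExtension u).biperiodic
  monotone z r r' hr := by
    have hmono := hf.monotone (foldMap z).1 (foldMap z).2 (foldMap_mem z).2
    unfold foldNonlinearity
    -- For sign `-1` the order is reversed twice, inside and outside, so monotonicity is kept.
    rcases foldSign_cases z with h | h | h <;> rw [h]
    · have := hmono (show -1 * r' ≤ -1 * r by linarith)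
      linarith
    · simp
    · have := hmono (show 1 * r ≤ 1 * r' by linarith)
      linarith
  bounded R := by
    refine ⟨c₀ * (1 + |R| ^ p), fun z r hr => ?_⟩
    unfold foldNonlinearity
    rw [abs_mul]
    refine (mul_le_of_le_one_left (abs_nonneg _) (abs_foldSign_le z)).trans
      ((hf.growth _ _ (foldMap_mem z).2 _).trans ?_)
    have : |foldSign z * r| ≤ |R| := by
      rw [abs_mul]
      exact (mul_le_of_le_one_left (abs_nonneg _) (abs_foldSign_le z)).trans
        (hr.trans (le_abs_self R))
    gcongr
  lipschitz := exists_lipschitz_foldNonlinearity hf hf1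
  biperiodic_nonlinearity := by
    constructor <;> intro x y <;> ext r <;> unfold foldNonlinearity
    · rw [foldSign_biperiodic.1, foldMap_biperiodic.1]
    · rw [foldSign_biperiodic.2, foldMap_biperiodic.2]
  integrable_nonlinearity := by
    simp only [foldNonlinearity_oddExtension]
    exact integrable_oddExtension hfi
  weak := by
    have h := isWeakWave_oddExtension (u := u)
      (k := fun z => b * u z + ε * v z + f z.1 z.2 (u z)) hui
      (((hui.const_mul b).add (hvi.const_mul ε)).add hfi) (fun φ hφ => by
        rw [← hweak φ hφ]
        refine integral_congr_ae (Eventually.of_forall fun z => ?_)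
        simp only; ring)
    convert h using 2 with z
    rw [foldNonlinearity_oddExtension]
    simp only [oddExtension]; ring

/-! ### Return to the rectangle: the regular splitting and the conclusion. -/

lemma ae_foldSign_mul_self : ∀ᵐ z ∂(squareMeasure (4 * π)), foldSign z * foldSign z = 1 := by
  have h1 : ∀ᵐ z ∂((volume : Measure (ℝ × ℝ)).restrict Omega), z.2 ∈ Ioo 0 π := by
    rw [Omega, Measure.volume_eq_prod, ← Measure.prod_restrict]
    refine Measure.quasiMeasurePreserving_snd.ae ?_
    rw [← restrict_Ioo_eq_restrict_Icc]
    exact ae_restrict_mem measurableSet_Ioo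
  have hodd : IsOddPeriodic (fun z => Real.sin ((z.1 - z.2) / 2)) := by
    refine ⟨fun z => ?_, fun x y => ?_, fun x y => ?_⟩
    · rw [← Real.sin_neg, Prod.fst_swap, Prod.snd_swap]; congr 1; ring
    · simp only; congr 1; ring
    · simp only
      rw [← Real.sin_add_two_pi ((x - y) / 2)]; congr 1; ring
  filter_upwards [ae_foldMap h1] with z hz
  have h2 := hodd.apply_foldMap z
  have h3 : 0 < Real.sin (foldMap z).2 := Real.sin_pos_of_pos_of_lt_pi hz.1 hz.2
  simp only [show ∀ a b : ℝ, (a + b - (a - b)) / 2 = b from fun a b => by ring] at h2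
  rcases foldSign_cases z with h | h | h
  · rw [h]; norm_num
  · rw [h, zero_mul] at h2; exact absurd h2 h3.ne'
  · rw [h]; norm_num

/-- The kernel is symmetric and depends on differences only, so the convolution inherits the
symmetries of the source. The half-period `2π` is not a period of the sawtooth and needs a change of
variables on the torus. -/
lemma isOddPeriodic_waveInverse {H : ℝ × ℝ → ℝ} (hH : Integrable H (squareMeasure (4 * π)))
    (hodd : IsOddPeriodic H) : IsOddPeriodic (waveInverse (4 * π) H) := by
  have hT : 0 < 4 * π := by positivity
  have htime : ∀ x y, waveInverse (4 * π) H (x + 2 * π, y + 2 * π) =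
      waveInverse (4 * π) H (x, y) := by
    intro x y
    let E : ℝ × ℝ → ℝ := fun s =>
      saw (4 * π) (x + 2 * π - s.1) * saw (4 * π) (y + 2 * π - s.2) * H s
    have hE : Integrable E (squareMeasure (4 * π)) :=
      integrable_waveKernel_mul hH (x + 2 * π, y + 2 * π)
    have hs : ∀ c s, saw (4 * π) (c - (s + 4 * π)) = saw (4 * π) (c - s) := fun c s => by
      rw [← saw_periodic hT (c - (s + 4 * π))]; congr 1; ring
    have hEp : IsBiperiodic (4 * π) E := by
      constructor <;> intro a c
      · simp only [E, hs, hodd.biperiodic.1]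
      · simp only [E, hs, hodd.biperiodic.2]
    have hmp := measurePreserving_torusShift hT (2 * π)
    have hshift : ∫ z, E z ∂(squareMeasure (4 * π)) =
        ∫ z, E (z + (2 * π, 2 * π)) ∂(squareMeasure (4 * π)) := by
      conv_lhs => rw [← hmp.map_eq]
      rw [integral_map hmp.aemeasurable (by rw [hmp.map_eq]; exact hE.aestronglyMeasurable)]
      simp only [hEp.apply_torusShift hT]
    unfold waveInverse
    congr 1
    refine hshift.trans (integral_congr_ae (Eventually.of_forall fun s => ?_))
    have hH : H (s + (2 * π, 2 * π)) = H s := hodd.time s.1 s.2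
    simp only [E, hH, Prod.fst_add, Prod.snd_add, add_sub_add_right_eq_sub]
  refine ⟨fun z => ?_, htime, fun x y => ?_⟩
  · change waveInverse (4 * π) H (z.2, z.1) = -waveInverse (4 * π) H (z.1, z.2)
    rw [waveInverse_swap]
    simp only [hodd.swap, waveInverse, mul_neg, integral_neg]
  · rw [← waveInverse_add_snd hT (x + 2 * π) (y - 2 * π), ← htime x y]
    congr 2; ring

/-- A shift of the first variable by `2π` can be traded for one of the second, over which the mean
is taken. This halves the a priori period `4π`. -/
lemma kernelPart_periodic_two_pi {U : ℝ × ℝ → ℝ} (hodd : IsOddPeriodic U) :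
    Periodic (kernelPart (4 * π) U) (2 * π) := fun x => by
  have h1 : ∀ y, U (x + 2 * π, y) = U (x, y + 2 * π) := fun y => by
    rw [← hodd.time, ← hodd.biperiodic.1 x]
    congr 2; ring
  have h2 : Periodic (fun y => U (x, y)) (4 * π) := fun y => hodd.biperiodic.2 x y
  simp only [kernelPart, periodMean, h1]
  rw [integral_periodMeasure_add (by positivity) h2]

/-- A mode of the kernel of the d'Alembertian integrates to zero against a margin-free function. -/
lemma integral_mul_sub_eq_zero {T : ℝ} {G : ℝ × ℝ → ℝ} (hG : Integrable G (squareMeasure T))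
    (hfree : IsMarginFree T G) {a : ℝ → ℝ} (ha : Measurable a) (ha1 : ∀ x, |a x| ≤ 1) (c : ℝ) :
    ∫ z, G z * (c * (a z.1 - a z.2)) ∂(squareMeasure T) = 0 := by
  have e : ∀ z : ℝ × ℝ, G z * (c * (a z.1 - a z.2)) = c * (G z * a z.1 - G z * a z.2) :=
    fun z => by ring
  simp only [e]
  rw [integral_const_mul, integral_sub (integrable_mul_fst hG ha ha1)
    (integrable_mul_snd hG ha ha1), (hfree a ha ha1).1, (hfree a ha ha1).2]
  simp

lemma isOddPeriodic_sub {a : ℝ → ℝ} (ha : Periodic a (2 * π)) (c : ℝ) :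
    IsOddPeriodic (fun z => c * (a z.1 - a z.2)) := by
  refine ⟨fun z => ?_, fun x y => ?_, fun x y => ?_⟩
  · simp only [Prod.fst_swap, Prod.snd_swap]; ring
  · simp only [ha x, ha y]
  · simp only [ha x, ha.sub_eq y]

lemma isFiniteMeasure_restrict_Omega :
    IsFiniteMeasure ((volume : Measure (ℝ × ℝ)).restrict Omega) :=
  ⟨by
    rw [Measure.restrict_apply_univ]
    exact (isCompact_Icc.prod isCompact_Icc).measure_lt_top⟩

/-- Both factors are odd under folding, so their signs cancel almost everywhere and the integral
becomes one over the torus, where margin-freeness applies. -/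
lemma integral_Omega_mul_eq_zero {W : ℝ × ℝ → ℝ} (hW : IsOddPeriodic W) (hWc : Continuous W)
    (hWi : Integrable W (squareMeasure (4 * π))) (hfree : IsMarginFree (4 * π) W)
    {a : ℝ → ℝ} (ha : Continuous a) (ha1 : ∀ x, |a x| ≤ 1) (hp : Periodic a (2 * π)) (c : ℝ) :
    ∫ z in Omega, W (z.1 + z.2, z.1 - z.2) * (c * (a (z.1 + z.2) - a (z.1 - z.2))) = 0 := by
  have hm : Continuous (fun z : ℝ × ℝ =>
      W (z.1 + z.2, z.1 - z.2) * (c * (a (z.1 + z.2) - a (z.1 - z.2)))) := by fun_prop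
  have h1 := integral_comp_foldMap (hm.aestronglyMeasurable (μ := volume.restrict Omega))
  have h2 : ∫ z, W ((foldMap z).1 + (foldMap z).2, (foldMap z).1 - (foldMap z).2) *
      (c * (a ((foldMap z).1 + (foldMap z).2) - a ((foldMap z).1 - (foldMap z).2)))
      ∂(squareMeasure (4 * π)) = 0 := by
    rw [← integral_mul_sub_eq_zero hWi hfree ha.measurable ha1 c]
    refine integral_congr_ae ?_
    filter_upwards [ae_foldSign_mul_self] with z hz
    have e1 := hW.apply_foldMap z
    have e2 := (isOddPeriodic_sub hp c).apply_foldMap z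
    simp only at e2
    rw [e1, e2]
    linear_combination W z * (c * (a z.1 - a z.2)) * hz
  rw [h2] at h1
  linarith

lemma IsWaveComponent.hasRegularSplitting {b ε : ℝ} {u : ℝ × ℝ → ℝ} {V : ℝ × ℝ → ℝ}
    {F G : ℝ × ℝ → ℝ → ℝ} (hu : Measurable u) (hε : 2 * |ε| < b)
    (hS : IsWaveComponent (4 * π) b ε (oddExtension u) V F)
    (hS' : IsWaveComponent (4 * π) b ε V (oddExtension u) G)
    (hsource : IsOddPeriodic fun z => b * oddExtension u z + ε * V z + F z (oddExtension u z)) :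
    HasRegularSplitting u := by
  have hT : 0 < 4 * π := by positivity
  obtain ⟨L, R, hRL, hRT, hPR⟩ := hS.exists_lipschitz_kernelPart hT hε hS'
  obtain ⟨K, hK0, hK⟩ := hS.exists_waveInverse_lipschitz hT hε hS'
  have hH := hS.integrable_source hS'.integrable
  have hdec := hS.decomposition hT hS'.integrable
  have hfree := (hS.weak.isMarginFree hT hH).waveInverse hT hH
  have hWi := integrable_waveInverse hH
  have hbd := abs_waveInverse_le hH
  have hW := isOddPeriodic_waveInverse hH hsource
  set W := waveInverse (4 * π) fun z => b * oddExtension u z + ε * V z + F z (oddExtension u z)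
  have hRc : Continuous R := hRL.continuous
  have hR2 : Periodic R (2 * π) := by
    have h1 : (fun s => R (s + 2 * π)) =ᵐ[volume] R := by
      have := (measurePreserving_add_right (volume : Measure ℝ)
        (2 * π)).quasiMeasurePreserving.ae hPR
      filter_upwards [hPR, this] with s hs hs'
      rw [← hs, ← hs', kernelPart_periodic_two_pi (isOddPeriodic_oddExtension u)]
    exact congrFun (((hRc.comp (continuous_add_const _)).ae_eq_iff_eq volume hRc).1 h1)
  -- The integral over `4π` vanishes by antisymmetry of the extension, and it is twice the integral
  -- over `2π`.
  have hmean : ∫ s in (0 : ℝ)..(2 * π), R s = 0 := by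
    have h1 : ∫ s, R s ∂(periodMeasure (4 * π)) = 0 := by
      rw [← integral_kernelPart hS.integrable hS.antisymm]
      exact integral_congr_ae (ae_periodMeasure_of_ae (hPR.mono fun _ h => h.symm))
    rw [← intervalIntegral.integral_of_le hT.le] at h1
    have h2 := hR2.intervalIntegral_add_eq (2 * π) 0
    rw [zero_add, show 2 * π + 2 * π = 4 * π by ring] at h2
    rw [← intervalIntegral.integral_add_adjacent_intervals
      (hRc.intervalIntegrable 0 (2 * π)) (hRc.intervalIntegrable (2 * π) (4 * π)), h2] at h1
    linarith
  -- In the maximum metric each characteristic coordinate changes by at most twice the distance.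
  have hLip : LipschitzWith ⟨4 * K, by positivity⟩ (fun z : ℝ × ℝ => W (z.1 + z.2, z.1 - z.2)) := by
    refine LipschitzWith.of_dist_le_mul fun z z' => ?_
    have h1 := hK (z.1 + z.2, z.1 - z.2) (z'.1 + z'.2, z'.1 - z'.2)
    have d1 : |z.1 - z'.1| ≤ dist z z' := by
      rw [Prod.dist_eq, ← Real.dist_eq]; exact le_max_left _ _
    have d2 : |z.2 - z'.2| ≤ dist z z' := by
      rw [Prod.dist_eq, ← Real.dist_eq]; exact le_max_right _ _
    have d3 : |z.1 + z.2 - (z'.1 + z'.2)| ≤ 2 * dist z z' := by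
      rw [show z.1 + z.2 - (z'.1 + z'.2) = (z.1 - z'.1) + (z.2 - z'.2) by ring]
      exact (abs_add_le _ _).trans (by linarith)
    have d4 : |z.1 - z.2 - (z'.1 - z'.2)| ≤ 2 * dist z z' := by
      rw [show z.1 - z.2 - (z'.1 - z'.2) = (z.1 - z'.1) - (z.2 - z'.2) by ring]
      exact (abs_sub _ _).trans (by linarith)
    rw [Real.dist_eq]
    refine h1.trans ((mul_le_mul_of_nonneg_left (add_le_add d3 d4) hK0).trans_eq ?_)
    change K * _ = 4 * K * _
    ring
  have hWc : Continuous W := by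
    have : W = (fun z : ℝ × ℝ => W (z.1 + z.2, z.1 - z.2)) ∘
        fun ζ : ℝ × ℝ => ((ζ.1 + ζ.2) / 2, (ζ.1 - ζ.2) / 2) := by
      ext ζ
      simp only [comp_apply]
      congr 1
      ext <;> simp only <;> ring
    rw [this]
    exact hLip.continuous.comp (by fun_prop)
  have hperj : ∀ (j : ℕ) (x : ℝ), (j : ℝ) * (x + 2 * π) = j * x + j * (2 * π) := fun j x => by ring
  refine ⟨fun z => W (z.1 + z.2, z.1 - z.2), R, ⟨?_, fun j _ => ⟨?_, ?_⟩⟩,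
    ⟨_, hLip.lipschitzOnWith⟩, hRc, hR2, hmean, ?_⟩
  · have := isFiniteMeasure_restrict_Omega
    exact MemLp.of_bound hLip.continuous.aestronglyMeasurable _ (Eventually.of_forall fun z => hbd _)
  -- Here `sin(jx) cos(jt) = (sin j(t+x) - sin j(t-x)) / 2`; below, `sin(jx) sin(jt) = -(cos j(t+x)
  -- - cos j(t-x)) / 2`.
  · rw [← integral_Omega_mul_eq_zero hW hWc hWi hfree (a := fun x => Real.sin (j * x))
      (by fun_prop) (fun x => Real.abs_sin_le_one _)
      (fun x => by simp only [hperj, Real.sin_add_nat_mul_two_pi]) (1 / 2)]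
    refine integral_congr_ae (Eventually.of_forall fun z => ?_)
    simp only [mul_add, mul_sub, Real.sin_add, Real.sin_sub]
    ring
  · rw [← integral_Omega_mul_eq_zero hW hWc hWi hfree (a := fun x => Real.cos (j * x))
      (by fun_prop) (fun x => Real.abs_cos_le_one _)
      (fun x => by simp only [hperj, Real.cos_add_nat_mul_two_pi]) (-(1 / 2))]
    refine integral_congr_ae (Eventually.of_forall fun z => ?_)
    simp only [mul_add, mul_sub, Real.cos_add, Real.cos_sub]
    ring
  · have hmeas : MeasurableSet {z : ℝ × ℝ |
        u z = W (z.1 + z.2, z.1 - z.2) + (R (z.1 + z.2) - R (z.1 - z.2))} :=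
      measurableSet_eq_fun hu (by fun_prop)
    have hPR' := ae_periodMeasure_of_ae (T := 4 * π) hPR
    have hae : ∀ᵐ z ∂(squareMeasure (4 * π)),
        u (foldMap z) = W ((foldMap z).1 + (foldMap z).2, (foldMap z).1 - (foldMap z).2) +
          (R ((foldMap z).1 + (foldMap z).2) - R ((foldMap z).1 - (foldMap z).2)) := by
      filter_upwards [hdec, ae_foldSign_mul_self, ae_square_fst hPR', ae_square_snd hPR']
        with z h1 h2 h3 h4
      have e1 := hW.apply_foldMap z
      have e2 := (isOddPeriodic_sub hR2 1).apply_foldMap z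
      simp only [one_mul] at e2
      rw [h3, h4, oddExtension] at h1
      rw [e1, e2]
      linear_combination foldSign z * h1 - u (foldMap z) * h2
    -- The image of the torus measure is `8` times Lebesgue measure on the rectangle, so the two
    -- have the same null sets.
    have hmap := (ae_map_iff measurable_foldMap.aemeasurable hmeas).2 hae
    rw [measurePreserving_foldMap.map_eq, Measure.ae_ennreal_smul_measure_eq (by norm_num)] at hmap
    exact hmap

lemma HasRegularSplitting.congr {u u' : ℝ × ℝ → ℝ} (h : HasRegularSplitting u')
    (hu : u =ᵐ[volume.restrict Omega] u') : HasRegularSplitting u := by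
  obtain ⟨w, P, h1, h2, h3, h4, h5, h6⟩ := h
  exact ⟨w, P, h1, h2, h3, h4, h5, hu.trans h6⟩

lemma HasRegularSplitting.isContinuousOnOmega {u : ℝ × ℝ → ℝ} (h : HasRegularSplitting u) :
    IsContinuousOnOmega u := by
  obtain ⟨w, P, -, ⟨C, hC⟩, h3, -, -, h6⟩ := h
  refine ⟨_, hC.continuousOn.add (Continuous.continuousOn ?_), h6⟩
  fun_prop

lemma IsWeakSolution.congr {b ε : ℝ} {f g : ℝ → ℝ → ℝ → ℝ} {u v u' v' : ℝ × ℝ → ℝ}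
    (h : IsWeakSolution b ε f g u v) (hu : u =ᵐ[volume.restrict Omega] u')
    (hv : v =ᵐ[volume.restrict Omega] v') : IsWeakSolution b ε f g u' v' where
  memLp_u := h.memLp_u.ae_eq hu
  memLp_v := h.memLp_v.ae_eq hv
  integrableOn_f := h.integrableOn_f.congr (by filter_upwards [hu] with z hz; rw [hz])
  integrableOn_g := h.integrableOn_g.congr (by filter_upwards [hv] with z hz; rw [hz])
  eq_u φ hφ := by
    rw [← h.eq_u φ hφ]
    refine integral_congr_ae ?_
    filter_upwards [hu, hv] with z h1 h2
    rw [h1, h2]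
  eq_v φ hφ := by
    rw [← h.eq_v φ hφ]
    refine integral_congr_ae ?_
    filter_upwards [hu, hv] with z h1 h2
    rw [h1, h2]

lemma isOddPeriodic_source (b ε : ℝ) (f : ℝ → ℝ → ℝ → ℝ) (u v : ℝ × ℝ → ℝ) :
    IsOddPeriodic fun z => b * oddExtension u z + ε * oddExtension v z +
      foldNonlinearity f z (oddExtension u z) := by
  have : (fun z => b * oddExtension u z + ε * oddExtension v z +
      foldNonlinearity f z (oddExtension u z)) =
      oddExtension fun z => b * u z + ε * v z + f z.1 z.2 (u z) := by
    ext z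
    rw [foldNonlinearity_oddExtension]
    simp only [oddExtension]; ring
  rw [this]
  exact isOddPeriodic_oddExtension _

/-- Weak solutions split into a Lipschitz part and a continuous kernel part if `2 |ε| < b`. -/
lemma IsWeakSolution.hasRegularSplitting {b ε p q c₀ : ℝ} {f g : ℝ → ℝ → ℝ → ℝ}
    {u v : ℝ × ℝ → ℝ} (hp : 0 ≤ p) (hq : 0 ≤ q) (hc₀ : 0 ≤ c₀) (hε : 2 * |ε| < b)
    (hf : IsSuperlinear f p c₀) (hg : IsSuperlinear g q c₀)
    (hf1 : ContDiffOn ℝ 1 (fun z : (ℝ × ℝ) × ℝ => f z.1.1 z.1.2 z.2) (Omega ×ˢ univ))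
    (hg1 : ContDiffOn ℝ 1 (fun z : (ℝ × ℝ) × ℝ => g z.1.1 z.1.2 z.2) (Omega ×ˢ univ))
    (h : IsWeakSolution b ε f g u v) : HasRegularSplitting u ∧ HasRegularSplitting v := by
  -- Solutions are classes modulo null sets; measurable representatives are needed for the
  -- compositions with `foldMap` and for the profiles.
  have hu := h.memLp_u.aestronglyMeasurable.ae_eq_mk
  have hv := h.memLp_v.aestronglyMeasurable.ae_eq_mk
  have mu := h.memLp_u.aestronglyMeasurable.stronglyMeasurable_mk.measurable
  have mv := h.memLp_v.aestronglyMeasurable.stronglyMeasurable_mk.measurable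
  have h' := h.congr hu hv
  set u' := h.memLp_u.aestronglyMeasurable.mk u
  set v' := h.memLp_v.aestronglyMeasurable.mk v
  have := isFiniteMeasure_restrict_Omega
  have iu : IntegrableOn u' Omega := h'.memLp_u.integrable (by norm_num)
  have iv : IntegrableOn v' Omega := h'.memLp_v.integrable (by norm_num)
  have hS := isWaveComponent_oddExtension hp hc₀ hf hf1 mu iu iv h'.integrableOn_f h'.eq_u
  have hS' := isWaveComponent_oddExtension hq hc₀ hg hg1 mv iv iu h'.integrableOn_g h'.eq_v
  exact ⟨(hS.hasRegularSplitting mu hε hS' (isOddPeriodic_source b ε f u' v')).congr hu,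
    (hS'.hasRegularSplitting mv hε hS (isOddPeriodic_source b ε g v' u')).congr hv⟩

end KleinGordon

theorem theorem1p5 (b : ℝ) (hb : 0 < b) (hbL : -b ∉ KleinGordon.sigmaL)
    (f g : ℝ → ℝ → ℝ → ℝ) (p q c₀ : ℝ) (hp : 1 < p) (hq : 1 < q) (hc₀ : 0 < c₀)
    (hf : KleinGordon.IsSuperlinear f p c₀) (hg : KleinGordon.IsSuperlinear g q c₀)
    (hf1 : ContDiffOn ℝ 1 (fun z : (ℝ × ℝ) × ℝ => f z.1.1 z.1.2 z.2)
      (KleinGordon.Omega ×ˢ Set.univ))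
    (hg1 : ContDiffOn ℝ 1 (fun z : (ℝ × ℝ) × ℝ => g z.1.1 z.1.2 z.2)
      (KleinGordon.Omega ×ˢ Set.univ))
    (hfs : ∀ z ∈ KleinGordon.Omega, StrictMono (f z.1 z.2))
    (hgs : ∀ z ∈ KleinGordon.Omega, StrictMono (g z.1 z.2)) :
    ∃ ε₀ > (0 : ℝ), ∀ ε : ℝ, |ε| < ε₀ → ∀ u v : ℝ × ℝ → ℝ,
      KleinGordon.IsWeakSolution b ε f g u v →
        (KleinGordon.IsContinuousOnOmega u ∧ KleinGordon.IsContinuousOnOmega v) ∧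
        (KleinGordon.HasRegularSplitting u ∧ KleinGordon.HasRegularSplitting v) := by
  -- The threshold is exactly the condition `2|ε| < b` of the maximum principle.
  refine ⟨b / 2, by positivity, fun ε hε u v h => ?_⟩
  have hsplit := h.hasRegularSplitting (zero_le_one.trans hp.le) (zero_le_one.trans hq.le) hc₀.le
    (by linarith) hf hg hf1 hg1
  exact ⟨⟨hsplit.1.isContinuousOnOmega, hsplit.2.isContinuousOnOmega⟩, hsplit⟩
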